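/- **Setting.** Fix $\mathbb R^d$ with translations as the only motions. A *prototile* is a labelled compact connected subset of $\mathbb R^d$ that is the closure of its interior and has a boundary of Lebesgue measure $0$ (for example a closed topological disk with null boundary); a *tile* is a translate of a prototile; a *patch* is a finite set of tiles that overlap only on their boundaries and have nonempty connected union; a *tiling* is a set of tiles that overlap only on their boundaries and cover $\mathbb R^d$. A tiling has *finite local complexity* (FLC) if up to translation it contains only finitely many two-tile patches. A *fusion rule* $\mathcal R$ consists, for each $n\ge 0$, of a finite nonempty list of patches $P_n(1),\dots,P_n(j_n)$ (the *$n$-supertiles*, possibly labelled), where the $P_0(i)$ are the prototiles and each $P_{n+1}(l)$ is a patch built (in a fixed way) from translates of $n$-supertiles that overlap only on their boundaries. Let $M_{n,n+1}(k,l)$ be the number of $n$-supertiles of type $k$ in $P_{n+1}(l)$, and $M_{n,N}=M_{n,n+1}\cdots M_{N-1,N}$ for $n<N$. $X^n_{\mathcal R}$ is the space of tilings by translates of $n$-supertiles all of whose patches (of $n$-supertiles) occur, up to translation, in the decomposition of some $N$-supertile into $n$-supertiles; $X_{\mathcal R}=X^0_{\mathcal R}$. These spaces carry the topology in which two tilings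 are $\varepsilon$-close if, after translations of size at most $\varepsilon$, they agree exactly on the ball of radius $1/\varepsilon$ around the origin. It is assumed that $X_{\mathcal R}\neq\emptyset$ and that all its tilings have FLC. $\mathcal R$ is *recognizable* if for every $n\ge1$ the subdivision map $X^n_{\mathcal R}\to X^{n-1}_{\mathcal R}$ (breaking each $n$-supertile into $(n-1)$-supertiles) is a homeomorphism; *primitive* if for each $n$ there is $N>n$ such that all entries of $M_{n,N}$ are positive; *van Hove* if for every choice of one $n$-supertile for each $n$, with supports $A_n$, and every $r\ge0$, $\mathrm{Vol}(\{x:\mathrm{dist}(x,\partial A_n)\le r\})/\mathrm{Vol}(A_n)\to0$. A sequence $\rho=(\rho_n)_{n\ge0}$ of vectors $\rho_n\in\mathbb R^{j_n}$ with nonnegative entries is a sequence of *well-defined supertile frequencies* if $\sum_i\rho_n(i)\mathrm{Vol}(P_n(i))=1$ for all $n$ and $\rho_n=M_{n,N}\rho_N$ for all $n<N$. For a patch $P$ let $\#(P\text{ in }P_n(i))$ be the number of translates of $P$ contained in the patch $P_n(i)$. For a translation-invariant Borel probability measure $\mu$ on $X_{\mathcal R}$, $\mathrm{freq}_\mu(P)\ge0$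 is the number with $\mu(X_{P,U})=\mathrm{freq}_\mu(P)\,\mathrm{Vol}(U)$ for every Borel set $U\subseteq\mathbb R^d$ such that every tiling in $X_{\mathcal R}$ contains $P-v$ for at most one $v\in U$; here $X_{P,U}$ is the set of tilings in $X_{\mathcal R}$ containing $P-v$ for some $v\in U$. For $n<N$ let $D_{n,N}(i,k)=M_{n,N}(i,k)/\sum_l M_{n,N}(l,k)\mathrm{Vol}(P_n(l))$, let $\Delta_{n,N}\subset\mathbb R^{j_n}$ be the convex hull of the columns of $D_{n,N}$, $\Delta_n=\bigcap_{N>n}\Delta_{n,N}$, and let $\Delta_\infty$ be the inverse limit of the $\Delta_n$ under the maps $M_{n,N}$, i.e. the set of sequences $(x_n)$ with $x_n\in\Delta_n$ and $x_n=M_{n,N}x_N$ for all $n<N$. **Theorem.** Let $\mathcal R$ be a recognizable, primitive, van Hove fusion rule. There is a one-to-one correspondence $\mu\leftrightarrow\rho$ between the translation-invariant Borel probability measures on $X_{\mathcal R}$ and the sequences of well-defined supertile frequencies such that for every patch $P$ the frequency $\mathrm{freq}_\mu(P)$ exists and $$\mathrm{freq}_\mu(P)=\lim_{n\to\infty}\sum_{i=1}^{j_n}\#\bigl(P\text{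 in }P_n(i)\bigr)\,\rho_n(i).$$ Moreover, the same correspondence $\mu\mapsto\rho$ is a bijection from the invariant Borel probability measures onto $\Delta_\infty$. -/

import Mathlib

open Set Filter Topology MeasureTheory
open scoped Pointwise

namespace FusionTiling

/-! ### Tiles, patches and tilings

The group of motions is the translation group of Euclidean space. -/

/-- The physical space. -/
abbrev Space (d : ℕ) : Type := EuclideanSpace ℝ (Fin d)

/-- The requirements on the closed set that underlies a prototile: a connected compact set that is
the closure of its interior and has a boundary of measure zero. Every closed topological disk
whose boundary is a null set is of this kind, and so is every finite connected union of such
sets; in particular supertiles may again serve as prototiles. -/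
structure IsPrototile {d : ℕ} (s : Set (Space d)) : Prop where
  isCompact : IsCompact s
  isConnected : IsConnected s
  closure_interior : closure (interior s) = s
  volume_frontier : volume (frontier s) = 0

/-- The set covered by a tile. A tile is a pair `t = (i, v)`: the prototile with label `i`,
translated by `v`. -/
def tileSupp {ι : Type} {d : ℕ} (supp : ι → Set (Space d)) (t : ι × Space d) : Set (Space d) :=
  t.2 +ᵥ supp t.1

/-- The set covered by a set of tiles. -/
def cover {ι : Type} {d : ℕ} (supp : ι → Set (Space d)) (P : Set (ι × Space d)) :
    Set (Space d) :=
  ⋃ t ∈ P, tileSupp supp t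

/-- The translate `P + v` of a set of tiles. -/
def translate {ι : Type} {d : ℕ} (v : Space d) (P : Set (ι × Space d)) : Set (ι × Space d) :=
  (fun t => (t.1, t.2 + v)) '' P

/-- Distinct tiles overlap at most on their boundaries. -/
def NonOverlapping {ι : Type} {d : ℕ} (supp : ι → Set (Space d)) (P : Set (ι × Space d)) : Prop :=
  P.Pairwise fun s t => Disjoint (interior (tileSupp supp s)) (interior (tileSupp supp t))

/-- A patch: a finite set of tiles that overlap only on their boundaries and have a connected
(in particular nonempty) union. -/
structure IsPatch {ι : Type} {d : ℕ} (supp : ι → Set (Space d)) (P : Set (ι × Space d)) :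
    Prop where
  finite : P.Finite
  nonOverlapping : NonOverlapping supp P
  isConnected : IsConnected (cover supp P)

/-- A tiling: a set of tiles that cover the space and overlap only on their boundaries. -/
@[ext]
structure Tiling {ι : Type} {d : ℕ} (supp : ι → Set (Space d)) where
  tiles : Set (ι × Space d)
  cover_eq : cover supp tiles = univ
  nonOverlapping : NonOverlapping supp tiles

/-- Finite local complexity: up to translation the tiling contains only finitely many connected
two-tile patches. -/
def Tiling.HasFLC {ι : Type} {d : ℕ} {supp : ι → Set (Space d)} (T : Tiling supp) : Prop :=
  ∃ F : Set (Set (ι × Space d)), F.Finite ∧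
    ∀ P, IsPatch supp P → P.ncard = 2 → P ⊆ T.tiles → ∃ Q ∈ F, ∃ v, P = translate v Q

section TranslationFacts

variable {ι : Type} {d : ℕ} {supp : ι → Set (Space d)}

theorem mem_translate {v : Space d} {P : Set (ι × Space d)} {t : ι × Space d} :
    t ∈ translate v P ↔ (t.1, t.2 - v) ∈ P := by
  constructor
  · rintro ⟨s, hs, rfl⟩
    simpa using hs
  · intro h
    exact ⟨_, h, by ext1 <;> simp⟩

theorem translate_translate (v w : Space d) (P : Set (ι × Space d)) :
    translate v (translate w P) = translate (w + v) P := by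
  ext t
  simp only [mem_translate]
  rw [show t.2 - v - w = t.2 - (w + v) by abel]

theorem translate_zero (P : Set (ι × Space d)) : translate 0 P = P := by
  ext t
  simp [mem_translate]

theorem translate_mono {v : Space d} {P Q : Set (ι × Space d)} (h : P ⊆ Q) :
    translate v P ⊆ translate v Q :=
  image_mono h

theorem tileSupp_add (i : ι) (v w : Space d) :
    tileSupp supp (i, v + w) = w +ᵥ tileSupp supp (i, v) := by
  simp only [tileSupp, vadd_vadd, add_comm]

theorem cover_translate (v : Space d) (P : Set (ι × Space d)) :
    cover supp (translate v P) = v +ᵥ cover supp P := by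
  simp only [cover, translate, biUnion_image, tileSupp_add, vadd_set_iUnion]

theorem NonOverlapping.translate {P : Set (ι × Space d)} (h : NonOverlapping supp P)
    (v : Space d) : NonOverlapping supp (translate v P) := by
  rintro _ ⟨s, hs, rfl⟩ _ ⟨t, ht, rfl⟩ hne
  have hst : s ≠ t := fun e => hne (by rw [e])
  simp only [tileSupp_add, interior_vadd]
  exact (Set.disjoint_vadd_set (a := v)).2 (h hs ht hst)

theorem IsPatch.translate {P : Set (ι × Space d)} (h : IsPatch supp P) (v : Space d) :
    IsPatch supp (translate v P) where
  finite := h.finite.image _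
  nonOverlapping := h.nonOverlapping.translate v
  isConnected := by
    rw [cover_translate]
    exact h.isConnected.image _ (continuous_const_vadd v).continuousOn

end TranslationFacts

/-- The translate `T + v` of a tiling. -/
def Tiling.translate {ι : Type} {d : ℕ} {supp : ι → Set (Space d)} (v : Space d)
    (T : Tiling supp) : Tiling supp where
  tiles := FusionTiling.translate v T.tiles
  cover_eq := by rw [cover_translate, T.cover_eq, vadd_set_univ]
  nonOverlapping := T.nonOverlapping.translate v

/-- Two tilings agree exactly on a set `K`: they have the same tiles meeting `K`. -/
def Tiling.AgreeOn {ι : Type} {d : ℕ} {supp : ι → Set (Space d)} (K : Set (Space d))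
    (T T' : Tiling supp) : Prop :=
  {t ∈ T.tiles | (tileSupp supp t ∩ K).Nonempty} = {t ∈ T'.tiles | (tileSupp supp t ∩ K).Nonempty}

/-- Two tilings are `ε`-close in the big ball metric: after translations of size at most `ε` they
agree exactly on the ball of radius `1 / ε` around the origin. -/
def Tiling.Close {ι : Type} {d : ℕ} {supp : ι → Set (Space d)} (ε : ℝ) (T T' : Tiling supp) :
    Prop :=
  ∃ v v' : Space d, ‖v‖ ≤ ε ∧ ‖v'‖ ≤ ε ∧
    Tiling.AgreeOn (Metric.closedBall 0 (1 / ε)) (T.translate v) (T'.translate v')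

theorem Tiling.AgreeOn.mono {ι : Type} {d : ℕ} {supp : ι → Set (Space d)} {K L : Set (Space d)}
    {T T' : Tiling supp} (h : Tiling.AgreeOn L T T') (hKL : K ⊆ L) : Tiling.AgreeOn K T T' := by
  have key : ∀ t, (tileSupp supp t ∩ K).Nonempty → (t ∈ T.tiles ↔ t ∈ T'.tiles) := by
    intro t ht
    have ht' : (tileSupp supp t ∩ L).Nonempty := ht.mono (inter_subset_inter_right _ hKL)
    have := Set.ext_iff.1 h t
    simpa [ht'] using this
  ext t
  simp only [mem_ofPred_eq]
  constructor
  · exact fun ⟨h1, h2⟩ => ⟨(key t h2).1 h1, h2⟩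
  · exact fun ⟨h1, h2⟩ => ⟨(key t h2).2 h1, h2⟩

theorem Tiling.Close.mono {ι : Type} {d : ℕ} {supp : ι → Set (Space d)} {ε δ : ℝ} (hε : 0 < ε)
    (hεδ : ε ≤ δ) {T T' : Tiling supp} (h : Tiling.Close ε T T') : Tiling.Close δ T T' := by
  obtain ⟨v, v', hv, hv', h⟩ := h
  exact ⟨v, v', hv.trans hεδ, hv'.trans hεδ,
    h.mono (Metric.closedBall_subset_closedBall (one_div_le_one_div_of_le hε hεδ))⟩

/-- The topology of the big ball metric: a set is open if with each of its tilings it contains all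
tilings that are `ε`-close to it, for some `ε > 0`. -/
instance {ι : Type} {d : ℕ} {supp : ι → Set (Space d)} : TopologicalSpace (Tiling supp) where
  IsOpen U := ∀ T ∈ U, ∃ ε > 0, ∀ T', Tiling.Close ε T T' → T' ∈ U
  isOpen_univ := fun _ _ => ⟨1, one_pos, fun _ _ => mem_univ _⟩
  isOpen_inter := by
    intro U V hU hV T hT
    obtain ⟨ε, hε, h⟩ := hU T hT.1
    obtain ⟨δ, hδ, h'⟩ := hV T hT.2
    have hm : 0 < min ε δ := lt_min hε hδ
    exact ⟨min ε δ, hm, fun T' hT' =>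
      ⟨h T' (hT'.mono hm (min_le_left _ _)), h' T' (hT'.mono hm (min_le_right _ _))⟩⟩
  isOpen_sUnion := by
    intro S hS T ⟨U, hU, hT⟩
    obtain ⟨ε, hε, h⟩ := hS U hU T hT
    exact ⟨ε, hε, fun T' hT' => ⟨U, hU, h T' hT'⟩⟩

/-- The Borel sets of the big ball topology. -/
instance {ι : Type} {d : ℕ} {supp : ι → Set (Space d)} : MeasurableSpace (Tiling supp) :=
  borel _

instance {ι : Type} {d : ℕ} {supp : ι → Set (Space d)} : BorelSpace (Tiling supp) := ⟨rfl⟩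

/-! ### Fusion rules -/

/-- The data of a fusion rule: there are `j n` supertiles of level `n`; those of level `0` are the
prototiles, with supports `proto`; `fusion n l` is the (preferred) way in which the
`(n+1)`-supertile with label `l` is put together from translates `(k, v)` of `n`-supertiles. -/
structure FusionData (d : ℕ) where
  j : ℕ → ℕ
  proto : Fin (j 0) → Set (Space d)
  fusion : ∀ n, Fin (j (n + 1)) → Set (Fin (j n) × Space d)

namespace FusionData

variable {d : ℕ} (R : FusionData d)

/-- The support of the supertile `P_n(k)`. -/
def supp : ∀ n, Fin (R.j n) → Set (Space d)
  | 0 => R.proto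
  | n + 1 => fun l => cover (supp n) (R.fusion n l)

/-- `R.Contains n N l (k, v)`: in the hierarchical decomposition of the supertile `P_N(l)` into
`n`-supertiles, the `n`-supertile `P_n(k) + v` occurs. -/
inductive Contains (n : ℕ) : ∀ N, Fin (R.j N) → Fin (R.j n) × Space d → Prop
  | refl (k : Fin (R.j n)) : Contains n n k (k, 0)
  | step {N : ℕ} {l : Fin (R.j (N + 1))} {s : Fin (R.j N) × Space d} {t : Fin (R.j n) × Space d}
      (hs : s ∈ R.fusion N l) (ht : Contains n N s.1 t) :
      Contains n (N + 1) l (t.1, t.2 + s.2)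

/-- The supertile `P_N(l)` as a set of `n`-supertiles. For `n = 0` this is `P_N(l)` as a patch of
tiles. -/
def decomp (n N : ℕ) (l : Fin (R.j N)) : Set (Fin (R.j n) × Space d) :=
  {t | R.Contains n N l t}

end FusionData

/-- A fusion rule: the prototiles are admissible sets, each level has at least one supertile, and
every `(n+1)`-supertile is a patch of `n`-supertiles. Supertiles carry labels, so two of them may
be equal as patches of tiles. -/
structure FusionRule (d : ℕ) extends FusionData d where
  j_pos : ∀ n, 0 < j n
  isPrototile : ∀ i, IsPrototile (proto i)
  isPatch_fusion : ∀ n l, IsPatch (toFusionData.supp n) (fusion n l)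

namespace FusionRule

variable {d : ℕ} (R : FusionRule d)

/-- A set of `n`-supertiles is admitted by the fusion rule if a copy of it can be found inside some
supertile. -/
def Admits (n : ℕ) (P : Set (Fin (R.j n) × Space d)) : Prop :=
  ∃ N, ∃ l : Fin (R.j N), ∃ v, translate v P ⊆ R.decomp n N l

/-- The space of fusion tilings in which the `n`-supertiles are the smallest building blocks: the
tilings by `n`-supertiles all of whose patches are admitted. For `n = 0` this is the space of
fusion tilings. -/
def tilingSpace (n : ℕ) : Set (Tiling (R.supp n)) :=
  {T | ∀ P, IsPatch (R.supp n) P → P ⊆ T.tiles → R.Admits n P}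

/-- The set of `n`-supertiles obtained by breaking each tile of a set of `(n+1)`-supertiles into the
`n`-supertiles from which it was fused. -/
def subdivide (n : ℕ) (S : Set (Fin (R.j (n + 1)) × Space d)) : Set (Fin (R.j n) × Space d) :=
  ⋃ s ∈ S, translate s.2 (R.fusion n s.1)

theorem Admits.translate {n : ℕ} {P : Set (Fin (R.j n) × Space d)} (v : Space d)
    (h : R.Admits n (translate v P)) : R.Admits n P := by
  obtain ⟨N, l, w, h⟩ := h
  exact ⟨N, l, v + w, by rwa [translate_translate] at h⟩

/-- Translation of fusion tilings. -/
def translateTiling (n : ℕ) (v : Space d) (T : R.tilingSpace n) : R.tilingSpace n :=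
  ⟨T.1.translate v, by
    intro P hP hPT
    refine Admits.translate R (-v) (T.2 _ (hP.translate (-v)) ?_)
    have := translate_mono (v := -v) hPT
    rwa [Tiling.translate, translate_translate, add_neg_cancel, translate_zero] at this⟩

section SubdivisionFacts

theorem cover_translate_fusion {n : ℕ} (s : Fin (R.j (n + 1)) × Space d) :
    cover (R.supp n) (FusionTiling.translate s.2 (R.fusion n s.1)) =
      tileSupp (R.supp (n + 1)) s := by
  rw [cover_translate]
  rfl

theorem cover_subdivide (n : ℕ) (S : Set (Fin (R.j (n + 1)) × Space d)) :
    cover (R.supp n) (R.subdivide n S) = cover (R.supp (n + 1)) S := by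
  have : cover (R.supp n) (R.subdivide n S) =
      ⋃ s ∈ S, cover (R.supp n) (FusionTiling.translate s.2 (R.fusion n s.1)) := by
    simp only [cover, subdivide, biUnion_iUnion]
  simp only [this, cover_translate_fusion]
  rfl

theorem tileSupp_subset {n : ℕ} {s : Fin (R.j (n + 1)) × Space d} {t : Fin (R.j n) × Space d}
    (h : t ∈ FusionTiling.translate s.2 (R.fusion n s.1)) :
    tileSupp (R.supp n) t ⊆ tileSupp (R.supp (n + 1)) s := by
  rw [← cover_translate_fusion]
  exact subset_biUnion_of_mem (u := fun t => tileSupp (R.supp n) t) h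

theorem nonOverlapping_subdivide {n : ℕ} {S : Set (Fin (R.j (n + 1)) × Space d)}
    (hS : NonOverlapping (R.supp (n + 1)) S) : NonOverlapping (R.supp n) (R.subdivide n S) := by
  intro t ht t' ht' hne
  simp only [subdivide, mem_iUnion] at ht ht'
  obtain ⟨s, hs, ht⟩ := ht
  obtain ⟨s', hs', ht'⟩ := ht'
  by_cases hss : s = s'
  · subst hss
    exact ((R.isPatch_fusion n s.1).nonOverlapping.translate s.2) ht ht' hne
  · exact (hS hs hs' hss).mono (interior_mono (R.tileSupp_subset ht))
      (interior_mono (R.tileSupp_subset ht'))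

theorem contains_of_fusion {n N : ℕ} {l : Fin (R.j N)} {s : Fin (R.j (n + 1)) × Space d}
    (h : R.Contains (n + 1) N l s) {t : Fin (R.j n) × Space d}
    (ht : t ∈ FusionTiling.translate s.2 (R.fusion n s.1)) : R.Contains n N l t := by
  induction h generalizing t with
  | refl k =>
    rw [translate_zero] at ht
    simpa using FusionData.Contains.step ht (FusionData.Contains.refl t.1)
  | @step N l u s hu _ ih =>
    rw [mem_translate] at ht
    have := FusionData.Contains.step hu (ih (t := (t.1, t.2 - u.2)) (by
      rw [mem_translate]
      simpa [sub_sub, add_comm] using ht))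
    simpa using this

theorem supp_connected (n : ℕ) (k : Fin (R.j n)) : IsConnected (R.supp n k) := by
  cases n with
  | zero => exact (R.isPrototile k).isConnected
  | succ n => exact (R.isPatch_fusion n k).isConnected

theorem tileSupp_connected (n : ℕ) (t : Fin (R.j n) × Space d) :
    IsConnected (tileSupp (R.supp n) t) :=
  (R.supp_connected n t.1).image _ (continuous_const_vadd t.2).continuousOn

theorem subdivide_mem {n : ℕ} {T : Tiling (R.supp (n + 1))} {T' : Tiling (R.supp n)}
    (hT : T ∈ R.tilingSpace (n + 1)) (h : T'.tiles = R.subdivide n T.tiles) :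
    T' ∈ R.tilingSpace n := by
  intro P hP hPT
  have : Nonempty (Fin (R.j (n + 1))) := ⟨⟨0, R.j_pos (n + 1)⟩⟩
  have hex : ∀ t ∈ P, ∃ s ∈ T.tiles, t ∈ FusionTiling.translate s.2 (R.fusion n s.1) := by
    intro t ht
    have := hPT ht
    rw [h] at this
    simpa only [subdivide, mem_iUnion, exists_prop] using this
  choose! f hf hft using hex
  have hQ : IsPatch (R.supp (n + 1)) (f '' P) := by
    refine ⟨hP.finite.image f, T.nonOverlapping.mono (image_subset_iff.2 hf), ?_⟩
    have hsub : cover (R.supp n) P ⊆ cover (R.supp (n + 1)) (f '' P) := by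
      refine iUnion₂_subset fun t ht => (R.tileSupp_subset (hft t ht)).trans ?_
      exact subset_biUnion_of_mem (u := fun t => tileSupp (R.supp (n + 1)) t)
        (mem_image_of_mem f ht)
    have hPne := hP.isConnected.nonempty
    obtain ⟨x₀, hx₀⟩ := hPne
    have heq : cover (R.supp (n + 1)) (f '' P) =
        ⋃ t : P, (cover (R.supp n) P ∪ tileSupp (R.supp (n + 1)) (f t)) := by
      apply Subset.antisymm
      · intro x hx
        simp only [cover, biUnion_image, mem_iUnion] at hx
        obtain ⟨t, ht, hx⟩ := hx
        exact mem_iUnion.2 ⟨⟨t, ht⟩, Or.inr hx⟩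
      · refine iUnion_subset fun t => union_subset hsub ?_
        exact subset_biUnion_of_mem (u := fun t => tileSupp (R.supp (n + 1)) t)
          (mem_image_of_mem f t.2)
    obtain ⟨t₀, ht₀, -⟩ : ∃ t ∈ P, x₀ ∈ tileSupp (R.supp n) t := by
      simpa only [cover, mem_iUnion, exists_prop] using hx₀
    refine ⟨⟨x₀, hsub hx₀⟩, ?_⟩
    rw [heq]
    refine isPreconnected_iUnion ⟨x₀, mem_iInter.2 fun t => Or.inl hx₀⟩ fun t => ?_
    obtain ⟨y, hy⟩ := (R.tileSupp_connected n t.1).nonempty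
    refine IsPreconnected.union y ?_ (R.tileSupp_subset (hft t.1 t.2) hy)
      hP.isConnected.isPreconnected (R.tileSupp_connected (n + 1) _).isPreconnected
    exact mem_biUnion (t := fun t => tileSupp (R.supp n) t) t.2 hy
  obtain ⟨N, l, v, hNl⟩ := hT _ hQ (image_subset_iff.2 hf)
  refine ⟨N, l, v, ?_⟩
  rintro _ ⟨t, ht, rfl⟩
  have h1 : R.Contains (n + 1) N l ((f t).1, (f t).2 + v) :=
    hNl ⟨f t, mem_image_of_mem f ht, rfl⟩
  refine R.contains_of_fusion h1 ?_
  have h2 := hft t ht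
  rw [mem_translate] at h2 ⊢
  simpa using h2

end SubdivisionFacts

/-- The subdivision map from tilings by `(n+1)`-supertiles to tilings by `n`-supertiles. -/
def subdivisionMap (n : ℕ) (T : R.tilingSpace (n + 1)) : R.tilingSpace n :=
  ⟨⟨R.subdivide n T.1.tiles, by rw [cover_subdivide, T.1.cover_eq],
    R.nonOverlapping_subdivide T.1.nonOverlapping⟩, R.subdivide_mem T.2 rfl⟩

/-- Recognizability: all subdivision maps are homeomorphisms. -/
def IsRecognizable : Prop :=
  ∀ n, IsHomeomorph (R.subdivisionMap n)

/-- The fusion tilings have finite local complexity. -/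
def HasFLC : Prop :=
  ∀ T ∈ R.tilingSpace 0, T.HasFLC

/-! ### Transition matrices -/

/-- The transition matrix `M_{n,n+1}`: the `(k, l)` entry is the number of `n`-supertiles of type
`k` in the `(n+1)`-supertile of type `l`. -/
noncomputable def transitionStep (n : ℕ) : Matrix (Fin (R.j n)) (Fin (R.j (n + 1))) ℝ :=
  fun k l => ({v : Space d | (k, v) ∈ R.fusion n l}.ncard : ℝ)

/-- The transition matrix `M_{n,n+m} = M_{n,n+1} ⋯ M_{n+m-1,n+m}`. -/
noncomputable def transition (n : ℕ) : ∀ m, Matrix (Fin (R.j n)) (Fin (R.j (n + m))) ℝ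
  | 0 => 1
  | m + 1 => transition n m * R.transitionStep (n + m)

/-- Primitivity: for each `n` there is `N > n` such that all entries of `M_{n,N}` are positive. -/
def IsPrimitive : Prop :=
  ∀ n, ∃ m > 0, ∀ k l, 0 < R.transition n m k l

/-- The volume of the supertile `P_n(k)`. -/
noncomputable def vol (n : ℕ) (k : Fin (R.j n)) : ℝ :=
  volume.real (R.supp n k)

end FusionRule

/-- Van Hove sequences of subsets of Euclidean space. -/
def IsVanHoveSeq {d : ℕ} (A : ℕ → Set (Space d)) : Prop :=
  ∀ r : ℝ, 0 ≤ r →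
    Tendsto (fun n => volume (Metric.cthickening r (frontier (A n))) / volume (A n)) atTop (𝓝 0)

namespace FusionRule

variable {d : ℕ} (R : FusionRule d)

/-- A van Hove fusion rule: every choice of one `n`-supertile for each `n` gives a van Hove
sequence. -/
def IsVanHove : Prop :=
  ∀ k : ∀ n, Fin (R.j n), IsVanHoveSeq fun n => R.supp n (k n)

/-! ### Invariant measures and frequencies -/

/-- The translation-invariant Borel probability measures on the space of fusion tilings. -/
def InvariantMeasure : Type :=
  {μ : Measure (R.tilingSpace 0) //
    IsProbabilityMeasure μ ∧ ∀ v, MeasurePreserving (R.translateTiling 0 v) μ μ}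

/-- The cylinder set of all fusion tilings that contain `P - v` for some `v ∈ U`. -/
def cylinder (P : Set (Fin (R.j 0) × Space d)) (U : Set (Space d)) : Set (R.tilingSpace 0) :=
  {T | ∃ v ∈ U, translate (-v) P ⊆ T.1.tiles}

/-- `U` is so small that for every fusion tiling there is at most one `v ∈ U` for which the tiling
contains `P - v`. -/
def IsSmallFor (P : Set (Fin (R.j 0) × Space d)) (U : Set (Space d)) : Prop :=
  ∀ T ∈ R.tilingSpace 0, {v ∈ U | translate (-v) P ⊆ T.tiles}.Subsingleton

/-- `f` is the abstract frequency of `P` for the measure `μ`: the cylinder set of `P` over each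
small measurable set `U` has measure `f * volume U`. -/
def HasFreq (μ : R.InvariantMeasure) (P : Set (Fin (R.j 0) × Space d)) (f : ℝ) : Prop :=
  0 ≤ f ∧ ∀ U, MeasurableSet U → R.IsSmallFor P U →
    μ.1 (R.cylinder P U) = ENNReal.ofReal f * volume U

/-- The number of copies of `P` that are completely contained in the supertile `P_n(k)`. -/
noncomputable def count (P : Set (Fin (R.j 0) × Space d)) (n : ℕ) (k : Fin (R.j n)) : ℕ :=
  {v : Space d | translate v P ⊆ R.decomp 0 n k}.ncard

/-- A sequence of well-defined supertile frequencies: a sequence of nonnegative vectors that is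
volume-normalized and transition-consistent. -/
structure IsSupertileFreq (ρ : ∀ n, Fin (R.j n) → ℝ) : Prop where
  nonneg : ∀ n k, 0 ≤ ρ n k
  normalized : ∀ n, ∑ k, ρ n k * R.vol n k = 1
  consistent : ∀ n m, 0 < m → ρ n = (R.transition n m).mulVec (ρ (n + m))

/-! ### The inverse limit of the polytopes -/

/-- The direction matrix `D_{n,n+m}`: its columns are the volume-normalized columns of
`M_{n,n+m}`. -/
noncomputable def direction (n m : ℕ) : Matrix (Fin (R.j n)) (Fin (R.j (n + m))) ℝ :=
  fun i k => R.transition n m i k / ∑ l, R.transition n m l k * R.vol n l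

/-- The polytope `Δ_{n,n+m}`: the convex hull of the columns of `D_{n,n+m}`. -/
def polytope (n m : ℕ) : Set (Fin (R.j n) → ℝ) :=
  convexHull ℝ (range fun k => (R.direction n m).col k)

/-- The set `Δ_n`: the intersection of the polytopes `Δ_{n,N}` over all `N > n`. -/
def limitPolytope (n : ℕ) : Set (Fin (R.j n) → ℝ) :=
  ⋂ m > 0, R.polytope n m

/-- The inverse limit `Δ_∞` of the sets `Δ_n` under the maps given by the matrices `M_{n,N}`. -/
def inverseLimit : Set (∀ n, Fin (R.j n) → ℝ) :=
  {x | (∀ n, x n ∈ R.limitPolytope n) ∧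
    ∀ n m, 0 < m → (R.transition n m).mulVec (x (n + m)) = x n}

end FusionRule

end FusionTiling

/-!
The correspondence sends an invariant probability measure `μ` to the vectors of frequencies of the
`n`-supertiles, and the theorem says that these numbers determine `μ` and are subject to no
constraints but the obvious ones.

*Frequencies exist.* For an equivariant, locally finite and measurable choice of points in a random
tiling, the expected number of points in a Borel set is a translation-invariant measure on `ℝᵈ`,
hence a multiple of Lebesgue measure (`IsPointProcess.exists_intensity`). By recognizability the
control points of the `n`-supertiles of a given type form such a process; its intensity is
`freq`. Counting in two ways, through Campbell's formula, the `n`-supertiles inside `N`-supertiles,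
and the volume covered by supertiles, gives the consistency and normalization conditions
(`isSupertileFreq`).

*Frequencies of patches.* The occurrences of a patch are again a point process. Each of them either
lies inside a single `n`-supertile, which contributes `#(P in Pₙ(i)) ρₙ(i)`, or lies close to the
boundary of one, and the van Hove property makes the second contribution vanish as `n → ∞`
(`exists_hasFreq`).

*Uniqueness.* Integrating a function along all the translates of the tiling whose origin lies
inside an `n`-supertile, only the part near the boundary sees more than that supertile. Hence `μ` is
approximated by the sample measures `∑ i, ρₙ(i) ∫_{Pₙ(i)} δ_{T - x} dx`, which depend only on the
frequencies (`lintegral_le_sampleMeasure`, `eq_of_freq_eq`).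

*Existence.* Finite local complexity makes the tiling space compact
(`exists_le_nhds_of_hasDisplacements`, `isCompact_tilingSpace`). Given `ρ`, the sample measures
built from it have total mass `1`, so they accumulate at a probability measure on the tiling
space. The van Hove property makes the limit invariant (`measurePreserving_of_tendsto`), and testing
against continuous bump functions located at the control points of supertiles shows that its
frequencies are `ρ` (`tendsto_lintegral_nearOrigin`, `exists_invariantMeasure`).

*The inverse limit.* A sequence of well-defined supertile frequencies is the same as a point of the
inverse limit of the polytopes: `ρₙ = M_{n,N} ρ_N` exhibits `ρₙ` as a convex combination of the
normalized columns of `M_{n,N}`, the weights being the volume fractions of the `N`-supertiles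
(`isSupertileFreq_iff_mem_inverseLimit`).
-/

namespace FusionTiling

open scoped ENNReal NNReal

/-! ### Stationary point processes -/

/-- A stationary point process over a space `Ω` on which the translations act through `τ`: each
`ω` determines a uniformly separated set `L ω` of points, which moves along with `ω` and meets
every open set with measurable probability. -/
structure IsPointProcess {d : ℕ} {Ω : Type*} [MeasurableSpace Ω] (τ : Space d → Ω → Ω)
    (L : Ω → Set (Space d)) : Prop where
  separated : ∃ δ > 0, ∀ ω, (L ω).Pairwise fun x y => δ ≤ dist x y
  measurableSet_hit : ∀ U, IsOpen U → MeasurableSet {ω | (L ω ∩ U).Nonempty}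
  equivariant : ∀ v ω, L (τ v ω) = v +ᵥ L ω

/-- The counting measure of a set of points. -/
noncomputable def pointMeasure {d : ℕ} (L : Set (Space d)) : Measure (Space d) :=
  Measure.count.restrict L

theorem subsingleton_inter_of_separated {d : ℕ} {L B : Set (Space d)} {δ : ℝ}
    (hL : L.Pairwise fun x y => δ ≤ dist x y) (hB : ∀ x ∈ B, ∀ y ∈ B, dist x y < δ) :
    (L ∩ B).Subsingleton := by
  intro x hx y hy
  by_contra hne
  exact absurd (hL hx.1 hy.1 hne) (not_le.2 (hB x hx.2 y hy.2))

theorem measurableSet_of_separated {d : ℕ} {L : Set (Space d)} {δ : ℝ} (hδ : 0 < δ)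
    (hL : L.Pairwise fun x y => δ ≤ dist x y) : MeasurableSet L :=
  (Metric.isClosed_of_pairwise_le_dist hδ hL).measurableSet

theorem lintegral_pointMeasure {d : ℕ} {L : Set (Space d)} (hL : MeasurableSet L)
    (g : Space d → ℝ≥0∞) : ∫⁻ v, g v ∂pointMeasure L = ∑' v : L, g v := by
  rw [pointMeasure, ← lintegral_indicator hL, lintegral_count, tsum_subtype]

theorem count_of_subsingleton {d : ℕ} {s : Set (Space d)} (hs : s.Subsingleton) :
    (Measure.count s : ℝ≥0∞) = {t : Set (Space d) | t.Nonempty}.indicator 1 s := by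
  rcases hs.eq_empty_or_singleton with rfl | ⟨x, rfl⟩
  · simp
  · simp

/-- A countable measurable partition of space into pieces of small diameter. -/
theorem exists_small_partition (d : ℕ) {δ : ℝ} (hδ : 0 < δ) :
    ∃ B : ℕ → Set (Space d), (∀ i, MeasurableSet (B i)) ∧ Pairwise (Function.onFun Disjoint B) ∧
      (⋃ i, B i) = univ ∧ ∀ i, ∃ x, B i ⊆ Metric.ball x (δ / 2) := by
  refine ⟨disjointed fun i => Metric.ball (TopologicalSpace.denseSeq (Space d) i) (δ / 2),
    fun i => MeasurableSet.disjointed (fun i => Metric.isOpen_ball.measurableSet) i,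
    disjoint_disjointed _, ?_, fun i => ⟨_, disjointed_subset _ i⟩⟩
  rw [iUnion_disjointed, eq_univ_iff_forall]
  intro x
  obtain ⟨i, hi⟩ := (TopologicalSpace.denseRange_denseSeq (Space d)).exists_dist_lt x
    (half_pos hδ)
  exact mem_iUnion.2 ⟨i, hi⟩

namespace IsPointProcess

variable {d : ℕ} {Ω : Type*} [MeasurableSpace Ω] {τ : Space d → Ω → Ω} {L : Ω → Set (Space d)}

/-- Inside a ball that contains at most one point of each `L ω`, hitting a Borel set is an event:
the Borel sets with this property form a `σ`-algebra. -/
theorem measurableSet_hit_inter (h : IsPointProcess τ L) {B : Set (Space d)} (hB : IsOpen B)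
    (hs : ∀ ω, (L ω ∩ B).Subsingleton) {U : Set (Space d)} (hU : MeasurableSet U) :
    MeasurableSet {ω | (L ω ∩ (U ∩ B)).Nonempty} := by
  induction U, hU using MeasurableSet.induction_on_open with
  | isOpen U hU => exact h.measurableSet_hit _ (IsOpen.inter hU hB)
  | compl U _ ih =>
    have : {ω | (L ω ∩ (Uᶜ ∩ B)).Nonempty} =
        {ω | (L ω ∩ B).Nonempty} \ {ω | (L ω ∩ (U ∩ B)).Nonempty} := by
      ext ω
      constructor
      · rintro ⟨x, hx, hxU, hxB⟩
        refine ⟨⟨x, hx, hxB⟩, ?_⟩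
        rintro ⟨y, hy, hyU, hyB⟩
        exact hxU (hs ω ⟨hx, hxB⟩ ⟨hy, hyB⟩ ▸ hyU)
      · rintro ⟨⟨x, hx, hxB⟩, hn⟩
        exact ⟨x, hx, fun hxU => hn ⟨x, hx, hxU, hxB⟩, hxB⟩
    rw [this]
    exact (h.measurableSet_hit _ hB).diff ih
  | iUnion f _ _ ih =>
    have : {ω | (L ω ∩ ((⋃ i, f i) ∩ B)).Nonempty} = ⋃ i, {ω | (L ω ∩ (f i ∩ B)).Nonempty} := by
      ext ω
      simp only [iUnion_inter, inter_iUnion, nonempty_iUnion, mem_iUnion]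
      rfl
    rw [this]
    exact MeasurableSet.iUnion ih

theorem measurable_pointMeasure (h : IsPointProcess τ L) :
    Measurable fun ω => pointMeasure (L ω) := by
  obtain ⟨δ, hδ, hsep⟩ := h.separated
  obtain ⟨B, hBm, hBd, hBu, hBs⟩ := exists_small_partition d hδ
  refine Measure.measurable_of_measurable_coe _ fun U hU => ?_
  have hsub : ∀ i ω, (L ω ∩ B i).Subsingleton := fun i ω => by
    obtain ⟨x, hx⟩ := hBs i
    refine subsingleton_inter_of_separated (hsep ω) fun y hy z hz => ?_
    have h1 := Metric.mem_ball.1 (hx hy)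
    have h2 := Metric.mem_ball'.1 (hx hz)
    linarith [dist_triangle y x z]
  have key : ∀ ω, pointMeasure (L ω) U =
      ∑' i, {ω | (L ω ∩ (U ∩ B i)).Nonempty}.indicator (1 : Ω → ℝ≥0∞) ω := by
    intro ω
    have hU' : U = ⋃ i, U ∩ B i := by rw [← inter_iUnion, hBu, inter_univ]
    conv_lhs => rw [hU']
    rw [measure_iUnion (fun i j hij => (hBd hij).mono inter_subset_right inter_subset_right)
      (fun i => hU.inter (hBm i))]
    refine tsum_congr fun i => ?_
    rw [pointMeasure, Measure.restrict_apply (hU.inter (hBm i)), inter_comm,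
      count_of_subsingleton ((hsub i ω).anti (inter_subset_inter_right _ inter_subset_right))]
    rfl
  simp only [key]
  refine Measurable.tsum fun i => measurable_one.indicator ?_
  obtain ⟨x, hx⟩ := hBs i
  have hi : U ∩ B i = (U ∩ B i) ∩ Metric.ball x (δ / 2) :=
    (inter_eq_left.2 (inter_subset_right.trans hx)).symm
  rw [hi]
  refine h.measurableSet_hit_inter Metric.isOpen_ball (fun ω => ?_) (hU.inter (hBm i))
  refine subsingleton_inter_of_separated (hsep ω) fun y hy z hz => ?_
  have h1 := Metric.mem_ball.1 hy
  have h2 := Metric.mem_ball'.1 hz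
  linarith [dist_triangle y x z]

theorem measurableSet (h : IsPointProcess τ L) (ω : Ω) : MeasurableSet (L ω) := by
  obtain ⟨δ, hδ, hsep⟩ := h.separated
  exact measurableSet_of_separated hδ (hsep ω)

theorem measurable_tsum (h : IsPointProcess τ L) {g : Space d → ℝ≥0∞} (hg : Measurable g) :
    Measurable fun ω => ∑' v : L ω, g v := by
  simp only [← lintegral_pointMeasure (h.measurableSet _)]
  exact (Measure.measurable_lintegral hg).comp h.measurable_pointMeasure

/-- **Campbell's formula**. The mean number of points in a set is a translation-invariant measure
that is finite on small balls, hence a multiple of Lebesgue measure. -/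
theorem exists_intensity (h : IsPointProcess τ L) (μ : Measure Ω) [IsProbabilityMeasure μ]
    (hτ : ∀ v, MeasurePreserving (τ v) μ μ) :
    ∃ c : ℝ≥0, ∀ g : Space d → ℝ≥0∞, Measurable g →
      ∫⁻ ω, ∑' v : L ω, g v ∂μ = c * ∫⁻ v, g v := by
  obtain ⟨δ, hδ, hsep⟩ := h.separated
  set Λ := Measure.bind μ fun ω => pointMeasure (L ω) with hΛ
  have hint : ∀ g : Space d → ℝ≥0∞, Measurable g →
      ∫⁻ v, g v ∂Λ = ∫⁻ ω, ∑' v : L ω, g v ∂μ := by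
    intro g hg
    rw [hΛ, Measure.lintegral_bind h.measurable_pointMeasure.aemeasurable hg.aemeasurable]
    simp only [lintegral_pointMeasure (h.measurableSet _)]
  have hball : ∀ x, Λ (Metric.ball x (δ / 2)) ≤ 1 := by
    intro x
    rw [hΛ, Measure.bind_apply Metric.isOpen_ball.measurableSet
      h.measurable_pointMeasure.aemeasurable]
    refine (lintegral_mono (g := fun _ => (1 : ℝ≥0∞)) fun ω => ?_).trans (by simp)
    have hs : (L ω ∩ Metric.ball x (δ / 2)).Subsingleton := by
      refine subsingleton_inter_of_separated (hsep ω) fun y hy z hz => ?_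
      have h1 := Metric.mem_ball.1 hy
      have h2 := Metric.mem_ball'.1 hz
      linarith [dist_triangle y x z]
    simp only [pointMeasure]
    rw [Measure.restrict_apply Metric.isOpen_ball.measurableSet, inter_comm,
      count_of_subsingleton hs]
    exact indicator_le_self' (fun _ _ => zero_le) _
  have : IsLocallyFiniteMeasure Λ :=
    ⟨fun x => ⟨_, Metric.ball_mem_nhds x (half_pos hδ),
      (hball x).trans_lt ENNReal.one_lt_top⟩⟩
  have : Λ.IsAddLeftInvariant := by
    refine ⟨fun w => ?_⟩
    refine Measure.ext_of_lintegral _ fun g hg => ?_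
    rw [lintegral_map hg (measurable_const_add w),
      hint (fun v => g (w + v)) (hg.comp (measurable_const_add w)),
      hint g hg, ← (hτ w).lintegral_comp (h.measurable_tsum hg)]
    refine lintegral_congr fun ω => ?_
    rw [h.equivariant]
    exact ((Equiv.Set.image (fun v => w +ᵥ v) (L ω) (add_right_injective w)).tsum_eq
      fun v : (w +ᵥ L ω : Set (Space d)) => g v)
  refine ⟨Measure.addHaarScalarFactor Λ volume, fun g hg => ?_⟩
  rw [← hint g hg]
  conv_lhs => rw [Measure.isAddLeftInvariant_eq_smul Λ volume]
  rw [lintegral_smul_measure]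
  rfl

end IsPointProcess

end FusionTiling

namespace FusionTiling

open scoped ENNReal NNReal

/-! ### The uniform structure of the space of tilings -/

namespace Tiling

variable {ι : Type} {d : ℕ} {supp : ι → Set (Space d)}

theorem mem_translate_tiles {v : Space d} {T : Tiling supp} {t : ι × Space d} :
    t ∈ (T.translate v).tiles ↔ (t.1, t.2 - v) ∈ T.tiles :=
  mem_translate

theorem translate_translate (v w : Space d) (T : Tiling supp) :
    (T.translate v).translate w = T.translate (v + w) := by
  ext1
  exact FusionTiling.translate_translate w v T.tiles

theorem translate_zero (T : Tiling supp) : T.translate 0 = T := by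
  ext1
  exact FusionTiling.translate_zero T.tiles

theorem agreeOn_iff {K : Set (Space d)} {T T' : Tiling supp} :
    AgreeOn K T T' ↔
      ∀ t, (tileSupp supp t ∩ K).Nonempty → (t ∈ T.tiles ↔ t ∈ T'.tiles) := by
  constructor
  · intro h t ht
    simpa [ht] using Set.ext_iff.1 h t
  · intro h
    ext t
    exact ⟨fun ⟨h1, h2⟩ => ⟨(h t h2).1 h1, h2⟩, fun ⟨h1, h2⟩ => ⟨(h t h2).2 h1, h2⟩⟩

theorem mem_tileSupp_add {t : ι × Space d} {v x : Space d} :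
    x ∈ tileSupp supp (t.1, t.2 + v) ↔ x - v ∈ tileSupp supp t := by
  rw [tileSupp_add, mem_vadd_set_iff_neg_vadd_mem, vadd_eq_add, neg_add_eq_sub]

theorem mem_tileSupp_sub {t : ι × Space d} {v x : Space d} :
    x ∈ tileSupp supp (t.1, t.2 - v) ↔ x + v ∈ tileSupp supp t := by
  rw [sub_eq_add_neg, mem_tileSupp_add, sub_neg_eq_add]

theorem AgreeOn.translate {r s : ℝ} {v : Space d} {T T' : Tiling supp}
    (h : AgreeOn (Metric.closedBall 0 r) T T') (hs : s + ‖v‖ ≤ r) :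
    AgreeOn (Metric.closedBall 0 s) (T.translate v) (T'.translate v) := by
  rw [agreeOn_iff] at h ⊢
  rintro t ⟨x, hx, hxs⟩
  rw [mem_translate_tiles, mem_translate_tiles]
  refine h _ ⟨x - v, mem_tileSupp_sub.2 (by simpa using hx), ?_⟩
  rw [mem_closedBall_zero_iff] at hxs ⊢
  linarith [norm_sub_le x v]

theorem Close.refl {ε : ℝ} (hε : 0 ≤ ε) (T : Tiling supp) : Close ε T T :=
  ⟨0, 0, by simpa, by simpa, rfl⟩

theorem Close.symm {ε : ℝ} {T T' : Tiling supp} (h : Close ε T T') : Close ε T' T := by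
  obtain ⟨v, v', hv, hv', h⟩ := h
  exact ⟨v', v, hv', hv, Eq.symm h⟩

theorem Close.trans {ε δ : ℝ} (hδε : 3 * δ ≤ ε) (hδ : 1 / ε + 2 * δ ≤ 1 / δ)
    {T T' T'' : Tiling supp} (h : Close δ T T') (h' : Close δ T' T'') : Close ε T T'' := by
  obtain ⟨v, v', hv, hv', h⟩ := h
  obtain ⟨u, u', hu, hu', h'⟩ := h'
  have hn : ‖u - v'‖ ≤ 2 * δ := (norm_sub_le _ _).trans (by linarith)
  have h1 := h.translate (v := u - v') (s := 1 / ε) (by linarith)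
  simp only [Tiling.translate_translate, add_sub_cancel] at h1
  refine ⟨v + (u - v'), u', (norm_add_le _ _).trans (by linarith), ?_, ?_⟩
  · linarith [norm_nonneg u]
  · have h0 : 0 ≤ δ := (norm_nonneg u).trans hu
    exact Eq.trans h1 (h'.mono (Metric.closedBall_subset_closedBall (by linarith)))

/-- Tiles of `T` near the origin reappear in each tiling close to `T`, all shifted by the same
small vector. -/
theorem Close.exists_shift {ε : ℝ} {T T' : Tiling supp} (h : Close ε T T') :
    ∃ w : Space d, ‖w‖ ≤ 2 * ε ∧ ∀ t ∈ T.tiles,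
      (tileSupp supp t ∩ Metric.closedBall 0 (1 / ε - ε)).Nonempty →
        (t.1, t.2 + w) ∈ T'.tiles := by
  obtain ⟨v, v', hv, hv', h⟩ := h
  refine ⟨v - v', (norm_sub_le _ _).trans (by linarith), ?_⟩
  rintro t ht ⟨x, hx, hxr⟩
  have h1 := (agreeOn_iff.1 h (t.1, t.2 + v) ⟨x + v, mem_tileSupp_add.2 (by simpa using hx), ?_⟩).1
    (mem_translate_tiles.2 (by simpa using ht))
  · rw [mem_translate_tiles] at h1
    simpa [add_sub_assoc] using h1
  · rw [mem_closedBall_zero_iff] at hxr ⊢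
    linarith [norm_add_le x v]

theorem close_translate {ε : ℝ} {v : Space d} (hv : ‖v‖ ≤ ε) (T : Tiling supp) :
    Close ε T (T.translate v) :=
  ⟨v, 0, hv, by simpa using (norm_nonneg v).trans hv, by rw [translate_zero]; rfl⟩

theorem Close.translate {ε δ : ℝ} {v : Space d} {T T' : Tiling supp} (h : Close δ T T')
    (hδε : δ ≤ ε) (hδ : 1 / ε + ‖v‖ ≤ 1 / δ) : Close ε (T.translate v) (T'.translate v) := by
  obtain ⟨u, u', hu, hu', h⟩ := h
  refine ⟨u, u', hu.trans hδε, hu'.trans hδε, ?_⟩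
  have := h.translate hδ
  simpa only [translate_translate, add_comm] using this

/-- The pairs of `ε`-close tilings form a basis of a uniform structure. -/
def closeBasis (supp : ι → Set (Space d)) : FilterBasis (Tiling supp × Tiling supp) where
  sets := {S | ∃ ε > 0, S = {p | Close ε p.1 p.2}}
  nonempty := ⟨_, 1, one_pos, rfl⟩
  inter_sets := by
    rintro _ _ ⟨ε, hε, rfl⟩ ⟨δ, hδ, rfl⟩
    have hm : 0 < min ε δ := lt_min hε hδ
    exact ⟨_, ⟨min ε δ, hm, rfl⟩, fun p hp =>
      ⟨Close.mono hm (min_le_left _ _) hp, Close.mono hm (min_le_right _ _) hp⟩⟩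

theorem exists_close_trans {ε : ℝ} (hε : 0 < ε) :
    ∃ δ > 0, ∀ T T' T'' : Tiling supp, Close δ T T' → Close δ T' T'' → Close ε T T'' := by
  set η := min ε 1 with hη
  have hη0 : 0 < η := lt_min hε one_pos
  have hη1 : η ≤ 1 := min_le_right _ _
  refine ⟨η / 4, by linarith, fun T T' T'' h h' => ?_⟩
  refine Close.mono hη0 (min_le_left ε 1) (h.trans (by linarith) ?_ h')
  have h1 : 1 ≤ 1 / η := by rw [le_div_iff₀ hη0]; linarith
  have h2 : 1 / (η / 4) = 4 * (1 / η) := by field_simp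
  rw [h2]
  linarith

/-- The core of the uniform structure of the big ball metric. -/
def closeCore (supp : ι → Set (Space d)) : UniformSpace.Core (Tiling supp) :=
  UniformSpace.Core.mkOfBasis (closeBasis supp)
    (by rintro _ ⟨ε, hε, rfl⟩ T; exact Close.refl hε.le T)
    (by rintro _ ⟨ε, hε, rfl⟩; exact ⟨_, ⟨ε, hε, rfl⟩, fun p hp => Close.symm hp⟩)
    (by
      rintro _ ⟨ε, hε, rfl⟩
      obtain ⟨δ, hδ, h⟩ := exists_close_trans (supp := supp) hε
      refine ⟨_, ⟨δ, hδ, rfl⟩, ?_⟩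
      rintro ⟨T, T''⟩ ⟨T', h1, h2⟩
      exact h _ _ _ h1 h2)

theorem mem_closeCore {S : Set (Tiling supp × Tiling supp)} :
    S ∈ (closeCore supp).uniformity ↔ ∃ ε > 0, {p | Close ε p.1 p.2} ⊆ S := by
  change S ∈ (closeBasis supp).filter ↔ _
  rw [FilterBasis.mem_filter_iff]
  constructor
  · rintro ⟨_, ⟨ε, hε, rfl⟩, h⟩
    exact ⟨ε, hε, h⟩
  · rintro ⟨ε, hε, h⟩
    exact ⟨_, ⟨ε, hε, rfl⟩, h⟩

/-- The uniform structure of the big ball metric; it induces the big ball topology. -/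
instance : UniformSpace (Tiling supp) :=
  UniformSpace.ofCoreEq (closeCore supp) inferInstance <| by
    ext U
    refine forall₂_congr fun T hT => ?_
    change _ ↔ U ∈ Filter.comap (Prod.mk T) (closeCore supp).uniformity
    rw [Filter.mem_comap]
    constructor
    · rintro ⟨ε, hε, h⟩
      exact ⟨_, mem_closeCore.2 ⟨ε, hε, subset_rfl⟩, fun T' hT' => h T' hT'⟩
    · rintro ⟨S, hS, h⟩
      obtain ⟨ε, hε, hS⟩ := mem_closeCore.1 hS
      exact ⟨ε, hε, fun T' hT' => h (hS (a := (T, T')) hT')⟩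

theorem uniformity_basis :
    (uniformity (Tiling supp)).HasBasis (fun ε : ℝ => 0 < ε) fun ε => {p | Close ε p.1 p.2} :=
  ⟨fun _ => mem_closeCore⟩

theorem nhds_basis (T : Tiling supp) :
    (𝓝 T).HasBasis (fun ε : ℝ => 0 < ε) fun ε => {T' | Close ε T T'} :=
  nhds_basis_uniformity' uniformity_basis

instance : (uniformity (Tiling supp)).IsCountablyGenerated := by
  refine HasCountableBasis.isCountablyGenerated (p := fun _ : ℕ => True)
    (s := fun n => {p | Close (1 / ((n : ℝ) + 1)) p.1 p.2}) ⟨⟨fun S => ?_⟩, to_countable _⟩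
  rw [uniformity_basis.mem_iff]
  constructor
  · rintro ⟨ε, hε, h⟩
    obtain ⟨n, hn⟩ := exists_nat_one_div_lt hε
    exact ⟨n, trivial, fun p hp => h (Close.mono (by positivity) hn.le hp)⟩
  · rintro ⟨n, -, h⟩
    exact ⟨_, by positivity, h⟩

end Tiling

/-! ### Separation of tiles -/

variable {ι : Type} {d : ℕ} {supp : ι → Set (Space d)}

theorem IsPrototile.interior_nonempty {s : Set (Space d)} (h : IsPrototile s) :
    (interior s).Nonempty := by
  by_contra hn
  rw [not_nonempty_iff_eq_empty] at hn
  have := h.closure_interior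
  rw [hn, closure_empty] at this
  exact h.isConnected.nonempty.ne_empty this.symm

theorem IsPrototile.volume_pos {s : Set (Space d)} (h : IsPrototile s) : 0 < volume s :=
  (isOpen_interior.measure_pos volume h.interior_nonempty).trans_le (measure_mono interior_subset)

/-- Two translates of a prototile whose interiors are disjoint are a definite distance apart. -/
theorem IsPrototile.exists_separation {s : Set (Space d)} (h : IsPrototile s) :
    ∃ δ > 0, ∀ v w : Space d, Disjoint (interior (v +ᵥ s)) (interior (w +ᵥ s)) →
      δ ≤ dist v w := by
  obtain ⟨c, hc⟩ := h.interior_nonempty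
  obtain ⟨δ, hδ, hb⟩ := Metric.isOpen_iff.1 isOpen_interior c hc
  refine ⟨δ, hδ, fun v w hd => ?_⟩
  by_contra! hlt
  simp only [interior_vadd] at hd
  refine Set.disjoint_left.1 hd (show v + c ∈ v +ᵥ interior s from ⟨c, hc, rfl⟩) ?_
  rw [mem_vadd_set_iff_neg_vadd_mem, vadd_eq_add]
  apply hb
  rw [Metric.mem_ball, dist_eq_norm]
  rw [dist_eq_norm] at hlt
  rwa [show -w + (v + c) - c = v - w by abel]

theorem exists_separation [Finite ι] (h : ∀ i, IsPrototile (supp i)) :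
    ∃ δ > 0, ∀ P : Set (ι × Space d), NonOverlapping supp P →
      ∀ i v w, (i, v) ∈ P → (i, w) ∈ P → dist v w < δ → v = w := by
  cases nonempty_fintype ι
  choose δ hδ hs using fun i => (h i).exists_separation
  obtain ⟨δ₀, h0, hle⟩ : ∃ δ₀ > 0, ∀ i, δ₀ ≤ δ i := by
    rcases isEmpty_or_nonempty ι with hι | hι
    · exact ⟨1, one_pos, fun i => hι.elim i⟩
    · obtain ⟨i, hi⟩ := Finite.exists_min δ
      exact ⟨δ i, hδ i, hi⟩
  refine ⟨δ₀, h0, fun P hP i v w hv hw hd => ?_⟩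
  by_contra hne
  have := hs i v w (hP hv hw fun e => hne (Prod.ext_iff.1 e).2)
  linarith [hle i]

/-- Only finitely many tiles meet a given ball. -/
theorem finite_tiles_inter_closedBall [Finite ι] (h : ∀ i, IsPrototile (supp i))
    {P : Set (ι × Space d)} (hP : NonOverlapping supp P) (r : ℝ) :
    {t ∈ P | (tileSupp supp t ∩ Metric.closedBall 0 r).Nonempty}.Finite := by
  obtain ⟨δ, hδ, hs⟩ := exists_separation h
  have hfin : ∀ i, {v | (i, v) ∈ P ∧
      (tileSupp supp (i, v) ∩ Metric.closedBall 0 r).Nonempty}.Finite := by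
    intro i
    obtain ⟨ρ, hρ⟩ := (h i).isCompact.isBounded.exists_norm_le
    have hsep : {v | (i, v) ∈ P}.Pairwise fun x y => δ ≤ dist x y := by
      intro v hv w hw hne
      by_contra! hlt
      exact hne (hs P hP i v w hv hw hlt)
    have hdisc : IsDiscrete {v | (i, v) ∈ P} := by
      refine isDiscrete_iff_forall_mem_exists_isOpen.2 fun v hv =>
        ⟨Metric.ball v δ, Metric.isOpen_ball, ?_⟩
      ext w
      constructor
      · rintro ⟨hw, hwP⟩
        exact hs P hP i w v hwP hv hw
      · rintro rfl
        exact ⟨Metric.mem_ball_self hδ, hv⟩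
    refine Finite.subset (Metric.finite_isBounded_inter_isClosed hdisc
      (Metric.isBounded_closedBall (x := (0 : Space d)) (r := r + ρ))
      (Metric.isClosed_of_pairwise_le_dist hδ hsep)) ?_
    rintro v ⟨hv, x, ⟨s, hsi, rfl⟩, hx⟩
    refine ⟨?_, hv⟩
    simp only [mem_closedBall_zero_iff, vadd_eq_add] at hx ⊢
    have := norm_sub_le (v + s) s
    rw [add_sub_cancel_right] at this
    linarith [hρ s hsi]
  refine Finite.subset (Set.finite_iUnion fun i => (hfin i).image (Prod.mk i)) ?_
  rintro ⟨i, v⟩ ⟨hv, hx⟩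
  exact mem_iUnion.2 ⟨i, v, ⟨hv, hx⟩, rfl⟩

/-- Arbitrarily close tilings coincide: the small shifts that match a given tile with tiles of the
second tiling are eventually equal, since those tiles are separated, and they tend to `0`. -/
theorem Tiling.tiles_subset_of_close [Finite ι] (h : ∀ i, IsPrototile (supp i))
    {T T' : Tiling supp} (hc : ∀ ε > 0, Tiling.Close ε T T') : T.tiles ⊆ T'.tiles := by
  obtain ⟨δ, hδ, hs⟩ := exists_separation h
  choose! w hw hwT using fun ε hε => (hc ε hε).exists_shift
  rintro ⟨i, v⟩ ht
  obtain ⟨x, hx⟩ := (h i).isConnected.nonempty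
  set ρ := ‖v + x‖ with hρ
  obtain ⟨ε₀, hε₀, hε₁, hε₂⟩ : ∃ ε₀ > 0, ε₀ < δ / 4 ∧ ρ + ε₀ ≤ 1 / ε₀ := by
    refine ⟨min (δ / 5) (1 / (ρ + 1)), by positivity, ?_, ?_⟩
    · exact (min_le_left _ _).trans_lt (by linarith)
    · have h0 : 0 ≤ ρ := norm_nonneg _
      have h1 : min (δ / 5) (1 / (ρ + 1)) ≤ 1 / (ρ + 1) := min_le_right _ _
      have h2 : 1 / (ρ + 1) ≤ 1 := by rw [div_le_one (by positivity)]; linarith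
      have h3 : ρ + 1 ≤ 1 / min (δ / 5) (1 / (ρ + 1)) := by
        rw [le_div_iff₀ (by positivity)]
        calc (ρ + 1) * min (δ / 5) (1 / (ρ + 1)) ≤ (ρ + 1) * (1 / (ρ + 1)) := by gcongr
          _ = 1 := by field_simp
      linarith
  have hmem : ∀ ε, 0 < ε → ε ≤ ε₀ → (i, v + w ε) ∈ T'.tiles := by
    intro ε hε hle
    refine hwT ε hε (i, v) ht ⟨v + x, ⟨x, hx, rfl⟩, ?_⟩
    rw [mem_closedBall_zero_iff]
    have := one_div_le_one_div_of_le hε hle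
    linarith
  have heq : ∀ ε, 0 < ε → ε ≤ ε₀ → w ε = w ε₀ := by
    intro ε hε hle
    have := hs _ T'.nonOverlapping i _ _ (hmem ε hε hle) (hmem ε₀ hε₀ le_rfl) ?_
    · exact add_left_cancel this
    · rw [dist_add_left, dist_eq_norm]
      linarith [norm_sub_le (w ε) (w ε₀), hw ε hε, hw ε₀ hε₀]
  have h0 : ‖w ε₀‖ ≤ 0 := by
    refine le_of_forall_pos_le_add fun η hη => ?_
    have hm : 0 < min (η / 2) ε₀ := by positivity
    rw [← heq _ hm (min_le_right _ _)]
    linarith [hw _ hm, min_le_left (η / 2) ε₀]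
  have := hmem ε₀ hε₀ le_rfl
  rwa [norm_le_zero_iff.1 h0, add_zero] at this

theorem Tiling.t0Space [Finite ι] (h : ∀ i, IsPrototile (supp i)) : T0Space (Tiling supp) := by
  refine ⟨fun T T' hTT => ?_⟩
  have hc : ∀ ε > 0, Tiling.Close ε T T' := by
    intro ε hε
    have : {p : Tiling supp × Tiling supp | Tiling.Close ε p.1 p.2} ∈ uniformity (Tiling supp) :=
      Tiling.uniformity_basis.mem_of_mem hε
    exact (inseparable_iff_ker_uniformity.1 hTT) _ this
  exact Tiling.ext (Subset.antisymm (tiles_subset_of_close h hc)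
    (tiles_subset_of_close h fun ε hε => (hc ε hε).symm))

end FusionTiling

namespace FusionTiling

open scoped ENNReal NNReal

/-! ### Limits of tilings with finite local complexity -/

variable {ι : Type} {d : ℕ} {supp : ι → Set (Space d)}

theorem mem_sub_supp_iff {C : Set (Space d)} {i : ι} {v : Space d} :
    v ∈ C - supp i ↔ (tileSupp supp (i, v) ∩ C).Nonempty := by
  constructor
  · rintro ⟨c, hc, s, hs, rfl⟩
    exact ⟨c, ⟨s, hs, by simp⟩, hc⟩
  · rintro ⟨_, ⟨s, hs, rfl⟩, hc⟩
    exact ⟨_, hc, s, hs, by simp⟩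

theorem isCompact_sub {s t : Set (Space d)} (hs : IsCompact s) (ht : IsCompact t) :
    IsCompact (s - t) := by
  rw [sub_eq_add_neg]
  exact hs.add ht.neg

/-- `D` contains all pairs of labels with relative positions of intersecting tiles of tilings in
`X`. If `D` is finite this is a uniform form of finite local complexity. -/
def HasDisplacements (X : Set (Tiling supp)) (D : Set (ι × ι × Space d)) : Prop :=
  ∀ T ∈ X, ∀ t ∈ T.tiles, ∀ s ∈ T.tiles, t ≠ s →
    (tileSupp supp t ∩ tileSupp supp s).Nonempty → (t.1, s.1, s.2 - t.2) ∈ D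

/-- Tiles chosen in bounded positions in each tiling accumulate, along an ultrafilter, at some
position. -/
theorem exists_limit_tile [Finite ι] (𝒰 : Ultrafilter (Tiling supp)) {K : ι → Set (Space d)}
    (hK : ∀ i, IsCompact (K i)) (Q : Tiling supp → ι × Space d → Prop)
    (h : ∀ᶠ T : Tiling supp in 𝒰, ∃ t ∈ T.tiles, t.2 ∈ K t.1 ∧ Q T t) :
    ∃ t : ι × Space d, t.2 ∈ K t.1 ∧
      ∀ ε > 0, ∀ᶠ T : Tiling supp in 𝒰, ∃ v, ‖v - t.2‖ < ε ∧ (t.1, v) ∈ T.tiles ∧ Q T (t.1, v) := by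
  obtain ⟨i, hi⟩ : ∃ i, ∀ᶠ T : Tiling supp in 𝒰, ∃ v, v ∈ K i ∧ (i, v) ∈ T.tiles ∧ Q T (i, v) := by
    refine Ultrafilter.eventually_exists_iff.1 (h.mono ?_)
    rintro T ⟨⟨i, v⟩, h3, h4, h5⟩
    exact ⟨i, v, h4, h3, h5⟩
  have : Nonempty (Space d) := ⟨0⟩
  choose! f hf using fun T (hT : ∃ v, v ∈ K i ∧ (i, v) ∈ T.tiles ∧ Q T (i, v)) => hT
  obtain ⟨v, hv, hle⟩ := isCompact_iff_ultrafilter_le_nhds.1 (hK i) (𝒰.map f)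
    (le_principal_iff.2 (hi.mono fun T hT => (hf T hT).1))
  refine ⟨(i, v), hv, fun ε hε => ?_⟩
  have h1 : ∀ᶠ T : Tiling supp in 𝒰, f T ∈ Metric.ball v ε := hle (Metric.ball_mem_nhds v hε)
  filter_upwards [hi, h1] with T hT hT1
  exact ⟨f T, by simpa [dist_eq_norm] using hT1, (hf T hT).2⟩

/-- The tiles that are limits, along an ultrafilter, of tiles of tilings. -/
def limitTiles (𝒰 : Ultrafilter (Tiling supp)) : Set (ι × Space d) :=
  {t | ∀ ε > 0, ∀ᶠ T : Tiling supp in 𝒰, ∃ v, ‖v - t.2‖ < ε ∧ (t.1, v) ∈ T.tiles}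

theorem cover_limitTiles [Finite ι] (h : ∀ i, IsPrototile (supp i))
    (𝒰 : Ultrafilter (Tiling supp)) : cover supp (limitTiles 𝒰) = univ := by
  rw [eq_univ_iff_forall]
  intro x
  obtain ⟨t, ht, hlim⟩ := exists_limit_tile 𝒰 (K := fun i => {x} - supp i)
    (fun i => isCompact_sub isCompact_singleton (h i).isCompact) (fun _ _ => True) <| by
      refine Eventually.of_forall fun T => ?_
      have hx : x ∈ cover supp T.tiles := by rw [T.cover_eq]; trivial
      simp only [cover, mem_iUnion] at hx
      obtain ⟨t, ht, hx⟩ := hx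
      exact ⟨t, ht, mem_sub_supp_iff.2 ⟨x, hx, rfl⟩, trivial⟩
  obtain ⟨y, hy, rfl⟩ := mem_sub_supp_iff.1 ht
  exact mem_biUnion (t := fun t => tileSupp supp t)
    (show t ∈ limitTiles 𝒰 from fun ε hε => (hlim ε hε).mono fun T ⟨v, h1, h2, _⟩ => ⟨v, h1, h2⟩) hy

theorem nonOverlapping_limitTiles (𝒰 : Ultrafilter (Tiling supp)) :
    NonOverlapping supp (limitTiles 𝒰) := by
  rintro ⟨i, v⟩ ht ⟨j, w⟩ hs hne
  by_contra hcon
  obtain ⟨x, hx, hy⟩ := Set.not_disjoint_iff.1 hcon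
  -- small perturbations of the two tiles still have a common interior point
  have hpert : ∀ (k : ι) (u : Space d), x ∈ interior (tileSupp supp (k, u)) →
      ∃ ε > 0, ∀ u', ‖u' - u‖ < ε → x ∈ interior (tileSupp supp (k, u')) := by
    intro k u hx
    simp only [tileSupp, interior_vadd] at hx ⊢
    obtain ⟨ε, hε, hb⟩ := Metric.isOpen_iff.1 isOpen_interior _
      (mem_vadd_set_iff_neg_vadd_mem.1 hx)
    refine ⟨ε, hε, fun u' hu' => mem_vadd_set_iff_neg_vadd_mem.2 (hb ?_)⟩
    rw [Metric.mem_ball, dist_eq_norm, vadd_eq_add, vadd_eq_add, ← norm_neg]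
    rwa [show -(-u' + x - (-u + x)) = u' - u by abel]
  obtain ⟨ε, hε, h1⟩ := hpert i v hx
  obtain ⟨ε', hε', h2⟩ := hpert j w hy
  obtain ⟨η, hη, h3⟩ : ∃ η > 0, i = j → 2 * η ≤ ‖v - w‖ := by
    by_cases hij : i = j
    · have : v ≠ w := fun e => hne (by rw [hij, e])
      exact ⟨‖v - w‖ / 2, by have := norm_pos_iff.2 (sub_ne_zero.2 this); linarith,
        fun _ => by linarith⟩
    · exact ⟨1, one_pos, fun e => absurd e hij⟩
  obtain ⟨T, ⟨v', hv', hvT⟩, ⟨w', hw', hwT⟩⟩ :=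
    ((ht (min ε η) (by positivity)).and (hs (min ε' η) (by positivity))).exists
  have hne' : (i, v') ≠ (j, w') := by
    intro e
    obtain ⟨rfl, rfl⟩ := Prod.ext_iff.1 e
    have h4 := h3 rfl
    have h5 : ‖v - w‖ ≤ ‖v' - v‖ + ‖v' - w‖ := by
      rw [← norm_neg (v' - v), neg_sub]
      exact (congrArg norm (by abel)).trans_le (norm_add_le (v - v') (v' - w))
    dsimp only at h5 hv' hw'
    linarith [hv'.trans_le (min_le_right _ _), hw'.trans_le (min_le_right _ _)]
  exact Set.disjoint_left.1 (T.nonOverlapping hvT hwT hne')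
    (h1 v' (hv'.trans_le (min_le_left _ _))) (h2 w' (hw'.trans_le (min_le_left _ _)))

/-- A function on the tiles that meet a ball is constant as soon as it agrees on intersecting
tiles: the union of the tiles with a given value and the union of the others are closed. -/
theorem Tiling.eq_of_locally_eq [Finite ι] (h : ∀ i, IsPrototile (supp i)) {T : Tiling supp}
    {r : ℝ} {β : Type*} (f : ι × Space d → β)
    (hf : ∀ t ∈ T.tiles, ∀ s ∈ T.tiles,
      (tileSupp supp t ∩ Metric.closedBall 0 r).Nonempty →
      (tileSupp supp s ∩ Metric.closedBall 0 r).Nonempty →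
      (tileSupp supp t ∩ tileSupp supp s).Nonempty → f t = f s)
    {t s : ι × Space d} (ht : t ∈ T.tiles) (hs : s ∈ T.tiles)
    (htr : (tileSupp supp t ∩ Metric.closedBall 0 r).Nonempty)
    (hsr : (tileSupp supp s ∩ Metric.closedBall 0 r).Nonempty) : f t = f s := by
  by_contra hne
  have hfin := finite_tiles_inter_closedBall h T.nonOverlapping r
  have hclosed : ∀ t, IsClosed (tileSupp supp t) := fun t =>
    ((h t.1).isCompact.isClosed).vadd t.2
  set F := {t ∈ T.tiles | (tileSupp supp t ∩ Metric.closedBall 0 r).Nonempty} with hF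
  have hA : IsClosed (⋃ u ∈ {u ∈ F | f u = f t}, tileSupp supp u) :=
    (hfin.subset (sep_subset _ _)).isClosed_biUnion fun u _ => hclosed u
  have hB : IsClosed (⋃ u ∈ {u ∈ F | f u ≠ f t}, tileSupp supp u) :=
    (hfin.subset (sep_subset _ _)).isClosed_biUnion fun u _ => hclosed u
  have hcov : Metric.closedBall (0 : Space d) r ⊆ (⋃ u ∈ {u ∈ F | f u = f t}, tileSupp supp u) ∪
      ⋃ u ∈ {u ∈ F | f u ≠ f t}, tileSupp supp u := by
    intro x hx
    have hxc : x ∈ cover supp T.tiles := by rw [T.cover_eq]; trivial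
    simp only [cover, mem_iUnion] at hxc
    obtain ⟨u, hu, hxu⟩ := hxc
    have huF : u ∈ F := ⟨hu, x, hxu, hx⟩
    by_cases hut : f u = f t
    · exact Or.inl (mem_biUnion (t := fun t => tileSupp supp t) ⟨huF, hut⟩ hxu)
    · exact Or.inr (mem_biUnion (t := fun t => tileSupp supp t) ⟨huF, hut⟩ hxu)
  obtain ⟨x, hx, hxr⟩ := htr
  obtain ⟨y, hy, hyr⟩ := hsr
  obtain ⟨z, -, hzA, hzB⟩ := isPreconnected_closed_iff.1
    (convex_closedBall (0 : Space d) r).isPreconnected _ _ hA hB hcov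
    ⟨x, hxr, mem_biUnion (t := fun t => tileSupp supp t) ⟨⟨ht, x, hx, hxr⟩, rfl⟩ hx⟩
    ⟨y, hyr, mem_biUnion (t := fun t => tileSupp supp t)
      ⟨⟨hs, y, hy, hyr⟩, fun e => hne e.symm⟩ hy⟩
  simp only [mem_iUnion] at hzA hzB
  obtain ⟨u, ⟨huF, hu⟩, hzu⟩ := hzA
  obtain ⟨w, ⟨hwF, hw⟩, hzw⟩ := hzB
  exact hw ((hf u huF.1 w hwF.1 huF.2 hwF.2 ⟨z, hzu, hzw⟩).symm.trans hu)

theorem tileSupp_inter_closedBall_of_shift {i : ι} {v w : Space d} {r δ : ℝ} (hw : ‖w - v‖ ≤ δ)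
    (h : (tileSupp supp (i, v) ∩ Metric.closedBall 0 r).Nonempty) :
    (tileSupp supp (i, w) ∩ Metric.closedBall 0 (r + δ)).Nonempty := by
  obtain ⟨_, ⟨s, hs, rfl⟩, hx⟩ := h
  refine ⟨_, ⟨s, hs, rfl⟩, ?_⟩
  simp only [mem_closedBall_zero_iff, vadd_eq_add] at hx ⊢
  have := norm_add_le (v + s) (w - v)
  rw [show v + s + (w - v) = w + s by abel] at this
  linarith

/-- **Compactness under finite local complexity**: every ultrafilter on a set of tilings with
finitely many displacements between neighbouring tiles converges. For most tilings `T` the tiles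
near the origin are small perturbations of the limit tiles; two intersecting tiles of `T` have
been perturbed by the same vector, as their displacement lies in a finite set, and so all of them
have been perturbed by the same vector. -/
theorem exists_le_nhds_of_hasDisplacements [Finite ι] (h : ∀ i, IsPrototile (supp i))
    {X : Set (Tiling supp)} {D : Set (ι × ι × Space d)} (hD : D.Finite)
    (hX : HasDisplacements X D) (𝒰 : Ultrafilter (Tiling supp)) (h𝒰 : X ∈ 𝒰) :
    ∃ T, (𝒰 : Filter (Tiling supp)) ≤ 𝓝 T := by
  set S : Tiling supp :=
    ⟨limitTiles 𝒰, cover_limitTiles h 𝒰, nonOverlapping_limitTiles 𝒰⟩ with hS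
  refine ⟨S, (Tiling.nhds_basis S).ge_iff.2 fun ε hε => ?_⟩
  obtain ⟨σ, hσ, hsep⟩ := exists_separation h
  set r : ℝ := 1 / ε + 1 with hr
  have hr0 : 0 ≤ r := by positivity
  set F := {t ∈ S.tiles | (tileSupp supp t ∩ Metric.closedBall 0 (r + 1)).Nonempty} with hF
  have hFfin : F.Finite := finite_tiles_inter_closedBall h S.nonOverlapping (r + 1)
  -- the size `δ` of the perturbations separates the displacements that have to be distinguished
  obtain ⟨δ, hδ0, hδ1, hδε, hδσ, hδD⟩ : ∃ δ > 0, δ ≤ 1 / 2 ∧ δ ≤ ε ∧ 2 * δ < σ ∧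
      ∀ p ∈ D, ∀ t ∈ F, ∀ s ∈ F, p.2.2 ≠ s.2 - t.2 → 2 * δ < ‖p.2.2 - (s.2 - t.2)‖ := by
    have h1 : ∀ c : ℝ, 0 < c → ∀ᶠ δ in 𝓝[>] (0 : ℝ), 2 * δ < c := by
      intro c hc
      have : ∀ᶠ δ in 𝓝 (0 : ℝ), 2 * δ < c :=
        (continuous_const.mul continuous_id).tendsto' 0 0 (by simp) |>.eventually_lt_const hc
      exact this.filter_mono nhdsWithin_le_nhds
    have h2 : ∀ᶠ δ in 𝓝[>] (0 : ℝ), ∀ p ∈ D, ∀ t ∈ F, ∀ s ∈ F, p.2.2 ≠ s.2 - t.2 →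
        2 * δ < ‖p.2.2 - (s.2 - t.2)‖ := by
      refine (eventually_all_finite hD).2 fun p _ => (eventually_all_finite hFfin).2 fun t _ =>
        (eventually_all_finite hFfin).2 fun s _ => ?_
      by_cases he : p.2.2 = s.2 - t.2
      · exact Eventually.of_forall fun _ hne => absurd he hne
      · exact (h1 _ (norm_pos_iff.2 (sub_ne_zero.2 he))).mono fun δ hδ _ => hδ
    obtain ⟨δ, h3, h4, h5, h6, h7⟩ := (((h1 1 one_pos).and ((h1 ε hε).and
      ((h1 σ hσ).and (h2.and self_mem_nhdsWithin))))).exists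
    have h7' : 0 < δ := h7
    exact ⟨δ, h7', by linarith, by linarith, h5, h6⟩
  have hnear : ∀ᶠ T : Tiling supp in 𝒰, ∀ t ∈ F, ∃ v, ‖v - t.2‖ < δ ∧ (t.1, v) ∈ T.tiles :=
    (eventually_all_finite hFfin).2 fun t ht => ht.1 δ hδ0
  have hfar : ∀ᶠ T : Tiling supp in 𝒰, ∀ t ∈ T.tiles,
      (tileSupp supp t ∩ Metric.closedBall 0 r).Nonempty →
      ∃ v, ‖t.2 - v‖ < δ ∧ (t.1, v) ∈ S.tiles := by
    by_contra hcon
    have hcon' := Ultrafilter.eventually_not.2 hcon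
    obtain ⟨t, ht, hlim⟩ := exists_limit_tile 𝒰 (K := fun i => Metric.closedBall 0 r - supp i)
      (fun i => isCompact_sub (isCompact_closedBall _ _) (h i).isCompact)
      (fun T t => ¬ ∃ v, ‖t.2 - v‖ < δ ∧ (t.1, v) ∈ S.tiles) <| by
        filter_upwards [hcon'] with T hT
        push Not at hT
        obtain ⟨t, ht, hm, hn⟩ := hT
        exact ⟨t, ht, mem_sub_supp_iff.2 hm, fun ⟨v, h1, h2⟩ => hn v h1 h2⟩
    obtain ⟨T, v, hv, -, hQ⟩ := (hlim δ hδ0).exists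
    exact hQ ⟨t.2, hv, fun η hη => (hlim η hη).mono fun T ⟨v, h1, h2, _⟩ => ⟨v, h1, h2⟩⟩
  filter_upwards [hnear, hfar, h𝒰] with T hT1 hT2 hTX
  choose! f hf hfS using hT2
  have hfF : ∀ t ∈ T.tiles,
      (tileSupp supp t ∩ Metric.closedBall 0 r).Nonempty →
      (t.1, f t) ∈ F := by
    intro t ht htr
    refine ⟨hfS t ht htr, ?_⟩
    have h1 := tileSupp_inter_closedBall_of_shift (δ := δ) (w := f t)
      (by rw [norm_sub_rev]; exact (hf t ht htr).le) htr
    exact h1.mono (inter_subset_inter_right _ (Metric.closedBall_subset_closedBall (by linarith)))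
  -- intersecting tiles of `T` have been perturbed by the same vector
  have hadj : ∀ t ∈ T.tiles, ∀ s ∈ T.tiles,
      (tileSupp supp t ∩ Metric.closedBall 0 r).Nonempty →
      (tileSupp supp s ∩ Metric.closedBall 0 r).Nonempty →
      (tileSupp supp t ∩ tileSupp supp s).Nonempty → t.2 - f t = s.2 - f s := by
    intro t ht s hs htr hsr hts
    by_cases hne : t = s
    · rw [hne]
    · have h1 := hX T hTX t ht s hs hne hts
      by_contra hcon
      have h2 := hδD _ h1 _ (hfF t ht htr) _ (hfF s hs hsr) (fun e => hcon ?_)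
      · have h3 : s.2 - t.2 - (f s - f t) = (s.2 - f s) - (t.2 - f t) := by abel
        dsimp only at h2
        rw [h3] at h2
        linarith [norm_sub_le (s.2 - f s) (t.2 - f t), hf t ht htr, hf s hs hsr]
      · rw [sub_eq_sub_iff_add_eq_add, add_comm] at e ⊢
        dsimp only at e
        rw [← e, add_comm]
  obtain ⟨t₀, ht₀, htr₀⟩ : ∃ t ∈ T.tiles, (tileSupp supp t ∩ Metric.closedBall 0 r).Nonempty := by
    have hx : (0 : Space d) ∈ cover supp T.tiles := by rw [T.cover_eq]; trivial
    simp only [cover, mem_iUnion] at hx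
    obtain ⟨t, ht, hx⟩ := hx
    exact ⟨t, ht, 0, hx, Metric.mem_closedBall_self hr0⟩
  set w := t₀.2 - f t₀ with hw
  have hwδ : ‖w‖ < δ := hf t₀ ht₀ htr₀
  have hconst : ∀ t ∈ T.tiles,
      (tileSupp supp t ∩ Metric.closedBall 0 r).Nonempty →
      (t.1, t.2 - w) ∈ S.tiles := by
    intro t ht htr
    have h1 : t.2 - f t = w :=
      Tiling.eq_of_locally_eq h (fun t => t.2 - f t) hadj ht ht₀ htr htr₀
    rw [← h1, sub_sub_cancel]
    exact hfS t ht htr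
  refine ⟨w, 0, hwδ.le.trans hδε, by simpa using hε.le, Tiling.agreeOn_iff.2 fun t htr => ?_⟩
  have hmono : Metric.closedBall (0 : Space d) (1 / ε) ⊆ Metric.closedBall 0 r :=
    Metric.closedBall_subset_closedBall (by linarith)
  rw [Tiling.translate_zero, Tiling.mem_translate_tiles]
  constructor
  · intro ht
    have h1 := tileSupp_inter_closedBall_of_shift (δ := δ) (w := t.2 - w)
      (by rw [sub_sub_cancel_left, norm_neg]; exact hwδ.le) htr
    have h2 : (t.1, t.2 - w) ∈ F :=
      ⟨ht, h1.mono (inter_subset_inter_right _ (Metric.closedBall_subset_closedBall (by linarith)))⟩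
    obtain ⟨v, hv, hvT⟩ := hT1 _ h2
    dsimp only at hv hvT
    have h3 : ‖v - t.2‖ ≤ 2 * δ := by
      have := norm_sub_le (v - (t.2 - w)) w
      rw [show v - (t.2 - w) - w = v - t.2 by abel] at this
      linarith
    have h4 := tileSupp_inter_closedBall_of_shift (δ := 2 * δ) h3 htr
    have h5 := hconst _ hvT
      (h4.mono (inter_subset_inter_right _ (Metric.closedBall_subset_closedBall (by linarith))))
    have h6 := hsep _ S.nonOverlapping t.1 _ _ h5 ht (by
      rw [dist_eq_norm]
      dsimp only
      rw [sub_sub_sub_cancel_right]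
      linarith)
    rw [sub_left_inj] at h6
    dsimp only at h6
    rw [h6] at hvT
    exact hvT
  · intro ht
    exact hconst t ht (htr.mono (inter_subset_inter_right _ hmono))

end FusionTiling

namespace FusionTiling

open scoped ENNReal NNReal

/-! ### Supertiles and their decompositions -/

theorem IsPrototile.vadd {d : ℕ} {s : Set (Space d)} (h : IsPrototile s) (v : Space d) :
    IsPrototile (v +ᵥ s) where
  isCompact := h.isCompact.vadd v
  isConnected := h.isConnected.image _ (continuous_const_vadd v).continuousOn
  closure_interior := by rw [interior_vadd, closure_vadd, h.closure_interior]
  volume_frontier := by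
    have : frontier (v +ᵥ s) = v +ᵥ frontier s := by
      simp only [frontier, closure_vadd, interior_vadd, vadd_set_sdiff]
    rw [this, measure_vadd, h.volume_frontier]

theorem IsPrototile.isClosed {d : ℕ} {s : Set (Space d)} (h : IsPrototile s) : IsClosed s :=
  h.isCompact.isClosed

/-- A patch of prototiles covers a set that may again serve as a prototile. -/
theorem IsPatch.isPrototile_cover {ι : Type} {d : ℕ} {supp : ι → Set (Space d)}
    {P : Set (ι × Space d)} (hP : IsPatch supp P) (h : ∀ i, IsPrototile (supp i)) :
    IsPrototile (cover supp P) := by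
  have ht : ∀ t, IsPrototile (tileSupp supp t) := fun t => (h t.1).vadd t.2
  have hsub : ∀ t ∈ P, tileSupp supp t ⊆ cover supp P := fun t ht =>
    subset_biUnion_of_mem (u := fun t => tileSupp supp t) ht
  have hc : IsCompact (cover supp P) := hP.finite.isCompact_biUnion fun t _ => (ht t).isCompact
  refine ⟨hc, hP.isConnected, ?_, ?_⟩
  · refine Subset.antisymm (closure_minimal interior_subset hc.isClosed) ?_
    refine iUnion₂_subset fun t htP => ?_
    rw [← (ht t).closure_interior]
    exact closure_mono (interior_mono (hsub t htP))
  · refine measure_mono_null (t := ⋃ t ∈ P, frontier (tileSupp supp t)) ?_ ?_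
    · rw [hc.isClosed.frontier_eq]
      rintro x ⟨hx, hn⟩
      simp only [cover, mem_iUnion] at hx
      obtain ⟨t, htP, hx⟩ := hx
      refine mem_biUnion (t := fun t => frontier (tileSupp supp t)) htP ?_
      rw [(ht t).isClosed.frontier_eq]
      exact ⟨hx, fun hi => hn (interior_mono (hsub t htP) hi)⟩
    · exact (measure_biUnion_null_iff hP.finite.countable).2 fun t _ => (ht t).volume_frontier

/-- A point in the interior of a tile lies in no other tile. -/
theorem NonOverlapping.eq_of_mem_interior {ι : Type} {d : ℕ} {supp : ι → Set (Space d)}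
    {P : Set (ι × Space d)} (hP : NonOverlapping supp P) (h : ∀ i, IsPrototile (supp i))
    {s t : ι × Space d} (hs : s ∈ P) (ht : t ∈ P) {x : Space d}
    (hxs : x ∈ interior (tileSupp supp s)) (hxt : x ∈ tileSupp supp t) : s = t := by
  by_contra hne
  have h1 : IsPrototile (tileSupp supp t) := (h t.1).vadd t.2
  rw [← h1.closure_interior] at hxt
  obtain ⟨y, hy, hy'⟩ := mem_closure_iff.1 hxt _ isOpen_interior hxs
  exact Set.disjoint_left.1 (hP hs ht hne) hy hy'

namespace FusionRule

variable {d : ℕ} (R : FusionRule d)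

theorem isPrototile_supp : ∀ n k, IsPrototile (R.supp n k)
  | 0, k => R.isPrototile k
  | n + 1, k => (R.isPatch_fusion n k).isPrototile_cover (isPrototile_supp n)

theorem isPrototile_tileSupp (n : ℕ) (t : Fin (R.j n) × Space d) :
    IsPrototile (tileSupp (R.supp n) t) :=
  (R.isPrototile_supp n t.1).vadd t.2

theorem vol_pos (n : ℕ) (k : Fin (R.j n)) : 0 < R.vol n k :=
  ENNReal.toReal_pos (R.isPrototile_supp n k).volume_pos.ne'
    (R.isPrototile_supp n k).isCompact.measure_ne_top

theorem ofReal_vol (n : ℕ) (k : Fin (R.j n)) : ENNReal.ofReal (R.vol n k) = volume (R.supp n k) :=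
  ENNReal.ofReal_toReal (R.isPrototile_supp n k).isCompact.measure_ne_top

variable {R}

theorem le_of_contains {n N : ℕ} {l : Fin (R.j N)} {t : Fin (R.j n) × Space d}
    (h : R.Contains n N l t) : n ≤ N := by
  induction h with
  | refl => exact le_rfl
  | step _ _ ih => exact ih.trans (Nat.le_succ _)

theorem contains_self_iff {n : ℕ} {l : Fin (R.j n)} {t : Fin (R.j n) × Space d} :
    R.Contains n n l t ↔ t = (l, 0) := by
  constructor
  · intro h
    cases h with
    | refl => rfl
    | step _ h => exact absurd (le_of_contains h) (by simp)
  · rintro rfl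
    exact FusionData.Contains.refl l

theorem contains_succ_iff {n N : ℕ} (hnN : n ≤ N) {l : Fin (R.j (N + 1))}
    {t : Fin (R.j n) × Space d} :
    R.Contains n (N + 1) l t ↔
      ∃ s ∈ R.fusion N l, t ∈ translate s.2 (R.decomp n N s.1) := by
  constructor
  · intro h
    cases h with
    | refl => exact absurd hnN (by simp)
    | step hs h => exact ⟨_, hs, _, h, rfl⟩
  · rintro ⟨s, hs, t', h, rfl⟩
    exact FusionData.Contains.step hs h

theorem decomp_self (n : ℕ) (l : Fin (R.j n)) : R.decomp n n l = {(l, 0)} := by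
  ext t
  exact contains_self_iff

theorem decomp_succ {n N : ℕ} (hnN : n ≤ N) (l : Fin (R.j (N + 1))) :
    R.decomp n (N + 1) l = ⋃ s ∈ R.fusion N l, translate s.2 (R.decomp n N s.1) := by
  ext t
  simp only [mem_iUnion, exists_prop]
  exact contains_succ_iff hnN

theorem finite_decomp {n N : ℕ} (hnN : n ≤ N) (l : Fin (R.j N)) : (R.decomp n N l).Finite := by
  induction N, hnN using Nat.le_induction with
  | base => rw [decomp_self]; exact finite_singleton _
  | succ N hN ih =>
    rw [decomp_succ hN]
    exact (R.isPatch_fusion N l).finite.biUnion fun s _ => (ih s.1).image _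

theorem tileSupp_subset_of_mem_decomp {n N : ℕ} (hnN : n ≤ N) {s : Fin (R.j N) × Space d}
    {t : Fin (R.j n) × Space d} (ht : t ∈ translate s.2 (R.decomp n N s.1)) :
    tileSupp (R.supp n) t ⊆ tileSupp (R.supp N) s := by
  induction N, hnN using Nat.le_induction with
  | base =>
    rw [decomp_self, mem_translate, mem_singleton_iff, Prod.mk.injEq, sub_eq_zero] at ht
    rw [show t = s from Prod.ext ht.1 ht.2]
  | succ N hN ih =>
    rw [mem_translate, decomp_succ hN] at ht
    simp only [mem_iUnion, exists_prop] at ht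
    obtain ⟨u, hu, ht⟩ := ht
    have h1 : t ∈ translate (u.2 + s.2) (R.decomp n N u.1) := by
      rw [mem_translate] at ht ⊢
      rwa [add_comm, ← sub_sub]
    refine (ih (s := (u.1, u.2 + s.2)) h1).trans (R.tileSupp_subset ?_)
    exact ⟨u, hu, rfl⟩

/-- The transition matrix `M_{n,n+m}` counts the `n`-supertiles in the decompositions of
`(n+m)`-supertiles. -/
theorem transition_eq_ncard (n m : ℕ) (k : Fin (R.j n)) (l : Fin (R.j (n + m))) :
    R.transition n m k l = ({v | (k, v) ∈ R.decomp n (n + m) l}.ncard : ℝ) := by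
  classical
  induction m with
  | zero =>
    simp only [transition, Matrix.one_apply]
    have : {v : Space d | (k, v) ∈ R.decomp n (n + 0) l} = if k = l then {0} else ∅ := by
      ext v
      have := Set.ext_iff.1 (decomp_self (R := R) n l) (k, v)
      refine this.trans ?_
      split_ifs with h <;> simp [h]
    rw [this]
    split_ifs <;> simp
  | succ m ih =>
    have hfus := (R.isPatch_fusion (n + m) l).finite
    have hV : ∀ k', {v : Space d | (k, v) ∈ R.decomp n (n + m) k'}.Finite := fun k' =>
      (finite_decomp (Nat.le_add_right n m) k').preimage
        ((Prod.mk_right_injective k).injOn)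
    have hW : ∀ k', {v : Space d | (k', v) ∈ R.fusion (n + m) l}.Finite := fun k' =>
      hfus.preimage ((Prod.mk_right_injective k').injOn)
    have h1 : {v : Space d | (k, v) ∈ R.decomp n (n + (m + 1)) l} =
        ⋃ s ∈ R.fusion (n + m) l,
          (fun v => v + s.2) '' {v | (k, v) ∈ R.decomp n (n + m) s.1} := by
      ext v
      have := Set.ext_iff.1 (decomp_succ (R := R) (Nat.le_add_right n m) l) (k, v)
      refine this.trans ?_
      simp only [mem_iUnion, mem_translate, mem_image, exists_prop]
      refine exists_congr fun s => and_congr_right fun _ => ?_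
      constructor
      · exact fun h => ⟨_, h, by simp⟩
      · rintro ⟨w, hw, rfl⟩
        simpa using hw
    have h2 : {v : Space d | (k, v) ∈ R.decomp n (n + (m + 1)) l}.ncard =
        ∑ s ∈ hfus.toFinset, {v : Space d | (k, v) ∈ R.decomp n (n + m) s.1}.ncard := by
      rw [h1, hfus.ncard_biUnion (fun s _ => (hV s.1).image _),
        finsum_mem_eq_finite_toFinset_sum _ hfus]
      · exact Finset.sum_congr rfl fun s _ =>
          ncard_image_of_injective _ (add_left_injective s.2)
      · -- an `n`-supertile lies in only one of the `(n+m)`-supertiles that have been fused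
        intro s hs s' hs' hne
        refine Set.disjoint_left.2 ?_
        rintro _ ⟨v, hv, rfl⟩ ⟨v', hv', he⟩
        have ht : (k, v + s.2) ∈ translate s.2 (R.decomp n (n + m) s.1) := ⟨(k, v), hv, rfl⟩
        have ht' : (k, v + s.2) ∈ translate s'.2 (R.decomp n (n + m) s'.1) :=
          ⟨(k, v'), hv', Prod.ext rfl he⟩
        obtain ⟨x, hx⟩ := (R.isPrototile_tileSupp n (k, v + s.2)).interior_nonempty
        exact hne ((R.isPatch_fusion (n + m) l).nonOverlapping.eq_of_mem_interior
          (R.isPrototile_supp (n + m)) hs hs'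
          (interior_mono (tileSupp_subset_of_mem_decomp (Nat.le_add_right n m) ht) hx)
          (tileSupp_subset_of_mem_decomp (Nat.le_add_right n m) ht' (interior_subset hx)))
    have h3 : ∀ f : Fin (R.j (n + m)) → ℝ, ∑ s ∈ hfus.toFinset, f s.1 =
        ∑ k', f k' * R.transitionStep (n + m) k' l := by
      intro f
      rw [← Finset.sum_fiberwise hfus.toFinset (fun s => s.1) fun s => f s.1]
      refine Finset.sum_congr rfl fun k' _ => ?_
      rw [Finset.sum_congr rfl fun s hs => congrArg f (Finset.mem_filter.1 hs).2,
        Finset.sum_const, nsmul_eq_mul, mul_comm, transitionStep,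
        ← ncard_image_of_injective _ (Prod.mk_right_injective k'), ← Set.ncard_coe_finset]
      congr 3
      ext s
      simp only [Finset.coe_filter, Finite.mem_toFinset, mem_ofPred_eq, mem_image]
      constructor
      · rintro ⟨hs, rfl⟩
        exact ⟨s.2, hs, rfl⟩
      · rintro ⟨v, hv, rfl⟩
        exact ⟨hv, rfl⟩
    rw [h2, transition, Matrix.mul_apply]
    push_cast
    rw [h3 fun k' => ({v : Space d | (k, v) ∈ R.decomp n (n + m) k'}.ncard : ℝ)]
    simp only [ih]

/-! ### Recognition -/

theorem subdivisionMap_translate (n : ℕ) (v : Space d) (T : R.tilingSpace (n + 1)) :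
    R.subdivisionMap n (R.translateTiling (n + 1) v T) =
      R.translateTiling n v (R.subdivisionMap n T) := by
  refine Subtype.ext (Tiling.ext ?_)
  ext t
  simp only [subdivisionMap, translateTiling, subdivide, Tiling.translate, mem_iUnion,
    mem_translate, exists_prop]
  constructor
  · rintro ⟨s, hs, ht⟩
    exact ⟨_, hs, by simpa [sub_sub, add_comm] using ht⟩
  · rintro ⟨s, hs, ht⟩
    exact ⟨(s.1, s.2 + v), by simpa using hs, by simpa [sub_sub, add_comm] using ht⟩

variable (R) in
/-- Subdivision of tilings by `n`-supertiles all the way down to tilings by prototiles. -/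
def expand : ∀ n, R.tilingSpace n → R.tilingSpace 0
  | 0 => id
  | n + 1 => expand n ∘ R.subdivisionMap n

theorem IsRecognizable.isHomeomorph_expand (hrec : R.IsRecognizable) :
    ∀ n, IsHomeomorph (R.expand n)
  | 0 => IsHomeomorph.id
  | n + 1 => (hrec.isHomeomorph_expand n).comp (hrec n)

theorem expand_translate : ∀ (n : ℕ) (v : Space d) (T : R.tilingSpace n),
    R.expand n (R.translateTiling n v T) = R.translateTiling 0 v (R.expand n T)
  | 0, _, _ => rfl
  | n + 1, v, T => by
    simp only [expand, Function.comp_apply, subdivisionMap_translate, expand_translate n]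

/-- The tiling by `n`-supertiles from which a given tiling arises by subdivision. -/
noncomputable def IsRecognizable.recog (hrec : R.IsRecognizable) (n : ℕ) :
    R.tilingSpace 0 ≃ₜ R.tilingSpace n :=
  ((hrec.isHomeomorph_expand n).homeomorph _).symm

variable (hrec : R.IsRecognizable)

theorem IsRecognizable.expand_recog (n : ℕ) (T : R.tilingSpace 0) :
    R.expand n (hrec.recog n T) = T :=
  ((hrec.isHomeomorph_expand n).homeomorph _).apply_symm_apply T

theorem IsRecognizable.recog_expand (n : ℕ) (T : R.tilingSpace n) :
    hrec.recog n (R.expand n T) = T :=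
  ((hrec.isHomeomorph_expand n).homeomorph _).symm_apply_apply T

theorem IsRecognizable.recog_zero (T : R.tilingSpace 0) : hrec.recog 0 T = T :=
  hrec.recog_expand 0 T

theorem IsRecognizable.recog_translate (n : ℕ) (v : Space d) (T : R.tilingSpace 0) :
    hrec.recog n (R.translateTiling 0 v T) = R.translateTiling n v (hrec.recog n T) := by
  conv_lhs => rw [← hrec.expand_recog n T, ← expand_translate, hrec.recog_expand]

theorem IsRecognizable.mem_recog_translate {n : ℕ} {v : Space d} {T : R.tilingSpace 0}
    {t : Fin (R.j n) × Space d} :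
    t ∈ (hrec.recog n (R.translateTiling 0 v T)).1.tiles ↔
      (t.1, t.2 - v) ∈ (hrec.recog n T).1.tiles := by
  rw [hrec.recog_translate]
  exact Tiling.mem_translate_tiles

theorem IsRecognizable.subdivisionMap_recog (n : ℕ) (T : R.tilingSpace 0) :
    R.subdivisionMap n (hrec.recog (n + 1) T) = hrec.recog n T := by
  rw [← hrec.recog_expand n (R.subdivisionMap n (hrec.recog (n + 1) T))]
  exact congrArg _ (hrec.expand_recog (n + 1) T)

/-- The `n`-supertiles of a tiling are those in the decompositions of its `N`-supertiles. -/
theorem IsRecognizable.mem_recog_iff {n N : ℕ} (hnN : n ≤ N) {T : R.tilingSpace 0}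
    {t : Fin (R.j n) × Space d} :
    t ∈ (hrec.recog n T).1.tiles ↔
      ∃ s ∈ (hrec.recog N T).1.tiles, t ∈ translate s.2 (R.decomp n N s.1) := by
  induction N, hnN using Nat.le_induction with
  | base =>
    simp only [decomp_self, mem_translate, mem_singleton_iff, Prod.mk.injEq, sub_eq_zero]
    constructor
    · exact fun h => ⟨t, h, rfl, rfl⟩
    · rintro ⟨s, hs, h1, h2⟩
      rwa [show t = s from Prod.ext h1 h2]
  | succ N hN ih =>
    rw [ih, ← hrec.subdivisionMap_recog N]
    simp only [subdivisionMap, subdivide, mem_iUnion, exists_prop, mem_translate, decomp_succ hN]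
    constructor
    · rintro ⟨u, ⟨s, hs, hu⟩, ht⟩
      exact ⟨s, hs, _, hu, by simpa [sub_sub] using ht⟩
    · rintro ⟨s, hs, u, hu, ht⟩
      exact ⟨(u.1, u.2 + s.2), ⟨s, hs, by simpa using hu⟩, by
        simpa [sub_sub, add_comm] using ht⟩

theorem IsRecognizable.supertile_unique {n N : ℕ} (hnN : n ≤ N) {T : R.tilingSpace 0}
    {t : Fin (R.j n) × Space d} {s s' : Fin (R.j N) × Space d}
    (hs : s ∈ (hrec.recog N T).1.tiles) (hs' : s' ∈ (hrec.recog N T).1.tiles)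
    (ht : t ∈ translate s.2 (R.decomp n N s.1)) (ht' : t ∈ translate s'.2 (R.decomp n N s'.1)) :
    s = s' := by
  obtain ⟨x, hx⟩ := (R.isPrototile_tileSupp n t).interior_nonempty
  exact (hrec.recog N T).1.nonOverlapping.eq_of_mem_interior (R.isPrototile_supp N) hs hs'
    (interior_mono (tileSupp_subset_of_mem_decomp hnN ht) hx)
    (tileSupp_subset_of_mem_decomp hnN ht' (interior_subset hx))

/-- Deep inside an `N`-supertile the `n`-supertiles are determined by its decomposition. -/
theorem IsRecognizable.mem_decomp_of_mem_interior {n N : ℕ} (hnN : n ≤ N) {T : R.tilingSpace 0}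
    {t : Fin (R.j n) × Space d} {s : Fin (R.j N) × Space d}
    (ht : t ∈ (hrec.recog n T).1.tiles) (hs : s ∈ (hrec.recog N T).1.tiles) {x : Space d}
    (hxt : x ∈ tileSupp (R.supp n) t) (hxs : x ∈ interior (tileSupp (R.supp N) s)) :
    t ∈ translate s.2 (R.decomp n N s.1) := by
  obtain ⟨s', hs', ht'⟩ := (hrec.mem_recog_iff hnN).1 ht
  rwa [(hrec.recog N T).1.nonOverlapping.eq_of_mem_interior (R.isPrototile_supp N) hs hs' hxs
    (tileSupp_subset_of_mem_decomp hnN ht' hxt)]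

theorem IsRecognizable.agreeOn {N : ℕ} {T T' : R.tilingSpace 0} {s : Fin (R.j N) × Space d}
    (hs : s ∈ (hrec.recog N T).1.tiles) (hs' : s ∈ (hrec.recog N T').1.tiles) {K : Set (Space d)}
    (hK : K ⊆ interior (tileSupp (R.supp N) s)) : Tiling.AgreeOn K T.1 T'.1 := by
  have key : ∀ T T' : R.tilingSpace 0, s ∈ (hrec.recog N T).1.tiles →
      s ∈ (hrec.recog N T').1.tiles → ∀ t, (tileSupp (R.supp 0) t ∩ K).Nonempty →
      t ∈ T.1.tiles → t ∈ T'.1.tiles := by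
    rintro T T' hs hs' t ⟨x, hxt, hxK⟩ ht
    rw [← hrec.recog_zero T] at ht
    rw [← hrec.recog_zero T']
    exact (hrec.mem_recog_iff (Nat.zero_le N)).2 ⟨s, hs',
      hrec.mem_decomp_of_mem_interior (Nat.zero_le N) ht hs hxt (hK hxK)⟩
  exact Tiling.agreeOn_iff.2 fun t ht => ⟨key T T' hs hs' t ht, key T' T hs' hs t ht⟩

/-- By primitivity every tiling contains supertiles of all types and levels. -/
theorem IsRecognizable.exists_supertile (hprim : R.IsPrimitive) (T : R.tilingSpace 0) (n : ℕ)
    (k : Fin (R.j n)) : ∃ v, (k, v) ∈ (hrec.recog n T).1.tiles := by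
  obtain ⟨m, -, hm⟩ := hprim n
  obtain ⟨s, hs⟩ : (hrec.recog (n + m) T).1.tiles.Nonempty := by
    by_contra hemp
    have := (hrec.recog (n + m) T).1.cover_eq
    rw [not_nonempty_iff_eq_empty.1 hemp] at this
    simp only [cover, biUnion_empty] at this
    exact (Set.empty_ne_univ this)
  have h1 := hm k s.1
  rw [transition_eq_ncard, Nat.cast_pos] at h1
  obtain ⟨v, hv⟩ := nonempty_of_ncard_ne_zero h1.ne'
  exact ⟨v + s.2, (hrec.mem_recog_iff (Nat.le_add_right n m)).2 ⟨s, hs, _, hv, rfl⟩⟩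

theorem IsRecognizable.exists_tiling (hprim : R.IsPrimitive) (hne : (R.tilingSpace 0).Nonempty)
    (n : ℕ) (k : Fin (R.j n)) : ∃ T : R.tilingSpace 0, (k, 0) ∈ (hrec.recog n T).1.tiles := by
  obtain ⟨T, hT⟩ := hne
  obtain ⟨v, hv⟩ := hrec.exists_supertile hprim ⟨T, hT⟩ n k
  exact ⟨R.translateTiling 0 (-v) ⟨T, hT⟩, hrec.mem_recog_translate.2 (by simpa using hv)⟩

/-! ### Compactness of the space of fusion tilings -/

/-- Since any tiling contains copies of all admitted patches, finite local complexity of one tiling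
bounds the displacements in all of them. -/
theorem IsRecognizable.exists_hasDisplacements (hrec : R.IsRecognizable)
    (hprim : R.IsPrimitive) (hFLC : R.HasFLC)
    (hne : (R.tilingSpace 0).Nonempty) :
    ∃ D : Set (Fin (R.j 0) × Fin (R.j 0) × Space d), D.Finite ∧
      HasDisplacements (R.tilingSpace 0) D := by
  obtain ⟨T₀, hT₀⟩ := hne
  obtain ⟨F, hF, hFP⟩ := hFLC T₀ hT₀
  refine ⟨⋃ Q ∈ {Q ∈ F | Q.Finite}, (fun p => (p.1.1, p.2.1, p.2.2 - p.1.2)) '' (Q ×ˢ Q),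
    (hF.subset (sep_subset _ _)).biUnion fun Q hQ => (hQ.2.prod hQ.2).image _, ?_⟩
  intro T hT t ht s hs hne hts
  have hP : IsPatch (R.supp 0) {t, s} := by
    refine ⟨by simp, T.nonOverlapping.mono (by simp [insert_subset_iff, ht, hs]), ?_⟩
    simp only [cover, biUnion_insert, biUnion_singleton]
    exact (R.tileSupp_connected 0 t).union hts (R.tileSupp_connected 0 s)
  obtain ⟨N, l, v, hv⟩ := hT _ hP (by simp [insert_subset_iff, ht, hs])
  obtain ⟨u, hu⟩ := hrec.exists_supertile hprim ⟨T₀, hT₀⟩ N l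
  have h1 : translate (v + u) {t, s} ⊆ T₀.tiles := by
    rw [← translate_translate]
    refine (translate_mono hv).trans fun x hx => ?_
    have := (hrec.mem_recog_iff (Nat.zero_le N) (T := ⟨T₀, hT₀⟩)).2 ⟨(l, u), hu, hx⟩
    rwa [hrec.recog_zero] at this
  obtain ⟨Q, hQ, w, hw⟩ := hFP _ (hP.translate (v + u)) (by
    rw [translate, Set.ncard_image_of_injective _ fun a b hab => ?_, Set.ncard_pair hne]
    simp only [Prod.mk.injEq, add_left_inj] at hab
    exact Prod.ext hab.1 hab.2) h1
  have hQ' : Q = translate (v + u - w) {t, s} := by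
    rw [sub_eq_add_neg, ← translate_translate, hw, translate_translate, add_neg_cancel,
      translate_zero]
  refine mem_biUnion (show Q ∈ {Q ∈ F | Q.Finite} from ⟨hQ, ?_⟩) ?_
  · rw [hQ']
    exact (hP.translate _).finite
  · refine ⟨((t.1, t.2 + (v + u - w)), (s.1, s.2 + (v + u - w))), ⟨?_, ?_⟩, ?_⟩
    · rw [hQ']
      exact ⟨t, by simp, rfl⟩
    · rw [hQ']
      exact ⟨s, by simp, rfl⟩
    · simp

theorem isClosed_tilingSpace : IsClosed (R.tilingSpace 0) := by
  rw [← closure_subset_iff_isClosed]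
  intro T hT P hP hPT
  have hc : IsCompact (cover (R.supp 0) P) := (hP.isPrototile_cover R.isPrototile).isCompact
  obtain ⟨ρ, hρ⟩ := hc.isBounded.exists_norm_le
  obtain ⟨ε, hε, hερ⟩ : ∃ ε > 0, |ρ| ≤ 1 / ε - ε := by
    refine ⟨1 / (|ρ| + 1), by positivity, ?_⟩
    rw [one_div_one_div]
    have : 1 / (|ρ| + 1) ≤ 1 := by
      rw [div_le_one (by positivity)]
      linarith [abs_nonneg ρ]
    linarith
  obtain ⟨T', hT'T, hT'⟩ := (mem_closure_iff_nhds_basis (Tiling.nhds_basis T)).1 hT ε hε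
  obtain ⟨w, -, hw⟩ := Tiling.Close.exists_shift hT'
  refine Admits.translate R w (hT'T _ (hP.translate w) ?_)
  rintro _ ⟨t, ht, rfl⟩
  refine hw t (hPT ht) ?_
  obtain ⟨x, hx⟩ := (R.tileSupp_connected 0 t).nonempty
  refine ⟨x, hx, ?_⟩
  rw [mem_closedBall_zero_iff]
  exact (hρ x (mem_biUnion (t := fun t => tileSupp (R.supp 0) t) ht hx)).trans
    ((le_abs_self ρ).trans hερ)

theorem IsRecognizable.isCompact_tilingSpace (hrec : R.IsRecognizable)
    (hprim : R.IsPrimitive) (hFLC : R.HasFLC)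
    (hne : (R.tilingSpace 0).Nonempty) : IsCompact (R.tilingSpace 0) := by
  obtain ⟨D, hD, hX⟩ := hrec.exists_hasDisplacements hprim hFLC hne
  refine isCompact_iff_ultrafilter_le_nhds.2 fun 𝒰 h𝒰 => ?_
  have h𝒰' : R.tilingSpace 0 ∈ 𝒰 := le_principal_iff.1 h𝒰
  obtain ⟨T, hT⟩ := exists_le_nhds_of_hasDisplacements R.isPrototile hD hX 𝒰 h𝒰'
  exact ⟨T, isClosed_tilingSpace.mem_of_tendsto (f := id) hT h𝒰', hT⟩

instance : T2Space (R.tilingSpace 0) := by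
  have := Tiling.t0Space R.isPrototile
  have : T2Space (Tiling R.proto) := inferInstance
  exact (inferInstance : T2Space {T : Tiling R.proto // T ∈ R.tilingSpace 0})

end FusionRule

end FusionTiling

namespace FusionTiling

open scoped ENNReal NNReal

/-! ### Boundaries -/

theorem inter_frontier_nonempty_of_isPreconnected {α : Type*} [TopologicalSpace α] {C S : Set α}
    (hC : IsPreconnected C) (h1 : (C ∩ S).Nonempty) (h2 : (C ∩ Sᶜ).Nonempty) :
    (C ∩ frontier S).Nonempty := by
  by_contra hn
  have hn' : ∀ x ∈ C, x ∈ frontier S → False := fun x hx hf => hn ⟨x, hx, hf⟩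
  have hsub : C ⊆ interior S ∪ (closure S)ᶜ := by
    intro x hx
    by_cases hi : x ∈ interior S
    · exact Or.inl hi
    · exact Or.inr fun hc => hn' x hx ⟨hc, hi⟩
  obtain ⟨x, hxC, hxS⟩ := h1
  have hxi : x ∈ interior S := by
    rcases hsub hxC with h | h
    · exact h
    · exact absurd (subset_closure hxS) h
  have := IsPreconnected.subset_left_of_subset_union isOpen_interior isClosed_closure.isOpen_compl
    (Set.disjoint_left.2 fun y hy hy' => hy' (subset_closure (interior_subset hy))) hsub
    ⟨x, hxC, hxi⟩ hC
  obtain ⟨y, hyC, hyS⟩ := h2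
  exact hyS (interior_subset (this hyC))

variable {d : ℕ}

theorem mem_cthickening_frontier {S : Set (Space d)} {x y : Space d} {r : ℝ} (hx : x ∈ S)
    (hy : y ∉ S) (hr : dist x y ≤ r) :
    x ∈ Metric.cthickening r (frontier S) ∧ y ∈ Metric.cthickening r (frontier S) := by
  obtain ⟨z, hz, hzf⟩ := inter_frontier_nonempty_of_isPreconnected
    (convex_segment x y).isPreconnected ⟨x, left_mem_segment ℝ x y, hx⟩
    ⟨y, right_mem_segment ℝ x y, hy⟩
  have hd := dist_add_dist_of_mem_segment hz
  constructor
  · refine Metric.mem_cthickening_of_dist_le x z r _ hzf ?_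
    linarith [dist_nonneg (x := z) (y := y)]
  · refine Metric.mem_cthickening_of_dist_le y z r _ hzf ?_
    rw [dist_comm]
    linarith [dist_nonneg (x := x) (y := z)]

theorem closedBall_subset_interior_of_notMem_cthickening {S : Set (Space d)} {x : Space d} {r : ℝ}
    (hx : x ∈ S) (hr : x ∉ Metric.cthickening r (frontier S)) :
    Metric.closedBall x r ⊆ interior S := by
  intro y hy
  rw [Metric.mem_closedBall'] at hy
  by_contra hyi
  by_cases hyS : y ∈ S
  · exact hr (Metric.mem_cthickening_of_dist_le x y r _ ⟨subset_closure hyS, hyi⟩ hy)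
  · exact hr (mem_cthickening_frontier hx hyS hy).1

theorem tsum_le_of_unique {α : Type*} {f : α → ℝ≥0∞} {x : ℝ≥0∞} (h1 : ∀ a, f a ≤ x)
    (h : ∀ a b, f a ≠ 0 → f b ≠ 0 → a = b) : ∑' a, f a ≤ x := by
  by_cases h0 : ∃ a, f a ≠ 0
  · obtain ⟨a, ha⟩ := h0
    rw [tsum_eq_single a fun b hb => by_contra fun hn => hb (h b a hn ha)]
    exact h1 a
  · push Not at h0
    simp [h0]

/-! ### Copies of patches and supertiles -/

variable {ι : Type} {supp : ι → Set (Space d)}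

/-- The translation vectors of the copies of `P` in a set of tiles. -/
def copies (P S : Set (ι × Space d)) : Set (Space d) :=
  {v | translate v P ⊆ S}

theorem copies_translate (P S : Set (ι × Space d)) (v : Space d) :
    copies P (translate v S) = v +ᵥ copies P S := by
  ext w
  rw [mem_vadd_set_iff_neg_vadd_mem]
  constructor
  · intro h
    have := translate_mono (v := -v) h
    rwa [translate_translate, translate_translate, add_neg_cancel, translate_zero,
      add_comm w] at this
  · intro h
    have := translate_mono (v := v) h
    rw [translate_translate, vadd_eq_add] at this
    rwa [show -v + w + v = w by abel] at this

theorem exists_separation_copies [Finite ι] (h : ∀ i, IsPrototile (supp i))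
    {P : Set (ι × Space d)} (hP : P.Nonempty) :
    ∃ δ > 0, ∀ S, NonOverlapping supp S → (copies P S).Pairwise fun x y => δ ≤ dist x y := by
  obtain ⟨δ, hδ, hs⟩ := exists_separation h
  obtain ⟨t, ht⟩ := hP
  refine ⟨δ, hδ, fun S hS v hv w hw hne => ?_⟩
  by_contra! hlt
  refine hne (add_left_cancel (hs S hS t.1 (t.2 + v) (t.2 + w) (hv ⟨t, ht, rfl⟩)
    (hw ⟨t, ht, rfl⟩) ?_))
  rwa [dist_add_left]

theorem eventually_le_one_div_sub (ρ : ℝ) : ∀ᶠ ε in 𝓝[>] (0 : ℝ), ρ ≤ 1 / ε - ε := by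
  have h1 : ∀ᶠ ε in 𝓝[>] (0 : ℝ), ρ + 1 ≤ ε⁻¹ :=
    tendsto_inv_nhdsGT_zero.eventually_ge_atTop _
  have h2 : ∀ᶠ ε in 𝓝[>] (0 : ℝ), ε < 1 :=
    (gt_mem_nhds one_pos).filter_mono nhdsWithin_le_nhds
  filter_upwards [h1, h2] with ε h1 h2
  rw [one_div]
  linarith

/-- Close to `T`, each copy of `P` in `T` reappears after a small shift. -/
theorem eventually_exists_shift_copies (hsupp : ∀ i, (supp i).Nonempty) {P : Set (ι × Space d)}
    (hP : P.Finite) (r : ℝ) {η : ℝ} (hη : 0 < η) :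
    ∃ ε > 0, ∀ T T' : Tiling supp, Tiling.Close ε T T' → ∀ v ∈ copies P T.tiles, ‖v‖ ≤ r →
      ∃ w, ‖w‖ < η ∧ v + w ∈ copies P T'.tiles := by
  choose x hx using hsupp
  obtain ⟨ρ, hρ⟩ := (hP.image fun t => t.2 + x t.1).isBounded.exists_norm_le
  have h1 : ∀ᶠ ε in 𝓝[>] (0 : ℝ), 2 * ε < η := by
    have : ∀ᶠ ε in 𝓝 (0 : ℝ), 2 * ε < η :=
      (continuous_const.mul continuous_id).tendsto' 0 0 (by simp) |>.eventually_lt_const hη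
    exact this.filter_mono nhdsWithin_le_nhds
  obtain ⟨ε, ⟨h2, h3⟩, h4⟩ :=
    ((h1.and (eventually_le_one_div_sub (ρ + r))).and self_mem_nhdsWithin).exists
  refine ⟨ε, h4, fun T T' hTT' v hv hvr => ?_⟩
  obtain ⟨w, hw, hwT⟩ := hTT'.exists_shift
  refine ⟨w, hw.trans_lt h2, ?_⟩
  rintro _ ⟨t, ht, rfl⟩
  have := hwT (t.1, t.2 + v) (hv ⟨t, ht, rfl⟩) ⟨t.2 + v + x t.1, ⟨x t.1, hx t.1, rfl⟩, ?_⟩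
  · simpa [add_assoc] using this
  · rw [mem_closedBall_zero_iff]
    have h5 := hρ _ (mem_image_of_mem (fun t => t.2 + x t.1) ht)
    have h6 := norm_add_le (t.2 + x t.1) v
    rw [show t.2 + x t.1 + v = t.2 + v + x t.1 by abel] at h6
    linarith

theorem isOpen_copies_hit (hsupp : ∀ i, (supp i).Nonempty) {P : Set (ι × Space d)}
    (hP : P.Finite) {U : Set (Space d)} (hU : IsOpen U) :
    IsOpen {T : Tiling supp | (copies P T.tiles ∩ U).Nonempty} := by
  rintro T ⟨v, hv, hvU⟩
  obtain ⟨η, hη, hb⟩ := Metric.isOpen_iff.1 hU v hvU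
  obtain ⟨ε, hε, h⟩ := eventually_exists_shift_copies hsupp hP ‖v‖ hη
  refine ⟨ε, hε, fun T' hT' => ?_⟩
  obtain ⟨w, hw, hwT⟩ := h T T' hT' v hv le_rfl
  exact ⟨v + w, hwT, hb (by simpa [dist_eq_norm] using hw)⟩

namespace FusionRule

variable {R : FusionRule d} (hrec : R.IsRecognizable)

theorem supp_nonempty (n : ℕ) (k : Fin (R.j n)) : (R.supp n k).Nonempty :=
  (R.supp_connected n k).nonempty

theorem continuous_translateTiling (v : Space d) : Continuous (R.translateTiling 0 v) := by
  refine continuous_induced_rng.2 ?_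
  refine Continuous.comp (g := fun T : Tiling (R.supp 0) => T.translate v) ?_ continuous_subtype_val
  refine continuous_iff_continuousAt.2 fun T => ?_
  refine (Tiling.nhds_basis T).tendsto_iff (Tiling.nhds_basis _) |>.2 fun ε hε => ?_
  have h1 : 0 < 1 / ε + ‖v‖ := by positivity
  refine ⟨min ε (1 / (1 / ε + ‖v‖)), by positivity, fun T' hT' => ?_⟩
  refine Tiling.Close.translate hT' (min_le_left _ _) ?_
  have := one_div_le_one_div_of_le (by positivity) (min_le_right ε (1 / (1 / ε + ‖v‖)))
  rwa [one_div_one_div] at this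

theorem continuous_translateTiling_left (T : R.tilingSpace 0) :
    Continuous fun v => R.translateTiling 0 v T := by
  refine continuous_induced_rng.2 (continuous_iff_continuousAt.2 fun v => ?_)
  refine Metric.nhds_basis_ball.tendsto_iff (Tiling.nhds_basis _) |>.2 fun ε hε => ?_
  refine ⟨ε, hε, fun w hw => ?_⟩
  have h1 := Tiling.close_translate (v := w - v) (ε := ε) (by
    rw [← dist_eq_norm]; exact (Metric.mem_ball.1 hw).le) (T.1.translate v)
  rwa [Tiling.translate_translate, add_sub_cancel] at h1

theorem isPointProcess_copies {P : Set (Fin (R.j 0) × Space d)} (hP : P.Finite)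
    (hne : P.Nonempty) :
    IsPointProcess (R.translateTiling 0) fun T : R.tilingSpace 0 => copies P T.1.tiles where
  separated := by
    obtain ⟨δ, hδ, h⟩ := exists_separation_copies R.isPrototile hne
    exact ⟨δ, hδ, fun T => h _ T.1.nonOverlapping⟩
  measurableSet_hit U hU :=
    ((isOpen_copies_hit (R.supp_nonempty 0) hP hU).preimage continuous_subtype_val).measurableSet
  equivariant v T := copies_translate P T.1.tiles v

/-- The positions of the `n`-supertiles of type `k` in a tiling. -/
def IsRecognizable.positions (n : ℕ) (k : Fin (R.j n)) (T : R.tilingSpace 0) : Set (Space d) :=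
  {v | (k, v) ∈ (hrec.recog n T).1.tiles}

theorem IsRecognizable.positions_eq_copies (n : ℕ) (k : Fin (R.j n)) (T : R.tilingSpace 0) :
    hrec.positions n k T = copies {(k, 0)} (hrec.recog n T).1.tiles := by
  ext v
  simp [positions, copies, translate]

theorem IsRecognizable.isPointProcess_positions (n : ℕ) (k : Fin (R.j n)) :
    IsPointProcess (R.translateTiling 0) (hrec.positions n k) where
  separated := by
    obtain ⟨δ, hδ, h⟩ := exists_separation_copies (R.isPrototile_supp n)
      (singleton_nonempty (k, (0 : Space d)))
    refine ⟨δ, hδ, fun T => ?_⟩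
    rw [hrec.positions_eq_copies]
    exact h _ (hrec.recog n T).1.nonOverlapping
  measurableSet_hit U hU := by
    simp only [hrec.positions_eq_copies]
    exact ((isOpen_copies_hit (R.supp_nonempty n) (finite_singleton _) hU).preimage
      (continuous_subtype_val.comp (hrec.recog n).continuous)).measurableSet
  equivariant v T := by
    rw [hrec.positions_eq_copies, hrec.positions_eq_copies, hrec.recog_translate]
    exact copies_translate _ _ v

/-! ### Supertile frequencies of an invariant measure -/

instance (μ : R.InvariantMeasure) : IsProbabilityMeasure μ.1 := μ.2.1

/-- The mean number per unit volume of `n`-supertiles of type `k`. -/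
noncomputable def IsRecognizable.freq (μ : R.InvariantMeasure) (n : ℕ) (k : Fin (R.j n)) : ℝ≥0 :=
  ((hrec.isPointProcess_positions n k).exists_intensity μ.1 μ.2.2).choose

theorem IsRecognizable.lintegral_positions (μ : R.InvariantMeasure) (n : ℕ) (k : Fin (R.j n))
    {g : Space d → ℝ≥0∞} (hg : Measurable g) :
    ∫⁻ T, ∑' v : hrec.positions n k T, g v ∂μ.1 = hrec.freq μ n k * ∫⁻ v, g v :=
  ((hrec.isPointProcess_positions n k).exists_intensity μ.1 μ.2.2).choose_spec g hg

theorem tsum_tiles {n : ℕ} (P : Set (Fin (R.j n) × Space d))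
    (g : Fin (R.j n) × Space d → ℝ≥0∞) :
    ∑' t : P, g t = ∑ k, ∑' v : {v | (k, v) ∈ P}, g (k, v) := by
  rw [tsum_subtype P g, ENNReal.tsum_prod', tsum_fintype]
  refine Finset.sum_congr rfl fun k _ => ?_
  rw [tsum_subtype {v | (k, v) ∈ P} fun v => g (k, v)]
  rfl

theorem IsRecognizable.measurable_tsum_tiles (n : ℕ) {g : Fin (R.j n) × Space d → ℝ≥0∞}
    (hg : ∀ k, Measurable fun v => g (k, v)) :
    Measurable fun T => ∑' t : (hrec.recog n T).1.tiles, g t := by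
  simp only [tsum_tiles]
  exact Finset.measurable_sum _ fun k _ =>
    (hrec.isPointProcess_positions n k).measurable_tsum (hg k)

/-- Campbell's formula for the `n`-supertiles of all types. -/
theorem IsRecognizable.lintegral_tiles (μ : R.InvariantMeasure) (n : ℕ)
    {g : Fin (R.j n) × Space d → ℝ≥0∞} (hg : ∀ k, Measurable fun v => g (k, v)) :
    ∫⁻ T, ∑' t : (hrec.recog n T).1.tiles, g t ∂μ.1 =
      ∑ k, hrec.freq μ n k * ∫⁻ v, g (k, v) := by
  simp only [tsum_tiles]
  rw [lintegral_finsetSum]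
  · exact Finset.sum_congr rfl fun k _ => hrec.lintegral_positions μ n k (hg k)
  · exact fun k _ => (hrec.isPointProcess_positions n k).measurable_tsum (hg k)

/-- Almost every point lies in exactly one `n`-supertile, and supertiles have null boundaries. -/
theorem IsRecognizable.sum_freq_mul_volume (μ : R.InvariantMeasure) (n : ℕ) :
    ∑ k, (hrec.freq μ n k : ℝ≥0∞) * volume (R.supp n k) = 1 := by
  have hneg : ∀ s : Set (Space d), MeasurableSet s →
      Measurable (fun v : Space d => s.indicator (1 : Space d → ℝ≥0∞) (-v)) ∧
      ∫⁻ v, s.indicator (1 : Space d → ℝ≥0∞) (-v) = volume s := fun s hs =>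
    ⟨(measurable_one.indicator hs).comp measurable_neg, by
      rw [lintegral_neg_eq_self (fun v => s.indicator (1 : Space d → ℝ≥0∞) v),
        lintegral_indicator_one hs]⟩
  have hmem : ∀ (T : R.tilingSpace 0) (t : (hrec.recog n T).1.tiles) (s : Set (Space d)),
      -t.1.2 ∈ s ↔ (0 : Space d) ∈ t.1.2 +ᵥ s := fun T t s => by
    rw [mem_vadd_set_iff_neg_vadd_mem, vadd_eq_add, add_zero]
  apply le_antisymm
  · have hvol : ∀ k, volume (R.supp n k) = volume (interior (R.supp n k)) := by
      intro k
      refine le_antisymm ?_ (measure_mono interior_subset)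
      have h1 : R.supp n k ⊆ interior (R.supp n k) ∪ frontier (R.supp n k) := by
        rw [(R.isPrototile_supp n k).isClosed.frontier_eq, union_sdiff_self]
        exact subset_union_right
      refine (measure_mono h1).trans ((measure_union_le _ _).trans ?_)
      rw [(R.isPrototile_supp n k).volume_frontier, add_zero]
    simp only [hvol]
    simp only [← (hneg _ isOpen_interior.measurableSet).2]
    rw [← hrec.lintegral_tiles μ n
      (g := fun t => (interior (R.supp n t.1)).indicator (1 : Space d → ℝ≥0∞) (-t.2))
      fun k => (hneg (interior (R.supp n k)) isOpen_interior.measurableSet).1]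
    refine (lintegral_mono (g := fun _ => (1 : ℝ≥0∞)) fun T => ?_).trans (by simp)
    refine tsum_le_of_unique (fun t => indicator_le_self' (fun _ _ => zero_le) _) ?_
    intro t s ht hs
    have ht' := mem_of_indicator_ne_zero ht
    have hs' := mem_of_indicator_ne_zero hs
    rw [hmem, ← interior_vadd] at ht' hs'
    exact Subtype.ext ((hrec.recog n T).1.nonOverlapping.eq_of_mem_interior
      (R.isPrototile_supp n) t.2 s.2 ht' (interior_subset hs'))
  · simp only [← (hneg _ (R.isPrototile_supp n _).isClosed.measurableSet).2]
    rw [← hrec.lintegral_tiles μ n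
      (g := fun t => (R.supp n t.1).indicator (1 : Space d → ℝ≥0∞) (-t.2))
      fun k => (hneg (R.supp n k) (R.isPrototile_supp n k).isClosed.measurableSet).1]
    refine le_trans (by simp) (lintegral_mono (f := fun _ => (1 : ℝ≥0∞)) fun T => ?_)
    have h0 : (0 : Space d) ∈ cover (R.supp n) (hrec.recog n T).1.tiles := by
      rw [(hrec.recog n T).1.cover_eq]; trivial
    simp only [cover, mem_iUnion] at h0
    obtain ⟨t, ht, h0⟩ := h0
    refine le_trans ?_ (ENNReal.le_tsum ⟨t, ht⟩)
    rw [indicator_of_mem ((hmem T ⟨t, ht⟩ _).2 h0)]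
    rfl

/-- Campbell's formula for a point process that consists of finitely many points, at fixed relative
positions `C l`, for each `n`-supertile of type `l`. -/
theorem IsRecognizable.lintegral_tsum_tsum (μ : R.InvariantMeasure) (n : ℕ)
    {C : Fin (R.j n) → Set (Space d)} (hC : ∀ l, (C l).Finite) {f : Space d → ℝ≥0∞}
    (hf : Measurable f) :
    ∫⁻ T, ∑' s : (hrec.recog n T).1.tiles, ∑' c : C s.1.1, f (c + s.1.2) ∂μ.1 =
      (∑ l, (hrec.freq μ n l : ℝ≥0∞) * (C l).ncard) * ∫⁻ v, f v := by
  have hmeas : ∀ l, ∀ c : C l, Measurable fun v => f (c + v) := fun l c =>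
    hf.comp (measurable_const_add _)
  have hcount : ∀ l, Countable (C l) := fun l => (hC l).countable
  rw [hrec.lintegral_tiles μ n (g := fun s => ∑' c : C s.1, f (c + s.2))
    fun l => show Measurable fun v => ∑' c : C l, f (c + v) from Measurable.tsum (hmeas l),
    Finset.sum_mul]
  refine Finset.sum_congr rfl fun l _ => ?_
  rw [lintegral_tsum fun c => (hmeas l c).aemeasurable]
  simp only [lintegral_add_left_eq_self f]
  rw [ENNReal.tsum_const, mul_assoc]
  congr 2
  have := (hC l).to_subtype
  have h1 : ENat.card (C l) = ((C l).ncard : ℕ∞) := by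
    rw [(hC l).cast_ncard_eq]; rfl
  rw [h1]
  rfl

theorem finite_setOf_mem_decomp {n N : ℕ} (hnN : n ≤ N) (k : Fin (R.j n)) (l : Fin (R.j N)) :
    {v | (k, v) ∈ R.decomp n N l}.Finite :=
  (finite_decomp hnN l).preimage (Prod.mk_right_injective k).injOn

/-- The `n`-supertiles of type `k` are distributed among the `(n+m)`-supertiles. -/
theorem IsRecognizable.freq_eq_sum (μ : R.InvariantMeasure) (n m : ℕ) (k : Fin (R.j n)) :
    (hrec.freq μ n k : ℝ≥0∞) = ∑ l, (hrec.freq μ (n + m) l : ℝ≥0∞) *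
      ({v | (k, v) ∈ R.decomp n (n + m) l}.ncard : ℝ≥0∞) := by
  have hle := Nat.le_add_right n m
  set f : Space d → ℝ≥0∞ := (Metric.ball 0 1).indicator 1 with hf
  have hfm : Measurable f := measurable_one.indicator Metric.isOpen_ball.measurableSet
  have hfi : ∫⁻ v, f v = volume (Metric.ball (0 : Space d) 1) :=
    lintegral_indicator_one Metric.isOpen_ball.measurableSet
  have h0 : volume (Metric.ball (0 : Space d) 1) ≠ 0 := (Metric.measure_ball_pos _ _ one_pos).ne'
  have htop : volume (Metric.ball (0 : Space d) 1) ≠ ∞ := measure_ball_lt_top.ne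
  have h1 := hrec.lintegral_tsum_tsum μ (n + m)
    (C := fun l => {v | (k, v) ∈ R.decomp n (n + m) l})
    (fun l => finite_setOf_mem_decomp hle k l) hfm
  have h2 := hrec.lintegral_positions μ n k hfm
  rw [hfi] at h1 h2
  rw [← ENNReal.mul_left_inj h0 htop, ← h1, ← h2]
  refine lintegral_congr fun T => ?_
  have hmem : ∀ (s : Fin (R.j (n + m)) × Space d) (c : Space d),
      (k, c) ∈ R.decomp n (n + m) s.1 → (k, c + s.2) ∈ translate s.2 (R.decomp n (n + m) s.1) :=
    fun s c hc => ⟨(k, c), hc, rfl⟩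
  rw [← ENNReal.tsum_sigma' (α := (hrec.recog (n + m) T).1.tiles)
    (β := fun s => {v | (k, v) ∈ R.decomp n (n + m) s.1.1}) fun p => f (p.2.1 + p.1.1.2)]
  refine ((Equiv.ofBijective (fun p : (s : (hrec.recog (n + m) T).1.tiles) ×
    {v | (k, v) ∈ R.decomp n (n + m) s.1.1} => (⟨p.2.1 + p.1.1.2, ?_⟩ : hrec.positions n k T))
    ⟨?_, ?_⟩).tsum_eq fun v => f v).symm
  · exact (hrec.mem_recog_iff hle).2 ⟨p.1.1, p.1.2, hmem _ _ p.2.2⟩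
  · rintro ⟨⟨s, hs⟩, ⟨c, hc⟩⟩ ⟨⟨s', hs'⟩, ⟨c', hc'⟩⟩ he
    have he' : c + s.2 = c' + s'.2 := congrArg Subtype.val he
    obtain rfl : s = s' := hrec.supertile_unique hle hs hs' (hmem s c hc)
      (he' ▸ hmem s' c' hc')
    obtain rfl : c = c' := add_right_cancel he'
    rfl
  · rintro ⟨v, hv⟩
    obtain ⟨s, hs, t, ht, he⟩ := (hrec.mem_recog_iff hle).1 hv
    obtain ⟨rfl, rfl⟩ := Prod.ext_iff.1 he
    exact ⟨⟨⟨s, hs⟩, ⟨t.2, ht⟩⟩, rfl⟩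

theorem IsRecognizable.isSupertileFreq (μ : R.InvariantMeasure) :
    R.IsSupertileFreq fun n k => hrec.freq μ n k where
  nonneg n k := NNReal.coe_nonneg _
  normalized n := by
    have h1 := congrArg ENNReal.toReal (hrec.sum_freq_mul_volume μ n)
    rw [ENNReal.toReal_sum fun k _ => ENNReal.mul_ne_top ENNReal.coe_ne_top
      (R.isPrototile_supp n k).isCompact.measure_ne_top] at h1
    simpa [vol, measureReal_def] using h1
  consistent n m _ := by
    funext k
    have h1 := congrArg ENNReal.toReal (hrec.freq_eq_sum μ n m k)
    rw [ENNReal.toReal_sum fun k _ => ENNReal.mul_ne_top ENNReal.coe_ne_top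
      (ENNReal.natCast_ne_top _)] at h1
    simpa [Matrix.mulVec, dotProduct, transition_eq_ncard, mul_comm] using h1

end FusionRule

end FusionTiling

namespace FusionTiling

open scoped ENNReal NNReal

variable {d : ℕ}

namespace FusionRule

variable {R : FusionRule d} (hrec : R.IsRecognizable)

/-! ### Patch frequencies -/

/-- The van Hove property holds uniformly in the type of the supertiles: it is assumed for all
choices of types, in particular for the choice of a worst type at each level. -/
theorem IsVanHove.eventually_le (hvH : R.IsVanHove) {r : ℝ} (hr : 0 ≤ r) {η : ℝ} (hη : 0 < η) :
    ∀ᶠ n in atTop, ∀ k, volume (Metric.cthickening r (frontier (R.supp n k))) ≤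
      ENNReal.ofReal η * volume (R.supp n k) := by
  by_contra hcon
  classical
  let k : ∀ n, Fin (R.j n) := fun n =>
    if h : ∃ k, ¬ volume (Metric.cthickening r (frontier (R.supp n k))) ≤
      ENNReal.ofReal η * volume (R.supp n k) then h.choose else ⟨0, R.j_pos n⟩
  have h1 := (hvH k r hr).eventually_lt_const (ENNReal.ofReal_pos.2 hη)
  obtain ⟨n, h2, h3⟩ := ((not_eventually.1 hcon).and_eventually h1).exists
  have h4 : ∃ k, ¬ volume (Metric.cthickening r (frontier (R.supp n k))) ≤
      ENNReal.ofReal η * volume (R.supp n k) := by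
    push Not at h2 ⊢
    exact h2
  have h5 : k n = h4.choose := dif_pos h4
  refine h4.choose_spec ?_
  rw [← h5]
  exact (ENNReal.div_le_iff (R.isPrototile_supp n (k n)).volume_pos.ne'
    (R.isPrototile_supp n (k n)).isCompact.measure_ne_top).1 h3.le

/-- Boundary layers of supertiles have asymptotically vanishing density. -/
theorem IsVanHove.eventually_sum_le (hvH : R.IsVanHove) {r : ℝ} (hr : 0 ≤ r) {η : ℝ} (hη : 0 < η) :
    ∀ᶠ n in atTop, ∀ w : Fin (R.j n) → ℝ≥0∞, ∑ k, w k * volume (R.supp n k) = 1 →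
      ∑ k, w k * volume (Metric.cthickening r (frontier (R.supp n k))) ≤ ENNReal.ofReal η := by
  filter_upwards [hvH.eventually_le hr hη] with n hn w hw
  calc ∑ k, w k * volume (Metric.cthickening r (frontier (R.supp n k)))
      ≤ ∑ k, w k * (ENNReal.ofReal η * volume (R.supp n k)) := by
        gcongr with k
        exact hn k
    _ = ENNReal.ofReal η * ∑ k, w k * volume (R.supp n k) := by
        rw [Finset.mul_sum]
        exact Finset.sum_congr rfl fun k _ => mul_left_comm _ _ _
    _ = ENNReal.ofReal η := by rw [hw, mul_one]

theorem finite_copies_decomp {P : Set (Fin (R.j 0) × Space d)} (hP : P.Nonempty) (n : ℕ)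
    (k : Fin (R.j n)) : (copies P (R.decomp 0 n k)).Finite := by
  obtain ⟨t, ht⟩ := hP
  refine Finite.preimage (f := fun v => (t.1, t.2 + v)) ?_ (finite_decomp (Nat.zero_le n) k)
    |>.subset fun v hv => hv ⟨t, ht, rfl⟩
  exact fun v _ w _ h => add_left_cancel (Prod.ext_iff.1 h).2

theorem mem_copies_translate_decomp {P : Set (Fin (R.j 0) × Space d)} {n : ℕ}
    {s : Fin (R.j n) × Space d} {v : Space d} :
    v ∈ copies P (translate s.2 (R.decomp 0 n s.1)) ↔ v - s.2 ∈ copies P (R.decomp 0 n s.1) := by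
  rw [copies_translate, mem_vadd_set_iff_neg_vadd_mem, vadd_eq_add, neg_add_eq_sub]

theorem IsRecognizable.copies_subset (n : ℕ) {T : R.tilingSpace 0} {s : Fin (R.j n) × Space d}
    (hs : s ∈ (hrec.recog n T).1.tiles) (P : Set (Fin (R.j 0) × Space d)) :
    copies P (translate s.2 (R.decomp 0 n s.1)) ⊆ copies P T.1.tiles := by
  refine fun v hv => Subset.trans hv fun t ht => ?_
  rw [← hrec.recog_zero T]
  exact (hrec.mem_recog_iff (Nat.zero_le n)).2 ⟨s, hs, ht⟩

/-- Copies of `P` inside one supertile do not occur more often than all copies. -/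
theorem IsRecognizable.tsum_copies_decomp_le {P : Set (Fin (R.j 0) × Space d)} (hP : P.Nonempty)
    (n : ℕ) (T : R.tilingSpace 0) (f : Space d → ℝ≥0∞) :
    ∑' s : (hrec.recog n T).1.tiles, ∑' c : copies P (R.decomp 0 n s.1.1), f (c + s.1.2) ≤
      ∑' v : copies P T.1.tiles, f v := by
  have hmem : ∀ (s : Fin (R.j n) × Space d) (c : Space d), c ∈ copies P (R.decomp 0 n s.1) →
      c + s.2 ∈ copies P (translate s.2 (R.decomp 0 n s.1)) := fun s c hc =>
    mem_copies_translate_decomp.2 (by simpa using hc)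
  rw [← ENNReal.tsum_sigma' (α := (hrec.recog n T).1.tiles)
    (β := fun s => copies P (R.decomp 0 n s.1.1)) fun p => f (p.2.1 + p.1.1.2)]
  refine ENNReal.tsum_comp_le_tsum_of_injective
    (f := fun p : (s : (hrec.recog n T).1.tiles) × copies P (R.decomp 0 n s.1.1) =>
      (⟨p.2.1 + p.1.1.2, hrec.copies_subset n p.1.2 P (hmem _ _ p.2.2)⟩ : copies P T.1.tiles))
    ?_ fun v => f v
  rintro ⟨⟨s, hs⟩, ⟨c, hc⟩⟩ ⟨⟨s', hs'⟩, ⟨c', hc'⟩⟩ he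
  have he' : c + s.2 = c' + s'.2 := congrArg Subtype.val he
  obtain ⟨t, ht⟩ := hP
  obtain rfl : s = s' := hrec.supertile_unique (Nat.zero_le n) hs hs' (hmem s c hc ⟨t, ht, rfl⟩)
    (he' ▸ hmem s' c' hc' ⟨t, ht, rfl⟩)
  obtain rfl : c = c' := add_right_cancel he'
  rfl

/-- A copy of a patch lies in a single `n`-supertile or meets the boundary of one: the supports of
patches are connected. -/
theorem IsRecognizable.mem_copies_or {P : Set (Fin (R.j 0) × Space d)} (hP : IsPatch (R.supp 0) P)
    (n : ℕ) {T : R.tilingSpace 0} {v : Space d} (hv : v ∈ copies P T.1.tiles) :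
    ∃ s ∈ (hrec.recog n T).1.tiles, v ∈ copies P (translate s.2 (R.decomp 0 n s.1)) ∨
      ((v +ᵥ cover (R.supp 0) P) ∩ frontier (tileSupp (R.supp n) s)).Nonempty := by
  have hPv := hP.translate v
  have hparent : ∀ t ∈ translate v P, ∃ s ∈ (hrec.recog n T).1.tiles,
      t ∈ translate s.2 (R.decomp 0 n s.1) := by
    intro t ht
    have h1 := hv ht
    rw [← hrec.recog_zero T] at h1
    exact (hrec.mem_recog_iff (Nat.zero_le n)).1 h1
  obtain ⟨x, hx⟩ := hPv.isConnected.nonempty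
  simp only [cover, mem_iUnion] at hx
  obtain ⟨t, ht, -⟩ := hx
  obtain ⟨s, hs, hts⟩ := hparent t ht
  refine ⟨s, hs, or_iff_not_imp_left.2 fun hn => ?_⟩
  obtain ⟨t', ht', hn'⟩ := not_subset.1 hn
  obtain ⟨s', hs', hts'⟩ := hparent t' ht'
  have hss : s' ≠ s := fun e => hn' (e ▸ hts')
  have hcov : ∀ u ∈ translate v P, tileSupp (R.supp 0) u ⊆ v +ᵥ cover (R.supp 0) P := by
    intro u hu
    rw [← cover_translate]
    exact subset_biUnion_of_mem (u := fun u => tileSupp (R.supp 0) u) hu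
  obtain ⟨y, hy⟩ := (R.isPrototile_tileSupp 0 t).interior_nonempty
  obtain ⟨z, hz⟩ := (R.isPrototile_tileSupp 0 t').interior_nonempty
  have hconn : IsPreconnected (v +ᵥ cover (R.supp 0) P) := by
    rw [← cover_translate]
    exact hPv.isConnected.isPreconnected
  refine inter_frontier_nonempty_of_isPreconnected hconn
    ⟨y, hcov t ht (interior_subset hy),
      tileSupp_subset_of_mem_decomp (Nat.zero_le n) hts (interior_subset hy)⟩
    ⟨z, hcov t' ht' (interior_subset hz), fun hzs => hss ?_⟩
  exact (hrec.recog n T).1.nonOverlapping.eq_of_mem_interior (R.isPrototile_supp n) hs' hs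
    (interior_mono (tileSupp_subset_of_mem_decomp (Nat.zero_le n) hts') hz) hzs

/-- Each patch has a frequency, and it is the limit of its frequencies inside supertiles. The
copies that lie in no single `n`-supertile have small density, as they meet a supertile boundary. -/
theorem IsRecognizable.exists_hasFreq (hvH : R.IsVanHove) (μ : R.InvariantMeasure)
    {P : Set (Fin (R.j 0) × Space d)} (hP : IsPatch (R.supp 0) P) :
    ∃ c : ℝ, R.HasFreq μ P c ∧
      Tendsto (fun n => ∑ i, (R.count P n i : ℝ) * (hrec.freq μ n i : ℝ)) atTop (𝓝 c) := by
  have hne : P.Nonempty := by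
    obtain ⟨x, hx⟩ := hP.isConnected.nonempty
    simp only [cover, mem_iUnion] at hx
    obtain ⟨t, ht, -⟩ := hx
    exact ⟨t, ht⟩
  have hpp := isPointProcess_copies hP.finite hne
  obtain ⟨c, hc⟩ := hpp.exists_intensity μ.1 μ.2.2
  refine ⟨c, ⟨c.coe_nonneg, fun U hU hsmall => ?_⟩, ?_⟩
  · have hind : Measurable ((-U).indicator (1 : Space d → ℝ≥0∞)) :=
      measurable_one.indicator hU.neg
    have h1 := hc _ hind
    rw [lintegral_indicator_one hU.neg, Measure.measure_neg] at h1
    rw [ENNReal.ofReal_coe_nnreal, ← h1]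
    have hcyl : ∀ T : R.tilingSpace 0, ∑' v : copies P T.1.tiles,
        (-U).indicator (1 : Space d → ℝ≥0∞) v = (R.cylinder P U).indicator 1 T := by
      intro T
      by_cases hT : T ∈ R.cylinder P U
      · obtain ⟨u, hu, huT⟩ := hT
        rw [indicator_of_mem (show T ∈ R.cylinder P U from ⟨u, hu, huT⟩),
          tsum_eq_single (⟨-u, huT⟩ : copies P T.1.tiles)]
        · rw [indicator_of_mem (by simpa using hu)]
          rfl
        · rintro ⟨v, hv⟩ hvu
          refine indicator_of_notMem (fun hvU => hvu (Subtype.ext ?_)) _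
          have := hsmall T.1 T.2 (x := -v) ⟨hvU, by
            show translate (- -v) P ⊆ _
            rwa [neg_neg]⟩ (y := u) ⟨hu, huT⟩
          exact neg_eq_iff_eq_neg.1 this
      · rw [indicator_of_notMem hT]
        refine ENNReal.tsum_eq_zero.2 fun v => indicator_of_notMem (fun hvU => hT ?_) _
        exact ⟨-v.1, hvU, by rw [neg_neg]; exact v.2⟩
    have hmeas : MeasurableSet (R.cylinder P U) := by
      have : R.cylinder P U = (fun T : R.tilingSpace 0 => ∑' v : copies P T.1.tiles,
          (-U).indicator (1 : Space d → ℝ≥0∞) v) ⁻¹' {0}ᶜ := by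
        ext T
        simp only [mem_preimage, hcyl, mem_compl_iff, mem_singleton_iff, indicator_apply_eq_zero]
        simp
      rw [this]
      exact (hpp.measurable_tsum hind) (measurableSet_singleton 0).compl
    simp only [hcyl]
    exact (lintegral_indicator_one hmeas).symm
  · obtain ⟨δ, hδ, hsep⟩ := hpp.separated
    set B : Set (Space d) := Metric.ball 0 (δ / 2) with hB
    have hBm : MeasurableSet B := Metric.isOpen_ball.measurableSet
    have hfm : Measurable (B.indicator (1 : Space d → ℝ≥0∞)) := measurable_one.indicator hBm
    have hB0 : volume B ≠ 0 := (Metric.measure_ball_pos _ _ (half_pos hδ)).ne'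
    have hBtop : volume B ≠ ∞ := measure_ball_lt_top.ne
    have hone : ∀ T : R.tilingSpace 0, ∑' v : copies P T.1.tiles,
        B.indicator (1 : Space d → ℝ≥0∞) v ≤ 1 := by
      intro T
      refine tsum_le_of_unique (fun _ => indicator_le_self' (fun _ _ => zero_le) _) ?_
      intro v w hv hw
      have hv' := Metric.mem_ball.1 (mem_of_indicator_ne_zero hv)
      have hw' := Metric.mem_ball'.1 (mem_of_indicator_ne_zero hw)
      by_contra hne
      have := hsep T v.2 w.2 fun e => hne (Subtype.ext e)
      linarith [dist_triangle v.1 0 w.1]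
    obtain ⟨ρ, hρ⟩ := (hP.isPrototile_cover R.isPrototile).isCompact.isBounded.exists_norm_le
    obtain ⟨x₀, hx₀⟩ := hP.isConnected.nonempty
    have hρ0 : 0 ≤ ρ := (norm_nonneg _).trans (hρ x₀ hx₀)
    set r := ρ + δ with hr
    have hr0 : 0 ≤ r := by positivity
    have hCm : ∀ n k, MeasurableSet (Metric.cthickening r (frontier (R.supp n k))) := fun n k =>
      Metric.isClosed_cthickening.measurableSet
    have hcount : ∀ n k, (R.count P n k : ℝ≥0∞) = ((copies P (R.decomp 0 n k)).ncard : ℝ≥0∞) :=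
      fun _ _ => rfl
    have hlow : ∀ n, ∑ k, (hrec.freq μ n k : ℝ≥0∞) * R.count P n k ≤ c := by
      intro n
      rw [← ENNReal.mul_le_mul_iff_left hB0 hBtop, ← lintegral_indicator_one hBm]
      rw [← hc _ hfm]
      simp only [hcount]
      rw [← hrec.lintegral_tsum_tsum μ n (fun l => finite_copies_decomp hne n l) hfm]
      exact lintegral_mono fun T => hrec.tsum_copies_decomp_le hne n T _
    have hup : ∀ n, (c : ℝ≥0∞) * volume B ≤
        (∑ k, (hrec.freq μ n k : ℝ≥0∞) * R.count P n k) * volume B +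
        ∑ k, (hrec.freq μ n k : ℝ≥0∞) *
          volume (Metric.cthickening r (frontier (R.supp n k))) := by
      intro n
      have hgm : ∀ k : Fin (R.j n), Measurable fun v : Space d =>
          (Metric.cthickening r (frontier (R.supp n k))).indicator (1 : Space d → ℝ≥0∞) (-v) :=
        fun k => (measurable_one.indicator (hCm n k)).comp measurable_neg
      have h1 := hc _ hfm
      have h2 := hrec.lintegral_tsum_tsum μ n (fun l => finite_copies_decomp hne n l) hfm
      have h3 := hrec.lintegral_tiles μ n (g := fun s =>
        (Metric.cthickening r (frontier (R.supp n s.1))).indicator (1 : Space d → ℝ≥0∞) (-s.2)) hgm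
      have h4 : ∀ k : Fin (R.j n), ∫⁻ v, (Metric.cthickening r (frontier (R.supp n k))).indicator
          (1 : Space d → ℝ≥0∞) (-v) = volume (Metric.cthickening r (frontier (R.supp n k))) := by
        intro k
        rw [lintegral_neg_eq_self (fun v => (Metric.cthickening r (frontier (R.supp n k))).indicator
          (1 : Space d → ℝ≥0∞) v), lintegral_indicator_one (hCm n k)]
      simp only [h4] at h3
      rw [lintegral_indicator_one hBm] at h1 h2
      simp only [hcount]
      rw [← h1, ← h2, ← h3, ← lintegral_add_right]
      · refine lintegral_mono fun T => ?_
        by_cases hex : ∃ v ∈ copies P T.1.tiles, v ∈ B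
        · refine (hone T).trans ?_
          obtain ⟨v, hv, hvB⟩ := hex
          obtain ⟨s, hs, h | ⟨q, hq, hqs⟩⟩ := hrec.mem_copies_or hP n hv
          · refine le_add_right (le_trans ?_ (ENNReal.le_tsum ⟨s, hs⟩))
            refine le_trans ?_ (ENNReal.le_tsum ⟨v - s.2, mem_copies_translate_decomp.1 h⟩)
            rw [sub_add_cancel, indicator_of_mem hvB]
            rfl
          · refine le_add_left (le_trans ?_ (ENNReal.le_tsum ⟨s, hs⟩))
            rw [indicator_of_mem]
            · rfl
            obtain ⟨p, hp, rfl⟩ := hq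
            have hfr : v + p - s.2 ∈ frontier (R.supp n s.1) := by
              have h5 : frontier (tileSupp (R.supp n) s) = s.2 +ᵥ frontier (R.supp n s.1) := by
                simp only [tileSupp, frontier, closure_vadd, interior_vadd, vadd_set_sdiff]
              rw [h5, mem_vadd_set_iff_neg_vadd_mem] at hqs
              rwa [sub_eq_neg_add]
            refine Metric.mem_cthickening_of_dist_le _ _ r _ hfr ?_
            rw [dist_eq_norm, ← norm_neg, show -(-s.2 - (v + p - s.2)) = v + p by abel]
            have h6 : ‖v‖ < δ / 2 := mem_ball_zero_iff.1 hvB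
            linarith [norm_add_le v p, hρ p hp]
        · push Not at hex
          refine le_trans (le_of_eq ?_) zero_le
          exact ENNReal.tsum_eq_zero.2 fun v => indicator_of_notMem (hex v.1 v.2) _
      · exact hrec.measurable_tsum_tiles n (g := fun s =>
          (Metric.cthickening r (frontier (R.supp n s.1))).indicator (1 : Space d → ℝ≥0∞) (-s.2))
          hgm
    have hreal : ∀ n, ENNReal.ofReal (∑ k, (R.count P n k : ℝ) * (hrec.freq μ n k : ℝ)) =
        ∑ k, (hrec.freq μ n k : ℝ≥0∞) * R.count P n k := by
      intro n
      rw [ENNReal.ofReal_sum_of_nonneg fun _ _ => by positivity]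
      refine Finset.sum_congr rfl fun k _ => ?_
      rw [ENNReal.ofReal_mul (by positivity), ENNReal.ofReal_natCast, ENNReal.ofReal_coe_nnreal,
        mul_comm]
    have hb : 0 < volume.real B := ENNReal.toReal_pos hB0 hBtop
    refine Metric.tendsto_atTop.2 fun η hη => ?_
    obtain ⟨n₀, hn₀⟩ := eventually_atTop.1
      (hvH.eventually_sum_le hr0 (show 0 < η / 2 * volume.real B by positivity))
    refine ⟨n₀, fun n hn => ?_⟩
    have h0 : 0 ≤ ∑ k, (R.count P n k : ℝ) * (hrec.freq μ n k : ℝ) :=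
      Finset.sum_nonneg fun _ _ => by positivity
    have h1 := hlow n
    have h2 := (hup n).trans (add_le_add_right (hn₀ n hn _ (hrec.sum_freq_mul_volume μ n)) _)
    rw [← hreal] at h1 h2
    rw [← ENNReal.ofReal_coe_nnreal] at h1 h2
    rw [ENNReal.ofReal_le_ofReal_iff c.coe_nonneg] at h1
    rw [← ofReal_measureReal hBtop, ← ENNReal.ofReal_mul c.coe_nonneg, ← ENNReal.ofReal_mul h0,
      ← ENNReal.ofReal_add (by positivity) (by positivity),
      ENNReal.ofReal_le_ofReal_iff (by positivity), ← add_mul] at h2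
    have h3 := le_of_mul_le_mul_right h2 hb
    rw [Real.dist_eq, abs_lt]
    constructor <;> linarith

end FusionRule

end FusionTiling

namespace FusionTiling

open scoped ENNReal NNReal

variable {d : ℕ}

namespace FusionRule

variable {R : FusionRule d} (hrec : R.IsRecognizable)

/-! ### Measures supported on the supertiles of a given level -/

/-- The law of the tiling seen from a random point: an `n`-supertile of type `k` is chosen with
density `w k`, then a uniformly distributed point `x` in it, and the tiling `A k`, whose
`n`-supertile of type `k` is at the origin, is translated by `-x`. -/
noncomputable def sampleMeasure (n : ℕ) (A : Fin (R.j n) → R.tilingSpace 0)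
    (w : Fin (R.j n) → ℝ≥0∞) : Measure (R.tilingSpace 0) :=
  ∑ k, w k • (volume.restrict (R.supp n k)).map fun x => R.translateTiling 0 (-x) (A k)

theorem continuous_translateTiling_neg (T : R.tilingSpace 0) :
    Continuous fun v => R.translateTiling 0 (-v) T :=
  (continuous_translateTiling_left T).comp continuous_neg

theorem lintegral_sampleMeasure {n : ℕ} (A : Fin (R.j n) → R.tilingSpace 0)
    (w : Fin (R.j n) → ℝ≥0∞) {F : R.tilingSpace 0 → ℝ≥0∞} (hF : Measurable F) :
    ∫⁻ T, F T ∂sampleMeasure n A w =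
      ∑ k, w k * ∫⁻ x in R.supp n k, F (R.translateTiling 0 (-x) (A k)) := by
  rw [sampleMeasure, lintegral_finsetSum_measure]
  refine Finset.sum_congr rfl fun k _ => ?_
  rw [lintegral_smul_measure, lintegral_map hF (continuous_translateTiling_neg _).measurable]
  rfl

theorem isProbabilityMeasure_sampleMeasure {n : ℕ} (A : Fin (R.j n) → R.tilingSpace 0)
    {w : Fin (R.j n) → ℝ≥0∞} (hw : ∑ k, w k * volume (R.supp n k) = 1) :
    IsProbabilityMeasure (sampleMeasure n A w) := by
  refine ⟨?_⟩
  have := lintegral_sampleMeasure A w (F := fun _ => 1) measurable_const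
  rw [lintegral_one] at this
  rw [this]
  simpa using hw

theorem integral_le_of_lintegral_le {Ω : Type*} [MeasurableSpace Ω] {ν ν' : Measure Ω}
    [IsProbabilityMeasure ν] [IsProbabilityMeasure ν'] {f : Ω → ℝ} (hf : Measurable f) {C b : ℝ}
    (hC : ∀ x, |f x| ≤ C) (hb : 0 ≤ b)
    (h : ∫⁻ x, ENNReal.ofReal (f x + C) ∂ν ≤ ∫⁻ x, ENNReal.ofReal (f x + C) ∂ν' +
      ENNReal.ofReal b) : ∫ x, f x ∂ν ≤ ∫ x, f x ∂ν' + b := by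
  have hint : ∀ (κ : Measure Ω) [IsProbabilityMeasure κ], Integrable f κ := fun κ _ =>
    Integrable.of_bound hf.aestronglyMeasurable C (Eventually.of_forall hC)
  have hnn : ∀ x, 0 ≤ f x + C := fun x => by linarith [neg_abs_le (f x), hC x]
  have hint' : ∀ (κ : Measure Ω) [IsProbabilityMeasure κ], Integrable (fun x => f x + C) κ :=
    fun κ _ => (hint κ).add (integrable_const C)
  have heq : ∀ (κ : Measure Ω) [IsProbabilityMeasure κ],
      ∫⁻ x, ENNReal.ofReal (f x + C) ∂κ = ENNReal.ofReal (∫ x, f x ∂κ + C) := fun κ _ => by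
    rw [← ofReal_integral_eq_lintegral_ofReal (hint' κ)
      (Eventually.of_forall hnn), integral_add (hint κ) (integrable_const C)]
    simp
  have hnn' : ∀ (κ : Measure Ω) [IsProbabilityMeasure κ], 0 ≤ ∫ x, f x ∂κ + C := fun κ _ => by
    have h1 := integral_nonneg (μ := κ) (show 0 ≤ fun x => f x + C from hnn)
    rw [integral_add (hint κ) (integrable_const C)] at h1
    simpa using h1
  rw [heq ν, heq ν', ← ENNReal.ofReal_add (hnn' ν') hb,
    ENNReal.ofReal_le_ofReal_iff (add_nonneg (hnn' ν') hb)] at h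
  linarith

/-- The tiling seen from a point deep inside an `n`-supertile is determined by this supertile up to
distant tiles, so the mean of a local function is nearly that of the sample measure. -/
theorem IsRecognizable.lintegral_le_sampleMeasure (μ : R.InvariantMeasure) {n : ℕ}
    {A : Fin (R.j n) → R.tilingSpace 0} (hA : ∀ k, (k, 0) ∈ (hrec.recog n (A k)).1.tiles)
    {F : R.tilingSpace 0 → ℝ≥0∞} (hF : Measurable F) {C η : ℝ≥0∞} (hC : ∀ T, F T ≤ C) {r : ℝ}
    (hr : ∀ T T' : R.tilingSpace 0, Tiling.AgreeOn (Metric.closedBall 0 r) T.1 T'.1 →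
      F T ≤ F T' + η) :
    ∫⁻ T, F T ∂μ.1 ≤ ∫⁻ T, F T ∂sampleMeasure n A (fun k => hrec.freq μ n k) + (η +
      C * ∑ k, (hrec.freq μ n k : ℝ≥0∞) *
        volume (Metric.cthickening r (frontier (R.supp n k)))) := by
  set g : Fin (R.j n) × Space d → ℝ≥0∞ := fun s =>
    (R.supp n s.1).indicator (fun x => F (R.translateTiling 0 (-x) (A s.1)) + η) (-s.2) +
      (Metric.cthickening r (frontier (R.supp n s.1))).indicator (fun _ => C) (-s.2) with hg
  have hSm : ∀ k, MeasurableSet (R.supp n k) := fun k =>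
    (R.isPrototile_supp n k).isClosed.measurableSet
  have hCm : ∀ k, MeasurableSet (Metric.cthickening r (frontier (R.supp n k))) := fun k =>
    Metric.isClosed_cthickening.measurableSet
  have hm1 : ∀ k, Measurable fun x => F (R.translateTiling 0 (-x) (A k)) := fun k =>
    hF.comp (continuous_translateTiling_neg _).measurable
  have hm2 : ∀ k, Measurable ((R.supp n k).indicator
      (fun x => F (R.translateTiling 0 (-x) (A k)) + η)) := fun k =>
    ((hm1 k).add_const η).indicator (hSm k)
  have hm3 : ∀ k, Measurable ((Metric.cthickening r (frontier (R.supp n k))).indicator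
      (fun _ : Space d => C)) := fun k => measurable_const.indicator (hCm k)
  have hgm : ∀ k, Measurable fun v => g (k, v) := fun k =>
    ((hm2 k).comp measurable_neg).add ((hm3 k).comp measurable_neg)
  have hgi : ∀ k, ∫⁻ v, g (k, v) = (∫⁻ x in R.supp n k, F (R.translateTiling 0 (-x) (A k))) +
      (η * volume (R.supp n k) +
        C * volume (Metric.cthickening r (frontier (R.supp n k)))) := by
    intro k
    have h1 := lintegral_neg_eq_self (μ := (volume : Measure (Space d))) fun x =>
      (R.supp n k).indicator (fun x => F (R.translateTiling 0 (-x) (A k)) + η) x +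
      (Metric.cthickening r (frontier (R.supp n k))).indicator (fun _ => C) x
    refine h1.trans ?_
    rw [lintegral_add_left (hm2 k), lintegral_indicator (hSm k), lintegral_indicator_const (hCm k),
      lintegral_add_right _ measurable_const, lintegral_const, Measure.restrict_apply_univ,
      add_assoc]
  have hle : ∀ T, F T ≤ ∑' s : (hrec.recog n T).1.tiles, g s := by
    intro T
    have h0 : (0 : Space d) ∈ cover (R.supp n) (hrec.recog n T).1.tiles := by
      rw [(hrec.recog n T).1.cover_eq]; trivial
    simp only [cover, mem_iUnion] at h0
    obtain ⟨s, hs, h0⟩ := h0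
    rw [tileSupp, mem_vadd_set_iff_neg_vadd_mem, vadd_eq_add, add_zero] at h0
    refine le_trans ?_ (ENNReal.le_tsum ⟨s, hs⟩)
    by_cases hb : -s.2 ∈ Metric.cthickening r (frontier (R.supp n s.1))
    · refine le_add_left ?_
      rw [indicator_of_mem hb]
      exact hC T
    · refine le_add_right ?_
      rw [indicator_of_mem h0, neg_neg]
      refine hr _ _ (hrec.agreeOn hs (hrec.mem_recog_translate.2 (by simpa using hA s.1)) ?_)
      have h1 := closedBall_subset_interior_of_notMem_cthickening h0 hb
      intro y hy
      rw [tileSupp, interior_vadd, mem_vadd_set_iff_neg_vadd_mem]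
      refine h1 ?_
      rw [Metric.mem_closedBall, dist_eq_norm, vadd_eq_add, add_sub_cancel_left]
      exact mem_closedBall_zero_iff.1 hy
  refine (lintegral_mono hle).trans (le_of_eq ?_)
  rw [hrec.lintegral_tiles μ n hgm, lintegral_sampleMeasure A _ hF]
  simp only [hgi, mul_add, Finset.sum_add_distrib]
  congr 2
  · calc ∑ k, (hrec.freq μ n k : ℝ≥0∞) * (η * volume (R.supp n k))
        = η * ∑ k, (hrec.freq μ n k : ℝ≥0∞) * volume (R.supp n k) := by
          rw [Finset.mul_sum]
          exact Finset.sum_congr rfl fun k _ => mul_left_comm _ _ _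
      _ = η := by rw [hrec.sum_freq_mul_volume, mul_one]
  · rw [Finset.mul_sum]
    exact Finset.sum_congr rfl fun k _ => mul_left_comm _ _ _

/-- Continuous functions on a compact space of tilings are uniformly local. -/
theorem exists_local [CompactSpace (R.tilingSpace 0)] {f : R.tilingSpace 0 → ℝ}
    (hf : Continuous f) {η : ℝ} (hη : 0 < η) :
    ∃ r > 0, ∀ T T' : R.tilingSpace 0, Tiling.AgreeOn (Metric.closedBall 0 r) T.1 T'.1 →
      |f T - f T'| < η := by
  have hu := CompactSpace.uniformContinuous_of_continuous hf
  have h1 := hu (Metric.dist_mem_uniformity hη)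
  rw [Filter.mem_map, uniformity_subtype, Filter.mem_comap] at h1
  obtain ⟨S, hS, h1⟩ := h1
  obtain ⟨ε, hε, hεS⟩ := Tiling.uniformity_basis.mem_iff.1 hS
  refine ⟨1 / ε, by positivity, fun T T' h => ?_⟩
  have h2 : Tiling.Close ε T.1 T'.1 := ⟨0, 0, by simpa using hε.le, by simpa using hε.le, by
    simpa only [Tiling.translate_zero] using h⟩
  exact h1 (show (T, T') ∈ _ from hεS h2)

theorem IsRecognizable.eventually_integral_le [CompactSpace (R.tilingSpace 0)]
    (hvH : R.IsVanHove) (μ : R.InvariantMeasure) {f : R.tilingSpace 0 → ℝ} (hf : Continuous f)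
    {η : ℝ} (hη : 0 < η) :
    ∀ᶠ n in atTop, ∀ A : Fin (R.j n) → R.tilingSpace 0,
      (∀ k, (k, 0) ∈ (hrec.recog n (A k)).1.tiles) →
      ∫ T, f T ∂μ.1 ≤ ∫ T, f T ∂sampleMeasure n A (fun k => hrec.freq μ n k) + η := by
  obtain ⟨C, hC⟩ := isCompact_univ.exists_bound_of_continuousOn hf.continuousOn
  have hC' : ∀ T, |f T| ≤ |C| + 1 := fun T =>
    (hC T (mem_univ T)).trans ((le_abs_self C).trans (by linarith))
  have hC0 : 0 < 2 * (|C| + 1) := by positivity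
  obtain ⟨r, hr, hloc⟩ := exists_local hf (half_pos hη)
  filter_upwards [hvH.eventually_sum_le hr.le
    (show 0 < η / 2 / (2 * (|C| + 1)) by positivity)] with n hn A hA
  have := isProbabilityMeasure_sampleMeasure A (hrec.sum_freq_mul_volume μ n)
  refine integral_le_of_lintegral_le hf.measurable hC' hη.le ?_
  refine (hrec.lintegral_le_sampleMeasure μ hA (C := ENNReal.ofReal (2 * (|C| + 1)))
    (η := ENNReal.ofReal (η / 2)) (r := r) (by fun_prop) (fun T => ?_) (fun T T' hTT' => ?_)).trans
    (add_le_add_right ?_ _)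
  · exact ENNReal.ofReal_le_ofReal (by linarith [le_abs_self (f T), hC' T])
  · have h1 := hloc T T' hTT'
    have h2 : 0 ≤ f T' + (|C| + 1) := by linarith [neg_abs_le (f T'), hC' T']
    rw [← ENNReal.ofReal_add h2 (by positivity)]
    exact ENNReal.ofReal_le_ofReal (by linarith [le_abs_self (f T - f T')])
  · calc ENNReal.ofReal (η / 2) + ENNReal.ofReal (2 * (|C| + 1)) *
          ∑ k, (hrec.freq μ n k : ℝ≥0∞) * volume (Metric.cthickening r (frontier (R.supp n k)))
        ≤ ENNReal.ofReal (η / 2) + ENNReal.ofReal (2 * (|C| + 1)) *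
          ENNReal.ofReal (η / 2 / (2 * (|C| + 1))) := by
          gcongr
          exact hn _ (hrec.sum_freq_mul_volume μ n)
      _ = ENNReal.ofReal η := by
          rw [← ENNReal.ofReal_mul hC0.le, mul_div_cancel₀ _ hC0.ne',
            ← ENNReal.ofReal_add (by positivity) (by positivity), add_halves]

/-- An invariant measure is determined by its supertile frequencies. -/
theorem IsRecognizable.eq_of_freq_eq [CompactSpace (R.tilingSpace 0)] (hprim : R.IsPrimitive)
    (hne : (R.tilingSpace 0).Nonempty) (hvH : R.IsVanHove) {μ ν : R.InvariantMeasure}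
    (h : ∀ n k, hrec.freq μ n k = hrec.freq ν n k) : μ = ν := by
  have key : ∀ (μ ν : R.InvariantMeasure), (∀ n k, hrec.freq μ n k = hrec.freq ν n k) →
      ∀ f : R.tilingSpace 0 → ℝ, Continuous f → ∫ T, f T ∂μ.1 ≤ ∫ T, f T ∂ν.1 := by
    intro μ ν h f hf
    refine le_of_forall_pos_le_add fun η hη => ?_
    obtain ⟨n, h1, h2⟩ := ((hrec.eventually_integral_le hvH μ hf (half_pos hη)).and
      (hrec.eventually_integral_le hvH ν hf.neg (half_pos hη))).exists
    choose A hA using hrec.exists_tiling hprim hne n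
    have h3 := h1 A hA
    have h4 := h2 A hA
    simp only [h, Pi.neg_apply, integral_neg] at h3 h4
    linarith
  have heq : μ.1 = ν.1 := by
    refine ext_of_forall_integral_eq_of_IsFiniteMeasure fun f => ?_
    exact le_antisymm (key μ ν h f f.continuous)
      (key ν μ (fun n k => (h n k).symm) f f.continuous)
  exact Subtype.ext heq

end FusionRule

end FusionTiling

namespace FusionTiling

open scoped ENNReal NNReal

variable {d : ℕ}

namespace FusionRule

variable {R : FusionRule d} (hrec : R.IsRecognizable)

/-! ### Existence of an invariant measure with given frequencies -/

/-- Translation changes a sample measure only through points near the boundaries of supertiles. -/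
theorem lintegral_translate_sampleMeasure_le {n : ℕ} (A : Fin (R.j n) → R.tilingSpace 0)
    (w : Fin (R.j n) → ℝ≥0∞) (v : Space d) {F : R.tilingSpace 0 → ℝ≥0∞} (hF : Measurable F)
    {C : ℝ≥0∞} (hC : ∀ T, F T ≤ C) :
    ∫⁻ T, F (R.translateTiling 0 v T) ∂sampleMeasure n A w ≤ ∫⁻ T, F T ∂sampleMeasure n A w +
      C * ∑ k, w k * volume (Metric.cthickening ‖v‖ (frontier (R.supp n k))) := by
  rw [lintegral_sampleMeasure A w hF,
    lintegral_sampleMeasure A w (F := fun T => F (R.translateTiling 0 v T))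
      (hF.comp (continuous_translateTiling v).measurable),
    Finset.mul_sum, ← Finset.sum_add_distrib]
  refine Finset.sum_le_sum fun k _ => ?_
  rw [mul_left_comm, ← mul_add]
  gcongr
  have hSm : MeasurableSet (R.supp n k) := (R.isPrototile_supp n k).isClosed.measurableSet
  have hCm : MeasurableSet (Metric.cthickening ‖v‖ (frontier (R.supp n k))) :=
    Metric.isClosed_cthickening.measurableSet
  have hm : Measurable fun x => F (R.translateTiling 0 (-x) (A k)) :=
    hF.comp (continuous_translateTiling_neg _).measurable
  rw [← lintegral_indicator hSm, ← lintegral_indicator hSm, ← lintegral_indicator_const hCm,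
    ← lintegral_add_right _ (measurable_const.indicator hCm),
    ← lintegral_add_right_eq_self (μ := (volume : Measure (Space d))) _ v]
  refine lintegral_mono fun y => ?_
  dsimp only
  by_cases hy : y + v ∈ R.supp n k
  · rw [indicator_of_mem hy]
    have htr : R.translateTiling 0 v (R.translateTiling 0 (-(y + v)) (A k)) =
        R.translateTiling 0 (-y) (A k) := by
      refine Subtype.ext ((Tiling.translate_translate _ _ _).trans ?_)
      rw [neg_add, neg_add_cancel_right]
      rfl
    rw [htr]
    by_cases hyS : y ∈ R.supp n k
    · rw [indicator_of_mem hyS]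
      exact le_self_add
    · rw [indicator_of_notMem hyS, zero_add,
        indicator_of_mem (mem_cthickening_frontier hy hyS (by simp [dist_eq_norm])).2]
      exact hC _
  · rw [indicator_of_notMem hy]
    exact zero_le

/-- A bump function near the origin. -/
noncomputable def bump (δ : ℝ) (v : Space d) : ℝ≥0∞ :=
  ENNReal.ofReal (δ - ‖v‖)

theorem continuous_bump (δ : ℝ) : Continuous (bump (d := d) δ) := by
  exact ENNReal.continuous_ofReal.comp (continuous_const.sub continuous_norm)

theorem norm_lt_of_bump_ne_zero {δ : ℝ} {v : Space d} (h : bump δ v ≠ 0) : ‖v‖ < δ := by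
  by_contra! hle
  exact h (ENNReal.ofReal_of_nonpos (by linarith))

theorem bump_le_one {δ : ℝ} (hδ : δ ≤ 1) (v : Space d) : bump δ v ≤ 1 := by
  rw [bump, ← ENNReal.ofReal_one]
  exact ENNReal.ofReal_le_ofReal (by linarith [norm_nonneg v])

theorem bump_le_add (δ : ℝ) (v w : Space d) :
    bump δ v ≤ bump δ (v + w) + ENNReal.ofReal ‖w‖ := by
  unfold bump
  refine le_trans (ENNReal.ofReal_le_ofReal ?_) ENNReal.ofReal_add_le
  linarith [norm_add_le v w]

theorem lintegral_bump_ne_zero {δ : ℝ} (hδ : 0 < δ) : ∫⁻ v : Space d, bump δ v ≠ 0 := by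
  refine ((lintegral_pos_iff_support (continuous_bump δ).measurable).2 ?_).ne'
  refine ((Metric.measure_ball_pos volume (0 : Space d) hδ)).trans_le (measure_mono fun v hv => ?_)
  have hv' := mem_ball_zero_iff.1 hv
  exact (ENNReal.ofReal_pos.2 (by linarith)).ne'

theorem lintegral_bump_ne_top {δ : ℝ} (hδ : δ ≤ 1) : ∫⁻ v : Space d, bump δ v ≠ ∞ := by
  refine ne_top_of_le_ne_top (measure_ball_lt_top (μ := volume) (x := (0 : Space d)) (r := δ)).ne ?_
  rw [← lintegral_indicator_one Metric.isOpen_ball.measurableSet]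
  refine lintegral_mono fun v => ?_
  by_cases hv : bump δ v = 0
  · rw [hv]
    exact zero_le
  · rw [indicator_of_mem (mem_ball_zero_iff.2 (norm_lt_of_bump_ne_zero hv))]
    exact bump_le_one hδ v

/-- A bound `δ` such that each ball of radius `δ` contains at most one `n`-supertile position of a
given type. -/
def IsSeparating (n : ℕ) (δ : ℝ) : Prop :=
  0 < δ ∧ δ ≤ 1 ∧ ∀ (T : R.tilingSpace 0) (k : Fin (R.j n)) (x : Space d),
    ∀ v ∈ hrec.positions n k T, ∀ w ∈ hrec.positions n k T, ‖v - x‖ < δ → ‖w - x‖ < δ → v = w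

theorem IsRecognizable.exists_isSeparating (n : ℕ) : ∃ δ, IsSeparating hrec n δ := by
  obtain ⟨δ, hδ, hs⟩ := exists_separation (R.isPrototile_supp n)
  refine ⟨min (δ / 2) 1, by positivity, min_le_right _ _, fun T k x v hv w hw hvx hwx => ?_⟩
  refine hs _ (hrec.recog n T).1.nonOverlapping k v w hv hw ?_
  have h1 := hvx.trans_le (min_le_left _ _)
  have h2 := hwx.trans_le (min_le_left _ _)
  rw [dist_eq_norm, show v - w = (v - x) - (w - x) by abel]
  linarith [norm_sub_le (v - x) (w - x)]

/-- The smoothed indicator of the event that an `n`-supertile of type `k` lies near the origin. -/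
noncomputable def IsRecognizable.nearOrigin (n : ℕ) (k : Fin (R.j n)) (δ : ℝ)
    (T : R.tilingSpace 0) : ℝ≥0∞ :=
  ∑' v : hrec.positions n k T, bump δ v.1

theorem IsRecognizable.nearOrigin_le_one {n : ℕ} {δ : ℝ} (hδ : IsSeparating hrec n δ)
    (k : Fin (R.j n)) (T : R.tilingSpace 0) : hrec.nearOrigin n k δ T ≤ 1 := by
  refine tsum_le_of_unique (fun v => bump_le_one hδ.2.1 _) fun v w hv hw => Subtype.ext ?_
  exact hδ.2.2 T k 0 v v.2 w w.2 (by simpa using norm_lt_of_bump_ne_zero hv)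
    (by simpa using norm_lt_of_bump_ne_zero hw)

theorem IsRecognizable.continuous_nearOrigin {n : ℕ} {δ : ℝ} (hδ : IsSeparating hrec n δ)
    (k : Fin (R.j n)) : Continuous fun T => (hrec.nearOrigin n k δ T).toReal := by
  refine continuous_iff_continuousAt.2 fun T => Metric.tendsto_nhds.2 fun η hη => ?_
  obtain ⟨ε, hε, h⟩ := eventually_exists_shift_copies (R.supp_nonempty n)
    (finite_singleton (k, (0 : Space d))) δ (half_pos hη)
  have hle : ∀ T T' : R.tilingSpace 0, Tiling.Close ε (hrec.recog n T).1 (hrec.recog n T').1 →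
      (hrec.nearOrigin n k δ T).toReal ≤ (hrec.nearOrigin n k δ T').toReal + η / 2 := by
    intro T T' hTT'
    have h1 : hrec.nearOrigin n k δ T ≤ hrec.nearOrigin n k δ T' + ENNReal.ofReal (η / 2) := by
      refine tsum_le_of_unique (fun v => ?_) fun v w hv hw => Subtype.ext ?_
      · by_cases hv : bump δ v.1 = 0
        · rw [hv]
          exact zero_le
        · obtain ⟨w, hw, hvw⟩ := h _ _ hTT' v.1 (by
            rw [← hrec.positions_eq_copies]; exact v.2) (norm_lt_of_bump_ne_zero hv).le
          rw [← hrec.positions_eq_copies] at hvw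
          exact (bump_le_add δ v.1 w).trans (add_le_add
            (ENNReal.le_tsum (f := fun v : hrec.positions n k T' => bump δ v.1) ⟨_, hvw⟩)
            (ENNReal.ofReal_le_ofReal hw.le))
      · exact hδ.2.2 T k 0 v v.2 w w.2 (by simpa using norm_lt_of_bump_ne_zero hv)
          (by simpa using norm_lt_of_bump_ne_zero hw)
    have h2 : hrec.nearOrigin n k δ T' ≠ ∞ :=
      ne_top_of_le_ne_top ENNReal.one_ne_top (hrec.nearOrigin_le_one hδ k T')
    have h3 := ENNReal.toReal_mono (ENNReal.add_ne_top.2 ⟨h2, ENNReal.ofReal_ne_top⟩) h1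
    rwa [ENNReal.toReal_add h2 ENNReal.ofReal_ne_top,
      ENNReal.toReal_ofReal (by positivity)] at h3
  have hev : ∀ᶠ T' in 𝓝 T, Tiling.Close ε (hrec.recog n T).1 (hrec.recog n T').1 :=
    (continuous_subtype_val.comp (hrec.recog n).continuous).continuousAt.eventually
      ((Tiling.nhds_basis _).mem_of_mem hε)
  filter_upwards [hev] with T' hT'
  rw [Real.dist_eq, abs_lt]
  constructor <;> linarith [hle T T' hT', hle T' T hT'.symm]

/-- Inside an `N`-supertile the `n`-supertiles of the sampled tiling are those of the decomposition,
so their mean number is given by the transition matrix up to boundary effects. -/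
theorem IsRecognizable.lintegral_nearOrigin {n N : ℕ} (hnN : n ≤ N) {δ : ℝ}
    (hδ : IsSeparating hrec n δ) (k : Fin (R.j n)) {r : ℝ}
    (hr : ∀ s ∈ R.supp n k, δ + ‖s‖ ≤ r) {K : Fin (R.j N)} {T : R.tilingSpace 0}
    (hT : (K, 0) ∈ (hrec.recog N T).1.tiles) :
    (∫⁻ x in R.supp N K, hrec.nearOrigin n k δ (R.translateTiling 0 (-x) T) ≤
      ({v | (k, v) ∈ R.decomp n N K}.ncard : ℝ≥0∞) * (∫⁻ v : Space d, bump δ v) +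
        volume (Metric.cthickening r (frontier (R.supp N K)))) ∧
    ({v | (k, v) ∈ R.decomp n N K}.ncard : ℝ≥0∞) * (∫⁻ v : Space d, bump δ v) ≤
      (∫⁻ x in R.supp N K, hrec.nearOrigin n k δ (R.translateTiling 0 (-x) T)) +
        volume (Metric.cthickening r (frontier (R.supp N K))) := by
  set L := hrec.positions n k T with hL
  set V := {v | (k, v) ∈ R.decomp n N K} with hV
  have hVfin : V.Finite := finite_setOf_mem_decomp hnN k K
  have hVL : V ⊆ L := fun v hv => (hrec.mem_recog_iff hnN).2 ⟨(K, 0), hT, (k, v), hv, by simp⟩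
  have hSm : MeasurableSet (R.supp N K) := (R.isPrototile_supp N K).isClosed.measurableSet
  have hCm : MeasurableSet (Metric.cthickening r (frontier (R.supp N K))) :=
    Metric.isClosed_cthickening.measurableSet
  have hnear : ∀ x, hrec.nearOrigin n k δ (R.translateTiling 0 (-x) T) =
      ∑' v : L, bump δ (v.1 - x) := by
    intro x
    have h1 : hrec.positions n k (R.translateTiling 0 (-x) T) = -x +ᵥ L :=
      (hrec.isPointProcess_positions n k).equivariant (-x) T
    rw [nearOrigin, h1]
    have h2 := (Equiv.Set.image (fun v => -x +ᵥ v) L (add_right_injective (-x))).tsum_eq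
      fun v : (-x +ᵥ L : Set (Space d)) => bump δ v.1
    refine h2.symm.trans (tsum_congr fun v => ?_)
    rw [sub_eq_neg_add]
    rfl
  have huniq : ∀ x, ∀ v ∈ L, ∀ w ∈ L, bump δ (v - x) ≠ 0 → bump δ (w - x) ≠ 0 → v = w :=
    fun x v hv w hw h1 h2 => hδ.2.2 T k x v hv w hw (norm_lt_of_bump_ne_zero h1)
      (norm_lt_of_bump_ne_zero h2)
  have hone : ∀ x, ∑' v : L, bump δ (v.1 - x) ≤ 1 := fun x =>
    tsum_le_of_unique (fun v => bump_le_one hδ.2.1 _) fun v w hv hw =>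
      Subtype.ext (huniq x v v.2 w w.2 hv hw)
  have hVle : ∀ x, ∑' v : V, bump δ (v.1 - x) ≤ ∑' v : L, bump δ (v.1 - x) := fun x =>
    ENNReal.tsum_comp_le_tsum_of_injective (inclusion_injective hVL)
      fun v : L => bump δ (v.1 - x)
  have hpt : ∀ (v x : Space d), bump δ (v - x) ≠ 0 →
      ∃ y ∈ tileSupp (R.supp n) (k, v), dist y x ≤ r := by
    intro v x hvx
    obtain ⟨s, hs⟩ := R.supp_nonempty n k
    refine ⟨v + s, ⟨s, hs, rfl⟩, ?_⟩
    rw [dist_eq_norm, show v + s - x = (v - x) + s by abel]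
    linarith [norm_add_le (v - x) s, norm_lt_of_bump_ne_zero hvx, hr s hs]
  have hK0 : tileSupp (R.supp N) (K, 0) = R.supp N K := zero_vadd _ _
  have hmem0 : ∀ t : Fin (R.j n) × Space d,
      t ∈ translate ((K, (0 : Space d)) : Fin (R.j N) × Space d).2 (R.decomp n N K) →
      t ∈ R.decomp n N K := fun t ht => by rwa [translate_zero] at ht
  have hup : ∀ x, (R.supp N K).indicator (fun x => ∑' v : L, bump δ (v.1 - x)) x ≤
      ∑' v : V, bump δ (v.1 - x) +
        (Metric.cthickening r (frontier (R.supp N K))).indicator (fun _ => 1) x := by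
    intro x
    by_cases hxS : x ∈ R.supp N K
    · rw [indicator_of_mem hxS]
      by_cases hxC : x ∈ Metric.cthickening r (frontier (R.supp N K))
      · rw [indicator_of_mem hxC]
        exact le_add_left (hone x)
      · refine le_add_right ?_
        rw [tsum_subtype L fun v => bump δ (v - x), tsum_subtype V fun v => bump δ (v - x)]
        refine ENNReal.tsum_le_tsum fun v => ?_
        by_cases hv : v ∈ L ∧ bump δ (v - x) ≠ 0
        · obtain ⟨y, hy, hyx⟩ := hpt v x hv.2
          have hyi := closedBall_subset_interior_of_notMem_cthickening hxS hxC
            (Metric.mem_closedBall.2 hyx)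
          have hvV : v ∈ V := hmem0 _ (hrec.mem_decomp_of_mem_interior hnN hv.1 hT hy
            (by rwa [hK0]))
          rw [indicator_of_mem hv.1, indicator_of_mem hvV]
        · refine le_trans (le_of_eq ?_) zero_le
          rw [indicator_apply_eq_zero]
          intro hvL
          by_contra hne
          exact hv ⟨hvL, hne⟩
    · rw [indicator_of_notMem hxS]
      exact zero_le
  have hlow : ∀ x, ∑' v : V, bump δ (v.1 - x) ≤
      (R.supp N K).indicator (fun x => ∑' v : L, bump δ (v.1 - x)) x +
        (Metric.cthickening r (frontier (R.supp N K))).indicator (fun _ => 1) x := by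
    intro x
    by_cases hxS : x ∈ R.supp N K
    · rw [indicator_of_mem hxS]
      exact le_add_right (hVle x)
    · by_cases hv : ∃ v : V, bump δ (v.1 - x) ≠ 0
      · obtain ⟨v, hv⟩ := hv
        obtain ⟨y, hy, hyx⟩ := hpt v x hv
        have hyS : y ∈ R.supp N K := by
          rw [← hK0]
          exact tileSupp_subset_of_mem_decomp hnN (s := (K, 0)) (t := (k, v.1))
            ⟨(k, v.1), v.2, by simp⟩ hy
        rw [indicator_of_mem (mem_cthickening_frontier hyS hxS hyx).2]
        exact le_add_left ((hVle x).trans (hone x))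
      · push Not at hv
        rw [ENNReal.tsum_eq_zero.2 hv]
        exact zero_le
  have hVm : ∀ v : V, Measurable fun x => bump δ (v.1 - x) := fun v =>
    (continuous_bump δ).measurable.comp (measurable_const_sub _)
  have hVint : ∫⁻ x, ∑' v : V, bump δ (v.1 - x) =
      (V.ncard : ℝ≥0∞) * ∫⁻ v : Space d, bump δ v := by
    have := hVfin.countable.to_subtype
    rw [lintegral_tsum fun v => (hVm v).aemeasurable]
    simp only [lintegral_sub_left_eq_self (bump (d := d) δ)]
    rw [ENNReal.tsum_const]
    congr 1
    have h1 : ENat.card V = (V.ncard : ℕ∞) := by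
      rw [hVfin.cast_ncard_eq]; rfl
    rw [h1]
    rfl
  have hCind : Measurable ((Metric.cthickening r (frontier (R.supp N K))).indicator
      (fun _ : Space d => (1 : ℝ≥0∞))) := measurable_const.indicator hCm
  simp only [hnear]
  rw [← hVint, ← lintegral_indicator hSm]
  conv =>
    congr
    · rw [← one_mul (volume _), ← lintegral_indicator_const hCm,
        ← lintegral_add_right _ hCind]
    · rw [← one_mul (volume _), ← lintegral_indicator_const hCm,
        ← lintegral_add_right _ hCind]
  exact ⟨lintegral_mono hup, lintegral_mono hlow⟩

end FusionRule

end FusionTiling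

namespace FusionTiling

open scoped ENNReal NNReal

variable {d : ℕ}

namespace FusionRule

variable {R : FusionRule d}

theorem tendsto_integral_of_tendsto [CompactSpace (R.tilingSpace 0)] {ℱ : Filter ℕ}
    {ν : ℕ → ProbabilityMeasure (R.tilingSpace 0)} {μ : ProbabilityMeasure (R.tilingSpace 0)}
    (h : Tendsto ν ℱ (𝓝 μ)) {f : R.tilingSpace 0 → ℝ} (hf : Continuous f) :
    Tendsto (fun n => ∫ T, f T ∂(ν n : Measure (R.tilingSpace 0))) ℱ
      (𝓝 (∫ T, f T ∂(μ : Measure (R.tilingSpace 0)))) :=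
  ProbabilityMeasure.tendsto_iff_forall_integral_tendsto.1 h
    (BoundedContinuousFunction.mkOfCompact ⟨f, hf⟩)

/-- Limits of sample measures are translation invariant, by the van Hove property. -/
theorem IsVanHove.measurePreserving_of_tendsto [CompactSpace (R.tilingSpace 0)]
    (hvH : R.IsVanHove) {ℱ : Filter ℕ} [ℱ.NeBot] (hℱ : ℱ ≤ atTop)
    {ν : ℕ → ProbabilityMeasure (R.tilingSpace 0)} {μ : ProbabilityMeasure (R.tilingSpace 0)}
    (h : Tendsto ν ℱ (𝓝 μ)) {A : ∀ n, Fin (R.j n) → R.tilingSpace 0}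
    {w : ∀ n, Fin (R.j n) → ℝ≥0∞} (hw : ∀ n, ∑ k, w n k * volume (R.supp n k) = 1)
    (hν : ∀ n, (ν n : Measure (R.tilingSpace 0)) = sampleMeasure n (A n) (w n)) (v : Space d) :
    MeasurePreserving (R.translateTiling 0 v) (μ : Measure (R.tilingSpace 0)) μ := by
  have hτ := continuous_translateTiling (R := R) v
  have key : ∀ f : R.tilingSpace 0 → ℝ, Continuous f →
      ∫ T, f (R.translateTiling 0 v T) ∂(μ : Measure (R.tilingSpace 0)) ≤
        ∫ T, f T ∂(μ : Measure (R.tilingSpace 0)) := by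
    intro f hf
    refine le_of_forall_pos_le_add fun η hη => ?_
    refine le_of_tendsto_of_tendsto (tendsto_integral_of_tendsto h (hf.comp hτ))
      ((tendsto_integral_of_tendsto h hf).add_const η) ?_
    obtain ⟨C, hC⟩ := isCompact_univ.exists_bound_of_continuousOn hf.continuousOn
    have hC' : ∀ T, |f T| ≤ |C| + 1 := fun T =>
      (hC T (mem_univ T)).trans ((le_abs_self C).trans (by linarith))
    have hC0 : 0 < 2 * (|C| + 1) := by positivity
    filter_upwards [hℱ (hvH.eventually_sum_le (norm_nonneg v)
      (show 0 < η / (2 * (|C| + 1)) by positivity))] with n hn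
    have hmap := Measure.isProbabilityMeasure_map (μ := (ν n : Measure (R.tilingSpace 0)))
      hτ.measurable.aemeasurable
    have h1 := integral_le_of_lintegral_le
      (ν := (ν n : Measure (R.tilingSpace 0)).map (R.translateTiling 0 v))
      (ν' := (ν n : Measure (R.tilingSpace 0))) hf.measurable hC' hη.le ?_
    · rwa [integral_map hτ.measurable.aemeasurable hf.aestronglyMeasurable] at h1
    · have hFm : Measurable fun T => ENNReal.ofReal (f T + (|C| + 1)) := by fun_prop
      rw [lintegral_map hFm hτ.measurable, hν]
      refine (lintegral_translate_sampleMeasure_le (A n) (w n) v hFm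
        (C := ENNReal.ofReal (2 * (|C| + 1))) fun T => ?_).trans (add_le_add_right ?_ _)
      · exact ENNReal.ofReal_le_ofReal (by linarith [le_abs_self (f T), hC' T])
      · calc _ ≤ ENNReal.ofReal (2 * (|C| + 1)) * ENNReal.ofReal (η / (2 * (|C| + 1))) := by
              gcongr
              exact hn _ (hw n)
          _ = ENNReal.ofReal η := by
              rw [← ENNReal.ofReal_mul hC0.le, mul_div_cancel₀ _ hC0.ne']
  refine ⟨hτ.measurable, ?_⟩
  have := Measure.isProbabilityMeasure_map (μ := (μ : Measure (R.tilingSpace 0)))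
    hτ.measurable.aemeasurable
  refine ext_of_forall_integral_eq_of_IsFiniteMeasure fun f => ?_
  rw [integral_map hτ.measurable.aemeasurable f.continuous.aestronglyMeasurable]
  refine le_antisymm (key f f.continuous) ?_
  have h1 := key (fun T => -f T) f.continuous.neg
  simp only [integral_neg] at h1
  linarith

variable (hrec : R.IsRecognizable)

theorem IsSupertileFreq.sum_ofReal_mul_volume {ρ : ∀ n, Fin (R.j n) → ℝ}
    (hρ : R.IsSupertileFreq ρ) (n : ℕ) :
    ∑ k, ENNReal.ofReal (ρ n k) * volume (R.supp n k) = 1 := by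
  have h1 := congrArg ENNReal.ofReal (hρ.normalized n)
  rw [ENNReal.ofReal_sum_of_nonneg fun k _ => mul_nonneg (hρ.nonneg n k) (R.vol_pos n k).le,
    ENNReal.ofReal_one] at h1
  simpa only [ENNReal.ofReal_mul (hρ.nonneg n _), ofReal_vol] using h1

theorem IsSupertileFreq.sum_ofReal_mul_ncard {ρ : ∀ n, Fin (R.j n) → ℝ}
    (hρ : R.IsSupertileFreq ρ) {n N : ℕ} (hnN : n < N) (k : Fin (R.j n)) :
    ∑ K, ENNReal.ofReal (ρ N K) * ({v | (k, v) ∈ R.decomp n N K}.ncard : ℝ≥0∞) =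
      ENNReal.ofReal (ρ n k) := by
  obtain ⟨m, rfl⟩ := Nat.exists_eq_add_of_le hnN.le
  have h1 := congrFun (hρ.consistent n m (by omega)) k
  simp only [Matrix.mulVec, dotProduct, transition_eq_ncard] at h1
  rw [h1, ENNReal.ofReal_sum_of_nonneg fun K _ => mul_nonneg (Nat.cast_nonneg _) (hρ.nonneg _ K)]
  refine Finset.sum_congr rfl fun K _ => ?_
  rw [ENNReal.ofReal_mul (Nat.cast_nonneg _), ENNReal.ofReal_natCast, mul_comm]

/-- For the sample measures of a consistent sequence of frequencies, the mean of the smoothed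
supertile indicator converges to the prescribed frequency. -/
theorem IsRecognizable.tendsto_lintegral_nearOrigin (hvH : R.IsVanHove)
    {ρ : ∀ n, Fin (R.j n) → ℝ} (hρ : R.IsSupertileFreq ρ) {A : ∀ n, Fin (R.j n) → R.tilingSpace 0}
    (hA : ∀ n k, (k, 0) ∈ (hrec.recog n (A n k)).1.tiles) {n : ℕ} {δ : ℝ}
    (hδ : IsSeparating hrec n δ) (k : Fin (R.j n)) :
    Tendsto (fun N => ∫ T, (hrec.nearOrigin n k δ T).toReal
      ∂sampleMeasure N (A N) (fun K => ENNReal.ofReal (ρ N K))) atTop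
      (𝓝 (ρ n k * (∫⁻ v : Space d, bump δ v).toReal)) := by
  have hm : Measurable (hrec.nearOrigin n k δ) :=
    (hrec.isPointProcess_positions n k).measurable_tsum (continuous_bump δ).measurable
  obtain ⟨σ, hσ⟩ := (R.isPrototile_supp n k).isCompact.isBounded.exists_norm_le
  set r := δ + |σ| with hr
  have hr' : ∀ s ∈ R.supp n k, δ + ‖s‖ ≤ r := fun s hs => by
    linarith [hσ s hs, le_abs_self σ]
  have hr0 : 0 ≤ r := add_nonneg hδ.1.le (abs_nonneg σ)
  set G := ∫⁻ v : Space d, bump δ v with hG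
  have hGtop : G ≠ ∞ := lintegral_bump_ne_top hδ.2.1
  refine Metric.tendsto_atTop.2 fun η hη => ?_
  obtain ⟨N₀, hN₀⟩ := eventually_atTop.1 (hvH.eventually_sum_le hr0 (half_pos hη))
  refine ⟨max N₀ (n + 1), fun N hN => ?_⟩
  have hnN : n < N := (le_max_right N₀ (n + 1)).trans hN
  have hw := hρ.sum_ofReal_mul_volume N
  have hb := hN₀ N ((le_max_left _ _).trans hN) _ hw
  have hprob := isProbabilityMeasure_sampleMeasure (A N) hw
  have hLone : ∫⁻ T, hrec.nearOrigin n k δ T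
      ∂sampleMeasure N (A N) (fun K => ENNReal.ofReal (ρ N K)) ≤ 1 :=
    (lintegral_mono fun T => hrec.nearOrigin_le_one hδ k T).trans (by simp)
  rw [integral_toReal hm.aemeasurable (Eventually.of_forall fun T =>
    (hrec.nearOrigin_le_one hδ k T).trans_lt ENNReal.one_lt_top)]
  set Λ := ∫⁻ T, hrec.nearOrigin n k δ T
      ∂sampleMeasure N (A N) (fun K => ENNReal.ofReal (ρ N K)) with hΛ
  have hΛtop : Λ ≠ ∞ := ne_top_of_le_ne_top ENNReal.one_ne_top hLone
  have hΛ' := lintegral_sampleMeasure (A N) (fun K => ENNReal.ofReal (ρ N K)) hm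
  have hcount : ENNReal.ofReal (ρ n k) * G = ∑ K, ENNReal.ofReal (ρ N K) *
      (({v | (k, v) ∈ R.decomp n N K}.ncard : ℝ≥0∞) * G) := by
    rw [← hρ.sum_ofReal_mul_ncard hnN k, Finset.sum_mul]
    exact Finset.sum_congr rfl fun K _ => mul_assoc _ _ _
  have hpair := fun K => hrec.lintegral_nearOrigin hnN.le hδ k hr' (hA N K)
  have h1 : Λ ≤ ENNReal.ofReal (ρ n k) * G + ENNReal.ofReal (η / 2) := by
    rw [hΛ, hΛ', hcount]
    refine le_trans ?_ (add_le_add_right hb _)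
    rw [← Finset.sum_add_distrib]
    refine Finset.sum_le_sum fun K _ => ?_
    rw [← mul_add]
    gcongr
    exact (hpair K).1
  have h2 : ENNReal.ofReal (ρ n k) * G ≤ Λ + ENNReal.ofReal (η / 2) := by
    rw [hΛ, hΛ', hcount]
    refine le_trans ?_ (add_le_add_right hb _)
    rw [← Finset.sum_add_distrib]
    refine Finset.sum_le_sum fun K _ => ?_
    rw [← mul_add]
    gcongr
    exact (hpair K).2
  have hρG : ENNReal.ofReal (ρ n k) * G = ENNReal.ofReal (ρ n k * G.toReal) := by
    rw [ENNReal.ofReal_mul (hρ.nonneg n k), ENNReal.ofReal_toReal hGtop]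
  have hnn : 0 ≤ ρ n k * G.toReal := mul_nonneg (hρ.nonneg n k) ENNReal.toReal_nonneg
  rw [hρG, ← ENNReal.ofReal_toReal hΛtop, ← ENNReal.ofReal_add (by positivity) (by positivity),
    ENNReal.ofReal_le_ofReal_iff (by positivity)] at h1 h2
  rw [Real.dist_eq, abs_lt]
  constructor <;> linarith

/-- Every consistent sequence of supertile frequencies comes from an invariant measure, a limit of
sample measures. -/
theorem IsRecognizable.exists_invariantMeasure [CompactSpace (R.tilingSpace 0)]
    (hprim : R.IsPrimitive) (hne : (R.tilingSpace 0).Nonempty) (hvH : R.IsVanHove)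
    {ρ : ∀ n, Fin (R.j n) → ℝ} (hρ : R.IsSupertileFreq ρ) :
    ∃ μ : R.InvariantMeasure, ∀ n k, (hrec.freq μ n k : ℝ) = ρ n k := by
  choose A hA using hrec.exists_tiling hprim hne
  have hw := hρ.sum_ofReal_mul_volume
  let ν : ℕ → ProbabilityMeasure (R.tilingSpace 0) := fun n =>
    ⟨sampleMeasure n (A n) fun k => ENNReal.ofReal (ρ n k),
      isProbabilityMeasure_sampleMeasure (A n) (hw n)⟩
  obtain ⟨μ, -, hμ⟩ := isCompact_iff_ultrafilter_le_nhds.1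
    (isCompact_univ (X := ProbabilityMeasure (R.tilingSpace 0))) ((hyperfilter ℕ).map ν)
    (by simp)
  have hlim : Tendsto ν (hyperfilter ℕ) (𝓝 μ) := hμ
  have hinv := hvH.measurePreserving_of_tendsto Nat.hyperfilter_le_atTop hlim hw fun _ => rfl
  refine ⟨⟨μ, inferInstance, hinv⟩, fun n k => ?_⟩
  obtain ⟨δ, hδ⟩ := hrec.exists_isSeparating n
  have h1 := tendsto_integral_of_tendsto hlim (hrec.continuous_nearOrigin hδ k)
  have h2 := tendsto_nhds_unique h1
    ((hrec.tendsto_lintegral_nearOrigin hvH hρ hA hδ k).mono_left Nat.hyperfilter_le_atTop)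
  have hm : Measurable (hrec.nearOrigin n k δ) :=
    (hrec.isPointProcess_positions n k).measurable_tsum (continuous_bump δ).measurable
  rw [integral_toReal hm.aemeasurable (Eventually.of_forall fun T =>
    (hrec.nearOrigin_le_one hδ k T).trans_lt ENNReal.one_lt_top)] at h2
  have h3 := hrec.lintegral_positions ⟨μ, inferInstance, hinv⟩ n k
    (continuous_bump (d := d) δ).measurable
  have h4 := h2.symm.trans (congrArg ENNReal.toReal h3)
  rw [ENNReal.toReal_mul, ENNReal.coe_toReal] at h4
  have hG : (∫⁻ v : Space d, bump δ v).toReal ≠ 0 :=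
    (ENNReal.toReal_pos (lintegral_bump_ne_zero hδ.1) (lintegral_bump_ne_top hδ.2.1)).ne'
  exact (mul_right_cancel₀ hG h4).symm

/-! ### The inverse limit of the polytopes -/

theorem decomp_nonempty {n N : ℕ} (hnN : n ≤ N) (l : Fin (R.j N)) : (R.decomp n N l).Nonempty := by
  induction N, hnN using Nat.le_induction with
  | base => exact ⟨_, FusionData.Contains.refl l⟩
  | succ N hN ih =>
    obtain ⟨x, hx⟩ := (R.isPatch_fusion N l).isConnected.nonempty
    simp only [cover, mem_iUnion] at hx
    obtain ⟨s, hs, -⟩ := hx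
    obtain ⟨t, ht⟩ := ih s.1
    exact ⟨_, FusionData.Contains.step hs ht⟩

theorem transition_nonneg (n m : ℕ) (k : Fin (R.j n)) (l : Fin (R.j (n + m))) :
    0 ≤ R.transition n m k l := by
  rw [transition_eq_ncard]
  positivity

theorem sum_transition_mul_vol_pos (n m : ℕ) (l : Fin (R.j (n + m))) :
    0 < ∑ k, R.transition n m k l * R.vol n k := by
  obtain ⟨⟨k, v⟩, hv⟩ := decomp_nonempty (Nat.le_add_right n m) l
  refine Finset.sum_pos' (fun k _ => mul_nonneg (transition_nonneg n m k l) (R.vol_pos n k).le)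
    ⟨k, Finset.mem_univ k, mul_pos ?_ (R.vol_pos n k)⟩
  rw [transition_eq_ncard, Nat.cast_pos]
  exact (ncard_pos (finite_setOf_mem_decomp (Nat.le_add_right n m) k l)).2 ⟨v, hv⟩

theorem polytope_subset (n m : ℕ) :
    R.polytope n m ⊆ {x | (∀ k, 0 ≤ x k) ∧ ∑ k, x k * R.vol n k = 1} := by
  refine convexHull_min ?_ ?_
  · rintro _ ⟨l, rfl⟩
    have hpos := sum_transition_mul_vol_pos n m l
    refine ⟨fun k => div_nonneg (transition_nonneg n m k l) hpos.le, ?_⟩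
    simp only [Matrix.col_apply, direction, div_mul_eq_mul_div]
    rw [← Finset.sum_div, div_self hpos.ne']
  · rintro x ⟨hx, hx1⟩ y ⟨hy, hy1⟩ a b ha hb hab
    refine ⟨fun k => add_nonneg (mul_nonneg ha (hx k)) (mul_nonneg hb (hy k)), ?_⟩
    simp only [Pi.add_apply, Pi.smul_apply, smul_eq_mul, add_mul, Finset.sum_add_distrib, mul_assoc,
      ← Finset.mul_sum, hx1, hy1, mul_one, hab]

/-- The vectors of a consistent sequence are convex combinations of the normalized columns, the
weight of a column being the fraction of volume that the supertiles of its type occupy. -/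
theorem isSupertileFreq_iff_mem_inverseLimit {ρ : ∀ n, Fin (R.j n) → ℝ} :
    R.IsSupertileFreq ρ ↔ ρ ∈ R.inverseLimit := by
  constructor
  · intro h
    refine ⟨fun n => mem_iInter₂.2 fun m hm => ?_, fun n m hm => (h.consistent n m hm).symm⟩
    have hsum : ∑ l, ρ (n + m) l * (∑ k, R.transition n m k l * R.vol n k) = 1 := by
      rw [← h.normalized n, h.consistent n m hm]
      simp only [Matrix.mulVec, dotProduct, Finset.mul_sum, Finset.sum_mul]
      rw [Finset.sum_comm]
      exact Finset.sum_congr rfl fun k _ => Finset.sum_congr rfl fun l _ => by ring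
    have hcomb : ρ n = ∑ l, (ρ (n + m) l * (∑ k, R.transition n m k l * R.vol n k)) •
        (R.direction n m).col l := by
      funext i
      conv_lhs => rw [h.consistent n m hm]
      simp only [Matrix.mulVec, dotProduct, Finset.sum_apply, Pi.smul_apply, smul_eq_mul,
        Matrix.col_apply, direction]
      refine Finset.sum_congr rfl fun l _ => ?_
      rw [mul_assoc, mul_div_cancel₀ _ (sum_transition_mul_vol_pos n m l).ne', mul_comm]
    rw [hcomb]
    exact (convex_convexHull ℝ _).sum_mem
      (fun l _ => mul_nonneg (h.nonneg _ l) (sum_transition_mul_vol_pos n m l).le) hsum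
      fun l _ => subset_convexHull ℝ _ ⟨l, rfl⟩
  · rintro ⟨h1, h2⟩
    have h3 := fun n => polytope_subset n 1 (mem_iInter₂.1 (h1 n) 1 one_pos)
    exact ⟨fun n => (h3 n).1, fun n => (h3 n).2, fun n m hm => (h2 n m hm).symm⟩

end FusionRule

end FusionTiling

theorem theorem3p2 {d : ℕ} (R : FusionTiling.FusionRule d)
    (hne : (R.tilingSpace 0).Nonempty) (hFLC : R.HasFLC)
    (hrec : R.IsRecognizable) (hprim : R.IsPrimitive) (hvH : R.IsVanHove) :
    ∃ e : R.InvariantMeasure ≃ {ρ : ∀ n, Fin (R.j n) → ℝ // R.IsSupertileFreq ρ},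
      (∀ (μ : R.InvariantMeasure) (P : Set (Fin (R.j 0) × FusionTiling.Space d)),
        FusionTiling.IsPatch (R.supp 0) P →
          ∃ f : ℝ, R.HasFreq μ P f ∧
            Filter.Tendsto (fun n => ∑ i, (R.count P n i : ℝ) * (e μ).1 n i)
              Filter.atTop (nhds f)) ∧
      ∃ e' : R.InvariantMeasure ≃ R.inverseLimit, ∀ μ, (e' μ).1 = (e μ).1 := by
  have : CompactSpace (R.tilingSpace 0) :=
    isCompact_iff_compactSpace.1 (hrec.isCompact_tilingSpace hprim hFLC hne)
  let e : R.InvariantMeasure ≃ {ρ : ∀ n, Fin (R.j n) → ℝ // R.IsSupertileFreq ρ} :=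
    Equiv.ofBijective (fun μ => ⟨fun n k => hrec.freq μ n k, hrec.isSupertileFreq μ⟩) <| by
      refine ⟨fun μ ν h => hrec.eq_of_freq_eq hprim hne hvH fun n k => ?_, fun ρ => ?_⟩
      · exact NNReal.coe_injective (congrFun (congrFun (congrArg Subtype.val h) n) k)
      · obtain ⟨μ, hμ⟩ := hrec.exists_invariantMeasure hprim hne hvH ρ.2
        exact ⟨μ, Subtype.ext (funext fun n => funext (hμ n))⟩
  exact ⟨e, fun μ P hP => hrec.exists_hasFreq hvH μ hP,
    e.trans (Equiv.subtypeEquivRight fun ρ =>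
      FusionTiling.FusionRule.isSupertileFreq_iff_mem_inverseLimit), fun μ => rfl⟩
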